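/- **Graphs.** Labels are pairs (list, mark); lists are finite sequences of atoms, an atom being an integer or a string over the printable ASCII characters other than the double quote (an atom is identified with the one-element list, a character with the one-letter string). Node marks are none, red, green, blue, grey; edge marks are none, red, green, blue, dashed. A *host graph* is a finite directed graph with a label at each node and edge and a root flag at each node. Morphisms preserve sources, targets, and (where defined) labels and root flags. **Rule schemata.** A conditional rule schema $r=\langle L\leftarrow K\rightarrow R,\Gamma\rangle$ consists of two finite graphs $L,R$ whose lists are replaced by list expressions over typed variables (types list, atom, int, string, char; with $+,-,*,/$, length, concatenations, and the degree operators $\mathsf{indeg}(v),\mathsf{outdeg}(v)$ for nodes $v$ of $L$), and whose marks may be the wildcard any; an interface $K\subseteq L,R$ consisting of nodes only, with labels and roots undefined; and an application condition $\Gamma$, a Boolean combination of typing tests, (in)equations of lists, comparisons of integers and tests for edges between nodes of $L$. Expressions in $L$ are simple (no arithmetic operator, at most one list variable, at most one string variable in each string subexpression), all variables in $R$ and $\Gamma$ occur in $L$, and any occurs in $R$ only at interface nodes, or at edge identifiers shared with $L$, that are also marked any in $L$. Given a host graph $G$, an injective map $g\colon L\to G$ preserving sources, targets and root flags, and a label assignment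 $\alpha$ (values for the variables in their domains, and marks different from none for the wildcards), the instances $L^{g,\alpha},R^{g,\alpha},\Gamma^{g,\alpha}$ are obtained by evaluation, the degree operators being evaluated in $G$ at $g(v)$ (division truncates, and $x/0=0$). One writes $G\Rightarrow_r H$ if for some $g,\alpha$ the map $g\colon L^{g,\alpha}\to G$ preserves labels, $\Gamma^{g,\alpha}$ is true, and there are morphisms such that both squares of $(L^{g,\alpha}\leftarrow K\to R^{g,\alpha})$ over $(G\leftarrow D\to H)$ are pushouts and pullbacks, for some graph $D$ with partially defined node labels and root flags. **Formulas.** First-order formulas are built from true, false and atomic formulas by $\wedge,\vee,\neg$ and quantifiers $\exists_V,\exists_E,\exists_L$ over nodes, edges and lists. Terms use sources $s$, targets $t$, node and edge labels $l_V,l_E$ and marks $m_V,m_E$, in- and outdegrees, and the operators on lists, strings and integers; atomic formulas are typing predicates, rootedness, integer comparisons, (in)equations of nodes, edges, lists and marks (where any matches every mark other than none); $\mathsf{edge}(u,v,\dots)$ states the existence of an edge. An atomic formula with a term that has no value is false. A *condition over* a rule graph is a formula with its nodes and edges as additional constants and its variables as free label variables. **The formula $\mathrm{Slp}(c,r^{-1})$.**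 A generalised rule is $w=\langle L\leftarrow K\to R,ac_L,ac_R\rangle$ with conditions $ac_L$ over $L$ and $ac_R$ over $R$; its inverse is $w^{-1}=\langle R\leftarrow K\to L,ac_R,ac_L\rangle$. Let $r^\vee=\langle L\leftarrow K\to R,\Gamma^\vee,\mathsf{true}\rangle$, where $\Gamma^\vee$ is $\Gamma$ read as a condition over $L$. For a generalised rule $w$ (with graphs named $L,R$ again) and a closed formula $c$: * $\mathrm{Split}(c)$ commutes with the Boolean connectives and $\exists_L$ and fixes atomic formulas. It replaces $\exists_V x\,c_1$ by $\bigvee_{v\in V_L}\mathrm{Split}(c_1^{[x\mapsto v]})\vee\exists_V x(\bigwedge_{v\in V_L}x\ne v\wedge\mathrm{Split}(c_1))$, and $\exists_E x\,c_1$ by $\bigvee_{e\in E_L}\mathrm{Split}(c_1^{[x\mapsto e]})\vee\exists_E x(\bigwedge_{e\in E_L}x\neq e\wedge\mathrm{inc})$. Here $\mathrm{inc}$ is the disjunction, over the cases in which each of $s(x),t(x)$ is a given node of $L$ or is no node of $L$, of the description of the case and $\mathrm{Split}(c_1)$ with $s(x),t(x)$ replaced by the nodes that they equal. * $\mathrm{Dang}(L\leftarrow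 K\to R)=\bigwedge_{v\in V_L\setminus V_K}(\mathsf{indeg}(v)=\mathrm{indeg}_L(v)\wedge\mathsf{outdeg}(v)=\mathrm{outdeg}_L(v))$. * $\mathrm{Val}$ replaces terms with constant arguments, as well as rootedness of constants and comparisons of constants and of known marks, by their values in $L$. For $v\in V_K$, $\mathsf{indeg}(v)$ becomes $\mathsf{incon}(v)+\mathrm{indeg}_L(v)$ (likewise for outdegrees); a mark that is any in both $L$ and $R$ is kept as a term; degree operators inside the rule's own expressions keep referring to the host graph containing the match of the original left-hand side. Negations are pushed through $\mathsf{true},\mathsf{false},\neg,\wedge,\vee$. * $\mathrm{Lift}(c,w)=\mathrm{Val}(\mathrm{Split}(c\wedge ac_L)\wedge\mathrm{Dang}(L\leftarrow K\to R))$. * $\mathrm{Adj}$ replaces $\mathsf{incon}(v)$ by $\mathsf{indeg}(v)-\mathrm{indeg}_R(v)$ (likewise for $\mathsf{outcon}$), equations (inequations) with a node of $V_L\setminus V_K$ or an edge of $L$ as a side by false (true), and relativises $\exists_V,\exists_E$ to nodes outside $V_R\setminus V_K$ and edges outside $E_R$. * $\mathrm{Spec}(R)$ is the conjunction of the typing predicates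 of the variables and of all facts $l_V(v)=\dots$, $m_V(v)=\dots$, $(\neg)\mathsf{root}(v)$, $s(e)=\dots$, $t(e)=\dots$, $l_E(e)=\dots$, $m_E(e)=\dots$ given by $R$. * $\mathrm{Shift}(c,w)=\mathrm{Adj}(\mathrm{Lift}(c,w))\wedge ac_R\wedge\mathrm{Spec}(R)\wedge\mathrm{Dang}(R\leftarrow K\to L)$. * $\mathrm{Post}(c,w)$ is obtained from $\mathrm{Shift}(c,w)$ by replacing the node and edge constants by pairwise distinct fresh variables, stating that they are different, and existentially quantifying all these variables and all free label variables. Finally $\mathrm{Slp}(c,r^{-1})=\mathrm{Post}(c,(r^\vee)^{-1})$. **Weakest liberal preconditions.** An assertion (a predicate on host graphs) $c$ is a liberal precondition with respect to $r$ and $d$ if for all host graphs $G,H$: $G\vDash c$ and $G\Rightarrow_r H$ imply $H\vDash d$. A weakest liberal precondition $\mathrm{WLP}(r,d)$ is a liberal precondition that is implied by every liberal precondition with respect to $r$ and $d$. **Lemma.** Let $d$ be a closed first-order formula and $r$ a conditional rule schema. Then the closed first-order formula $\neg\mathrm{Slp}(\neg d,r^{-1})$ defines a weakest liberal precondition with respect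 to $r$ and $d$, and for every weakest liberal precondition $\mathrm{WLP}(r,d)$ and all host graphs $G$, $$G\vDash\neg\mathrm{Slp}(\neg d,r^{-1})\quad\text{if and only if}\quad G\vDash\mathrm{WLP}(r,d).$$ -/

import Mathlib

namespace GP2

/-! ## Label values, marks -/

/-- Printable ASCII characters except the double quote. -/
abbrev GPChar : Type := {c : ℕ // c = 32 ∨ c = 33 ∨ (35 ≤ c ∧ c ≤ 126)}

inductive GPAtom : Type
  | int (z : ℤ)
  | str (s : List GPChar)
  deriving DecidableEq

/-- Host graph lists (values): heterogeneous lists of integers and character strings.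
Atoms are identified with lists of length one, characters with strings of length one. -/
abbrev GPList : Type := List GPAtom

/-- The types of label variables. -/
inductive LSort : Type
  | list | atom | int | string | char
  deriving DecidableEq

/-- The domain of each type, as a set of lists. -/
def LSort.dom : LSort → Set GPList
  | .list => Set.univ
  | .atom => {l | ∃ a, l = [a]}
  | .int => {l | ∃ z, l = [.int z]}
  | .string => {l | ∃ s, l = [.str s]}
  | .char => {l | ∃ c, l = [.str [c]]}

def asInt : GPList → Option ℤ
  | [.int z] => some z
  | _ => none

def asStr : GPList → Option (List GPChar)
  | [.str s] => some s
  | _ => none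

def asChar : GPList → Option (List GPChar)
  | [.str [c]] => some [c]
  | _ => none

def asAtom : GPList → Option GPAtom
  | [a] => some a
  | _ => none

/-- The length of an atom: strings have their string length, an integer is a list of length one. -/
def GPAtom.length : GPAtom → ℤ
  | .int _ => 1
  | .str s => s.length

inductive VMark : Type
  | none | red | green | blue | grey
  deriving DecidableEq

inductive EMark : Type
  | none | red | green | blue | dashed
  deriving DecidableEq

/-- Marks together with the wildcard `any`. -/
inductive Wild (M : Type) : Type
  | mk (m : M)
  | any
  deriving DecidableEq

/-- Equality of marks, where `any` stands for an arbitrary mark different from `none`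
(which is passed as the argument `nomark`). -/
def Wild.agree {M : Type} [DecidableEq M] (nomark : M) : Wild M → Wild M → Bool
  | .mk a, .mk b => decide (a = b)
  | .mk a, .any => decide (a ≠ nomark)
  | .any, .mk b => decide (b ≠ nomark)
  | .any, .any => true

inductive EqOp : Type
  | eq | ne
  deriving DecidableEq

def EqOp.holds : EqOp → Prop → Prop
  | .eq, P => P
  | .ne, P => ¬ P

inductive CmpOp : Type
  | lt | le | gt | ge
  deriving DecidableEq

def CmpOp.holds : CmpOp → ℤ → ℤ → Prop
  | .lt, x, y => x < y
  | .le, x, y => x ≤ y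
  | .gt, x, y => x > y
  | .ge, x, y => x ≥ y

/-! ## Graphs and morphisms -/

/-- Finite graphs labelled with host graph labels, where node labels (list and mark) and rootedness
may be undefined at some nodes. -/
structure PGraph : Type 1 where
  V : Type
  E : Type
  finV : Finite V
  finE : Finite E
  src : E → V
  tgt : E → V
  labV : V → Option (GPList × VMark)
  labE : E → GPList × EMark
  root : V → Option Bool

/-- Graph morphisms preserve sources, targets, labels, roots and non-roots (where defined). -/
@[ext]
structure PGraph.Hom (G H : PGraph) : Type where
  fV : G.V → H.V
  fE : G.E → H.E
  src : ∀ e, H.src (fE e) = fV (G.src e)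
  tgt : ∀ e, H.tgt (fE e) = fV (G.tgt e)
  labV : ∀ v l, G.labV v = some l → H.labV (fV v) = some l
  labE : ∀ e, H.labE (fE e) = G.labE e
  root : ∀ v b, G.root v = some b → H.root (fV v) = some b

def PGraph.Hom.id (G : PGraph) : PGraph.Hom G G where
  fV := fun v => v
  fE := fun e => e
  src := fun _ => rfl
  tgt := fun _ => rfl
  labV := fun _ _ h => h
  labE := fun _ => rfl
  root := fun _ _ h => h

def PGraph.Hom.comp {G H J : PGraph} (f : PGraph.Hom G H) (g : PGraph.Hom H J) :
    PGraph.Hom G J where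
  fV := fun v => g.fV (f.fV v)
  fE := fun e => g.fE (f.fE e)
  src := fun e => by rw [g.src, f.src]
  tgt := fun e => by rw [g.tgt, f.tgt]
  labV := fun v l h => g.labV _ _ (f.labV v l h)
  labE := fun e => by rw [g.labE, f.labE]
  root := fun v b h => g.root _ _ (f.root v b h)

instance : CategoryTheory.Category PGraph where
  Hom := PGraph.Hom
  id := PGraph.Hom.id
  comp := PGraph.Hom.comp

/-- Host graphs: all labelling functions are total. -/
structure HostGraph : Type 1 where
  V : Type
  E : Type
  finV : Finite V
  finE : Finite E
  src : E → V
  tgt : E → V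
  labV : V → GPList
  markV : V → VMark
  labE : E → GPList
  markE : E → EMark
  root : V → Bool

def HostGraph.toPGraph (G : HostGraph) : PGraph where
  V := G.V
  E := G.E
  finV := G.finV
  finE := G.finE
  src := G.src
  tgt := G.tgt
  labV := fun v => some (G.labV v, G.markV v)
  labE := fun e => (G.labE e, G.markE e)
  root := fun v => some (G.root v)

noncomputable def HostGraph.indeg (G : HostGraph) (v : G.V) : ℤ :=
  (Nat.card {e : G.E // G.tgt e = v} : ℤ)

noncomputable def HostGraph.outdeg (G : HostGraph) (v : G.V) : ℤ :=
  (Nat.card {e : G.E // G.src e = v} : ℤ)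

/-! ## Rule expressions

The label variables of a rule are declared as `Fin p` with types `τ`, and `I` is the set of node
identifiers to which degree operators may refer. -/

/-- The declared variables of type `s`. -/
abbrev TVar {p : ℕ} (τ : Fin p → LSort) (s : LSort) : Type := {x : Fin p // τ x = s}

inductive IntExp {p : ℕ} (τ : Fin p → LSort) (I : Finset ℕ) : Type
  | num (z : ℤ)
  | var (x : TVar τ .int)
  | add (a b : IntExp τ I)
  | sub (a b : IntExp τ I)
  | mul (a b : IntExp τ I)
  | div (a b : IntExp τ I)
  | indeg (v : I)
  | outdeg (v : I)
  | lenA (x : TVar τ .atom)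
  | lenS (x : TVar τ .string)
  | lenL (x : TVar τ .list)

inductive StrExp {p : ℕ} (τ : Fin p → LSort) : Type
  | lit (s : List GPChar)
  | charVar (x : TVar τ .char)
  | strVar (x : TVar τ .string)
  | cat (a b : StrExp τ)

/-- List expressions: the set of rule graph lists. -/
inductive LExp {p : ℕ} (τ : Fin p → LSort) (I : Finset ℕ) : Type
  | empty
  | int (e : IntExp τ I)
  | str (e : StrExp τ)
  | atomVar (x : TVar τ .atom)
  | listVar (x : TVar τ .list)
  | app (a b : LExp τ I)

section Expressions

variable {p : ℕ} {τ : Fin p → LSort} {I : Finset ℕ}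

def IntExp.vars : IntExp τ I → Set (Fin p)
  | .num _ => ∅
  | .var x => {x.1}
  | .add a b => a.vars ∪ b.vars
  | .sub a b => a.vars ∪ b.vars
  | .mul a b => a.vars ∪ b.vars
  | .div a b => a.vars ∪ b.vars
  | .indeg _ => ∅
  | .outdeg _ => ∅
  | .lenA x => {x.1}
  | .lenS x => {x.1}
  | .lenL x => {x.1}

def StrExp.vars : StrExp τ → Set (Fin p)
  | .lit _ => ∅
  | .charVar x => {x.1}
  | .strVar x => {x.1}
  | .cat a b => a.vars ∪ b.vars

/-- The variables occurring in a list expression. -/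
def LExp.vars : LExp τ I → Set (Fin p)
  | .empty => ∅
  | .int e => e.vars
  | .str e => e.vars
  | .atomVar x => {x.1}
  | .listVar x => {x.1}
  | .app a b => a.vars ∪ b.vars

/-- No arithmetic operator occurs. -/
def IntExp.NoArith : IntExp τ I → Prop
  | .add _ _ => False
  | .sub _ _ => False
  | .mul _ _ => False
  | .div _ _ => False
  | _ => True

/-- The number of occurrences of list variables in an integer expression without arithmetic. -/
def IntExp.listVarCount : IntExp τ I → ℕ
  | .lenL _ => 1
  | _ => 0

def StrExp.strVarCount : StrExp τ → ℕ
  | .strVar _ => 1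
  | .cat a b => a.strVarCount + b.strVarCount
  | _ => 0

def LExp.listVarCount : LExp τ I → ℕ
  | .int e => e.listVarCount
  | .listVar _ => 1
  | .app a b => a.listVarCount + b.listVarCount
  | _ => 0

/-- No arithmetic operators, and at most one string variable in each string subexpression. -/
def LExp.SimpleParts : LExp τ I → Prop
  | .int e => e.NoArith
  | .str e => e.strVarCount ≤ 1
  | .app a b => a.SimpleParts ∧ b.SimpleParts
  | _ => True

/-- Simple expressions. -/
def LExp.Simple (e : LExp τ I) : Prop := e.SimpleParts ∧ e.listVarCount ≤ 1

/-- Evaluation of expressions with respect to the values `val` of the variables and the map `g`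
sending node identifiers to nodes of the host graph `G`. The values are always members of the
domains of the variables, so the defaults below are never used. Division truncates, and division
by zero yields zero. -/
noncomputable def IntExp.eval (G : HostGraph) (g : I → G.V) (val : Fin p → GPList) :
    IntExp τ I → ℤ
  | .num z => z
  | .var x => (asInt (val x.1)).getD 0
  | .add a b => a.eval G g val + b.eval G g val
  | .sub a b => a.eval G g val - b.eval G g val
  | .mul a b => a.eval G g val * b.eval G g val
  | .div a b => Int.tdiv (a.eval G g val) (b.eval G g val)
  | .indeg v => G.indeg (g v)
  | .outdeg v => G.outdeg (g v)
  | .lenA x => ((asAtom (val x.1)).map GPAtom.length).getD 0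
  | .lenS x => (((asStr (val x.1)).getD []).length : ℤ)
  | .lenL x => ((val x.1).length : ℤ)

def StrExp.eval (val : Fin p → GPList) : StrExp τ → List GPChar
  | .lit s => s
  | .charVar x => (asChar (val x.1)).getD []
  | .strVar x => (asStr (val x.1)).getD []
  | .cat a b => a.eval val ++ b.eval val

noncomputable def LExp.eval (G : HostGraph) (g : I → G.V) (val : Fin p → GPList) :
    LExp τ I → GPList
  | .empty => []
  | .int e => [.int (e.eval G g val)]
  | .str e => [.str (e.eval val)]
  | .atomVar x => val x.1
  | .listVar x => val x.1
  | .app a b => a.eval G g val ++ b.eval G g val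

end Expressions

/-! ## Application conditions of rule schemata -/

/-- Application conditions. In `edge u v l m`, the list `l` and the mark `m` are optional. -/
inductive Cond {p : ℕ} (τ : Fin p → LSort) (I : Finset ℕ) : Type
  | typ (s : LSort) (x : Fin p)
  | listRel (o : EqOp) (a b : LExp τ I)
  | cmp (o : CmpOp) (a b : IntExp τ I)
  | edge (u v : I) (l : Option (LExp τ I × Option (Wild EMark)))
  | not (c : Cond τ I)
  | and (c c' : Cond τ I)
  | or (c c' : Cond τ I)

def Cond.holds {p : ℕ} {τ : Fin p → LSort} {I : Finset ℕ} (G : HostGraph) (g : I → G.V)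
    (val : Fin p → GPList) : Cond τ I → Prop
  | .typ s x => val x ∈ s.dom
  | .listRel o a b => o.holds (a.eval G g val = b.eval G g val)
  | .cmp o a b => o.holds (a.eval G g val) (b.eval G g val)
  | .edge u v l => ∃ e : G.E, G.src e = g u ∧ G.tgt e = g v ∧
      ∀ q ∈ l, G.labE e = q.1.eval G g val ∧
        ∀ m ∈ q.2, Wild.agree EMark.none (.mk (G.markE e)) m = true
  | .not c => ¬ c.holds G g val
  | .and c c' => c.holds G g val ∧ c'.holds G g val
  | .or c c' => c.holds G g val ∨ c'.holds G g val

/-! ## Rule graphs and rule schemata -/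

/-- Total rule graphs with node identifiers `V` and edge identifiers `E`; the degree operators in
their expressions refer to identifiers in `I`. -/
structure RuleGraph {p : ℕ} (τ : Fin p → LSort) (V E I : Finset ℕ) : Type where
  src : E → V
  tgt : E → V
  labV : V → LExp τ I
  markV : V → Wild VMark
  labE : E → LExp τ I
  markE : E → Wild EMark
  root : V → Bool

section RuleGraphs

variable {p : ℕ} {τ : Fin p → LSort} {V E I : Finset ℕ}

def RuleGraph.indeg (M : RuleGraph τ V E I) (v : V) : ℤ :=
  ((Finset.univ.filter (fun e => M.tgt e = v)).card : ℤ)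

def RuleGraph.outdeg (M : RuleGraph τ V E I) (v : V) : ℤ :=
  ((Finset.univ.filter (fun e => M.src e = v)).card : ℤ)

/-- The variables occurring in a rule graph. -/
def RuleGraph.vars (M : RuleGraph τ V E I) : Set (Fin p) :=
  {x | (∃ v, x ∈ (M.labV v).vars) ∨ ∃ e, x ∈ (M.labE e).vars}

end RuleGraphs

/-- Conditional rule schemata `⟨L ← K → R, Γ⟩`. The interface consists of the nodes `VK`. Degree
operators refer to nodes of the left-hand graph, because expressions are evaluated by means of a
match of that graph. The declared variables are the variables of the left-hand graph, so that
all variables in `R` and `Γ` occur in `L`. The wildcard `any` may occur in the right-hand graph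
only at nodes of the interface and at edge identifiers shared with `L` that are marked `any` in
`L`, since otherwise it has no instance. -/
structure RuleSchema : Type where
  p : ℕ
  τ : Fin p → LSort
  VL : Finset ℕ
  EL : Finset ℕ
  VR : Finset ℕ
  ER : Finset ℕ
  VK : Finset ℕ
  KL : VK ⊆ VL
  KR : VK ⊆ VR
  L : RuleGraph τ VL EL VL
  R : RuleGraph τ VR ER VL
  Γ : Cond τ VL
  simpleV : ∀ v, (L.labV v).Simple
  simpleE : ∀ e, (L.labE e).Simple
  occurs : ∀ x, x ∈ L.vars
  anyV : ∀ v : VR, R.markV v = .any → ∃ h : v.1 ∈ VK, L.markV ⟨v.1, KL h⟩ = .any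
  anyE : ∀ e : ER, R.markE e = .any → ∃ h : e.1 ∈ EL, L.markE ⟨e.1, h⟩ = .any

/-- The interface graph: nodes only, with labels and roots undefined. -/
def interfaceGraph (VK : Finset ℕ) : PGraph where
  V := VK
  E := Empty
  finV := inferInstance
  finE := inferInstance
  src := Empty.elim
  tgt := Empty.elim
  labV := fun _ => none
  labE := Empty.elim
  root := fun _ => none

/-- Label assignments: values of the variables in their domains, and marks different from `none`
for the identifiers marked `any` (only the values at these identifiers matter). -/
structure LabelAssignment {p : ℕ} (τ : Fin p → LSort) : Type where
  val : Fin p → GPList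
  val_mem : ∀ x, val x ∈ (τ x).dom
  muV : ℕ → VMark
  muE : ℕ → EMark
  muV_ne : ∀ v, muV v ≠ .none
  muE_ne : ∀ e, muE e ≠ .none

/-- Replacement of the wildcard mark by `m`. -/
def Wild.resolve {M : Type} (m : M) : Wild M → M
  | .mk a => a
  | .any => m

/-- The instance of a rule graph. -/
noncomputable def RuleGraph.inst {p : ℕ} {τ : Fin p → LSort} {V E I : Finset ℕ}
    (M : RuleGraph τ V E I) (G : HostGraph) (g : I → G.V) (α : LabelAssignment τ) :
    HostGraph where
  V := V
  E := E
  finV := inferInstance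
  finE := inferInstance
  src := M.src
  tgt := M.tgt
  labV := fun v => (M.labV v).eval G g α.val
  markV := fun v => (M.markV v).resolve (α.muV v.1)
  labE := fun e => (M.labE e).eval G g α.val
  markE := fun e => (M.markE e).resolve (α.muE e.1)
  root := M.root

/-- Injective premorphisms from a rule graph to a host graph. -/
structure RuleGraph.Premorphism {p : ℕ} {τ : Fin p → LSort} {V E I : Finset ℕ}
    (M : RuleGraph τ V E I) (G : HostGraph) : Type where
  fV : V → G.V
  fE : E → G.E
  src : ∀ e, G.src (fE e) = fV (M.src e)
  tgt : ∀ e, G.tgt (fE e) = fV (M.tgt e)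
  root : ∀ v, G.root (fV v) = M.root v
  injV : Function.Injective fV
  injE : Function.Injective fE

open CategoryTheory in
/-- The inclusion of the interface into an instance of a rule graph. -/
noncomputable def interfaceIncl {p : ℕ} {τ : Fin p → LSort} {V E I VK : Finset ℕ} (h : VK ⊆ V)
    (M : RuleGraph τ V E I) (G : HostGraph) (g : I → G.V) (α : LabelAssignment τ) :
    interfaceGraph VK ⟶ (M.inst G g α).toPGraph :=
  PGraph.Hom.mk (G := interfaceGraph VK) (H := (M.inst G g α).toPGraph)
    (fun v => ⟨v.1, h v.2⟩) (fun e => Empty.elim e)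
    (fun e => Empty.elim e) (fun e => Empty.elim e)
    (fun _ _ hl => Option.noConfusion rfl (heq_of_eq hl)) (fun e => Empty.elim e)
    (fun _ _ hl => Option.noConfusion rfl (heq_of_eq hl))

open CategoryTheory in
/-- `G` directly derives `H` by `r` and the injective premorphism `g`: for some label assignment,
`g` is a label preserving morphism on the instance of `L`, the instance of `Γ` is true, and there
is a natural double-pushout, i.e. both squares are pushouts as well as pullbacks. -/
def RuleSchema.DirectDerivation (r : RuleSchema) (G H : HostGraph)
    (g : r.L.Premorphism G) : Prop :=
  ∃ (α : LabelAssignment r.τ) (m : (r.L.inst G g.fV α).toPGraph ⟶ G.toPGraph),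
    m.fV = g.fV ∧ m.fE = g.fE ∧ r.Γ.holds G g.fV α.val ∧
    ∃ (D : PGraph) (k : interfaceGraph r.VK ⟶ D) (dG : D ⟶ G.toPGraph)
      (dH : D ⟶ H.toPGraph) (gs : (r.R.inst G g.fV α).toPGraph ⟶ H.toPGraph),
      IsPushout (interfaceIncl r.KL r.L G g.fV α) k m dG ∧
      IsPullback (interfaceIncl r.KL r.L G g.fV α) k m dG ∧
      IsPushout (interfaceIncl r.KR r.R G g.fV α) k gs dH ∧
      IsPullback (interfaceIncl r.KR r.R G g.fV α) k gs dH

/-- The proper results of executing the program consisting of a call of `r`. -/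
def RuleSchema.results (r : RuleSchema) (G : HostGraph) : Set HostGraph :=
  {H | ∃ g : r.L.Premorphism G, r.DirectDerivation G H g}

/-! ## Liberal preconditions

An assertion is a predicate on host graphs, and a program enters through the map `sem` sending a
host graph to the set of graphs that may result from it. -/

def IsLiberalPre (sem : HostGraph → Set HostGraph) (d c : HostGraph → Prop) : Prop :=
  ∀ G H, c G → H ∈ sem G → d H

/-- Weakest liberal preconditions: those implied by all liberal preconditions. -/
def IsWLP (sem : HostGraph → Set HostGraph) (d c : HostGraph → Prop) : Prop :=
  IsLiberalPre sem d c ∧ ∀ c', IsLiberalPre sem d c' → ∀ G, c' G → c G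

/-! ## First-order formulas

Bound variables are de Bruijn indices: a term in scope of `n` node, `m` edge and `k` label
quantifiers uses variables from `Fin n`, `Fin m` and `Fin k`, with index `0` for the innermost
one. The signature `σ` provides the free symbols: node and edge constants (identifiers of a rule
graph), free label variables, and auxiliary integer symbols that are used only in intermediate
steps of the construction below. -/

structure Sig : Type 1 where
  nd : Type
  ed : Type
  lb : Type
  cn : Type

/-- The signature of closed formulas. -/
abbrev Sig.closed : Sig := ⟨Empty, Empty, Empty, Empty⟩

inductive ETerm (σ : Sig) (m : ℕ) : Type
  | const (e : σ.ed)
  | var (i : Fin m)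

inductive NTerm (σ : Sig) (n m : ℕ) : Type
  | const (v : σ.nd)
  | var (i : Fin n)
  | src (e : ETerm σ m)
  | tgt (e : ETerm σ m)

inductive LVar (X : Type) (k : ℕ) : Type
  | free (x : X)
  | var (i : Fin k)

inductive ITerm (σ : Sig) (n m k : ℕ) : Type
  | num (z : ℤ)
  | var (x : LVar σ.lb k)
  | add (a b : ITerm σ n m k)
  | sub (a b : ITerm σ n m k)
  | mul (a b : ITerm σ n m k)
  | div (a b : ITerm σ n m k)
  | indeg (t : NTerm σ n m)
  | outdeg (t : NTerm σ n m)
  | lenA (x : LVar σ.lb k)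
  | lenS (x : LVar σ.lb k)
  | lenL (x : LVar σ.lb k)
  | sym (c : σ.cn)

inductive STerm (X : Type) (k : ℕ) : Type
  | lit (s : List GPChar)
  | charVar (x : LVar X k)
  | strVar (x : LVar X k)
  | cat (a b : STerm X k)

inductive LTerm (σ : Sig) (n m k : ℕ) : Type
  | empty
  | int (t : ITerm σ n m k)
  | str (t : STerm σ.lb k)
  | atomVar (x : LVar σ.lb k)
  | listVar (x : LVar σ.lb k)
  | app (a b : LTerm σ n m k)
  | labV (t : NTerm σ n m)
  | labE (t : ETerm σ m)

inductive VMTerm (σ : Sig) (n m : ℕ) : Type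
  | lit (q : Wild VMark)
  | mark (t : NTerm σ n m)

inductive EMTerm (σ : Sig) (m : ℕ) : Type
  | lit (q : Wild EMark)
  | mark (t : ETerm σ m)

inductive Atomic (σ : Sig) (n m k : ℕ) : Type
  | typ (s : LSort) (x : LVar σ.lb k)
  | root (t : NTerm σ n m)
  | cmp (o : CmpOp) (a b : ITerm σ n m k)
  | nodeRel (o : EqOp) (s t : NTerm σ n m)
  | edgeRel (o : EqOp) (s t : ETerm σ m)
  | listRel (o : EqOp) (s t : LTerm σ n m k)
  | vmRel (o : EqOp) (s t : VMTerm σ n m)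
  | emRel (o : EqOp) (s t : EMTerm σ m)

inductive Form (σ : Sig) : ℕ → ℕ → ℕ → Type
  | tt {n m k : ℕ} : Form σ n m k
  | ff {n m k : ℕ} : Form σ n m k
  | atom {n m k : ℕ} (a : Atomic σ n m k) : Form σ n m k
  | and {n m k : ℕ} (c c' : Form σ n m k) : Form σ n m k
  | or {n m k : ℕ} (c c' : Form σ n m k) : Form σ n m k
  | not {n m k : ℕ} (c : Form σ n m k) : Form σ n m k
  | exV {n m k : ℕ} (c : Form σ (n + 1) m k) : Form σ n m k
  | exE {n m k : ℕ} (c : Form σ n (m + 1) k) : Form σ n m k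
  | exL {n m k : ℕ} (c : Form σ n m (k + 1)) : Form σ n m k

/-- Closed first-order formulas. -/
abbrev Sentence : Type := Form Sig.closed 0 0 0

/-! ### Satisfaction -/

/-- Assignments of values in `G` to free symbols and to the variables in scope. -/
structure Assignment (σ : Sig) (G : HostGraph) (n m k : ℕ) : Type where
  nd : σ.nd → G.V
  ed : σ.ed → G.E
  lb : σ.lb → GPList
  cn : σ.cn → ℤ
  vn : Fin n → G.V
  ve : Fin m → G.E
  vl : Fin k → GPList

section Satisfaction

variable {σ : Sig} {G : HostGraph} {n m k : ℕ}

def Assignment.pushV (a : Assignment σ G n m k) (v : G.V) : Assignment σ G (n + 1) m k :=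
  ⟨a.nd, a.ed, a.lb, a.cn, Fin.cons v a.vn, a.ve, a.vl⟩

def Assignment.pushE (a : Assignment σ G n m k) (e : G.E) : Assignment σ G n (m + 1) k :=
  ⟨a.nd, a.ed, a.lb, a.cn, a.vn, Fin.cons e a.ve, a.vl⟩

def Assignment.pushL (a : Assignment σ G n m k) (l : GPList) : Assignment σ G n m (k + 1) :=
  ⟨a.nd, a.ed, a.lb, a.cn, a.vn, a.ve, Fin.cons l a.vl⟩

def ETerm.eval (a : Assignment σ G n m k) : ETerm σ m → G.E
  | .const e => a.ed e
  | .var i => a.ve i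

def NTerm.eval (a : Assignment σ G n m k) : NTerm σ n m → G.V
  | .const v => a.nd v
  | .var i => a.vn i
  | .src e => G.src (e.eval a)
  | .tgt e => G.tgt (e.eval a)

def LVar.eval {X : Type} (lb : X → GPList) (vl : Fin k → GPList) : LVar X k → GPList
  | .free x => lb x
  | .var i => vl i

/-- The occurrence of a variable as an integer (atom, string, character) has a value only if the
variable is assigned a value of that type. -/
noncomputable def ITerm.eval (a : Assignment σ G n m k) : ITerm σ n m k → Option ℤ
  | .num z => some z
  | .var x => asInt (x.eval a.lb a.vl)
  | .add s t => Option.map₂ (· + ·) (s.eval a) (t.eval a)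
  | .sub s t => Option.map₂ (· - ·) (s.eval a) (t.eval a)
  | .mul s t => Option.map₂ (· * ·) (s.eval a) (t.eval a)
  | .div s t => Option.map₂ Int.tdiv (s.eval a) (t.eval a)
  | .indeg t => some (G.indeg (t.eval a))
  | .outdeg t => some (G.outdeg (t.eval a))
  | .lenA x => (asAtom (x.eval a.lb a.vl)).map GPAtom.length
  | .lenS x => (asStr (x.eval a.lb a.vl)).map (fun s => (s.length : ℤ))
  | .lenL x => some ((x.eval a.lb a.vl).length : ℤ)
  | .sym c => some (a.cn c)

def STerm.eval {X : Type} (lb : X → GPList) (vl : Fin k → GPList) :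
    STerm X k → Option (List GPChar)
  | .lit s => some s
  | .charVar x => asChar (x.eval lb vl)
  | .strVar x => asStr (x.eval lb vl)
  | .cat s t => Option.map₂ (· ++ ·) (s.eval lb vl) (t.eval lb vl)

noncomputable def LTerm.eval (a : Assignment σ G n m k) : LTerm σ n m k → Option GPList
  | .empty => some []
  | .int t => (t.eval a).map (fun z => [.int z])
  | .str t => (t.eval a.lb a.vl).map (fun s => [.str s])
  | .atomVar x => (asAtom (x.eval a.lb a.vl)).map (fun b => [b])
  | .listVar x => some (x.eval a.lb a.vl)
  | .app s t => Option.map₂ (· ++ ·) (s.eval a) (t.eval a)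
  | .labV t => some (G.labV (t.eval a))
  | .labE t => some (G.labE (t.eval a))

def VMTerm.eval (a : Assignment σ G n m k) : VMTerm σ n m → Wild VMark
  | .lit q => q
  | .mark t => .mk (G.markV (t.eval a))

def EMTerm.eval (a : Assignment σ G n m k) : EMTerm σ m → Wild EMark
  | .lit q => q
  | .mark t => .mk (G.markE (t.eval a))

/-- Truth of atomic formulas. Relations between terms are false if a term has no value. -/
def Atomic.sat (a : Assignment σ G n m k) : Atomic σ n m k → Prop
  | .typ s x => x.eval a.lb a.vl ∈ s.dom
  | .root t => G.root (t.eval a) = true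
  | .cmp o s t => ∃ x ∈ s.eval a, ∃ y ∈ t.eval a, o.holds x y
  | .nodeRel o s t => o.holds (s.eval a = t.eval a)
  | .edgeRel o s t => o.holds (s.eval a = t.eval a)
  | .listRel o s t => ∃ x ∈ s.eval a, ∃ y ∈ t.eval a, o.holds (x = y)
  | .vmRel o s t => o.holds (Wild.agree VMark.none (s.eval a) (t.eval a) = true)
  | .emRel o s t => o.holds (Wild.agree EMark.none (s.eval a) (t.eval a) = true)

def Form.sat {σ : Sig} {G : HostGraph} : {n m k : ℕ} → Assignment σ G n m k → Form σ n m k → Prop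
  | _, _, _, _, .tt => True
  | _, _, _, _, .ff => False
  | _, _, _, a, .atom b => b.sat a
  | _, _, _, a, .and c c' => c.sat a ∧ c'.sat a
  | _, _, _, a, .or c c' => c.sat a ∨ c'.sat a
  | _, _, _, a, .not c => ¬ c.sat a
  | _, _, _, a, .exV c => ∃ v, c.sat (a.pushV v)
  | _, _, _, a, .exE c => ∃ e, c.sat (a.pushE e)
  | _, _, _, a, .exL c => ∃ l, c.sat (a.pushL l)

end Satisfaction

/-- `G ⊨ c` for a closed formula: some assignment satisfies `c` (there is exactly one). -/
def Models (G : HostGraph) (c : Sentence) : Prop :=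
  ∃ a : Assignment Sig.closed G 0 0 0, c.sat a

/-! ### Substitution -/

section Weakening

variable {σ : Sig} {n m k : ℕ}

def ETerm.wk : ETerm σ m → ETerm σ (m + 1)
  | .const e => .const e
  | .var i => .var i.succ

def NTerm.wkV : NTerm σ n m → NTerm σ (n + 1) m
  | .const v => .const v
  | .var i => .var i.succ
  | .src e => .src e
  | .tgt e => .tgt e

def NTerm.wkE : NTerm σ n m → NTerm σ n (m + 1)
  | .const v => .const v
  | .var i => .var i
  | .src e => .src e.wk
  | .tgt e => .tgt e.wk

def LVar.wk {X : Type} : LVar X k → LVar X (k + 1)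
  | .free x => .free x
  | .var i => .var i.succ

end Weakening

/-- Simultaneous substitutions, acting on node terms, edge terms, label variables and auxiliary
symbols. -/
structure Subst (σ σ' : Sig) (n m k n' m' k' : ℕ) : Type where
  nd : NTerm σ n m → NTerm σ' n' m'
  ed : ETerm σ m → ETerm σ' m'
  lb : LVar σ.lb k → LVar σ'.lb k'
  cn : σ.cn → σ'.cn

section Substitution

variable {σ σ' : Sig} {n m k n' m' k' : ℕ}

/-- A substitution under a node quantifier. -/
def Subst.upV (s : Subst σ σ' n m k n' m' k') : Subst σ σ' (n + 1) m k (n' + 1) m' k' where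
  nd := fun
    | .const v => (s.nd (.const v)).wkV
    | .var i => Fin.cases (.var 0) (fun j => (s.nd (.var j)).wkV) i
    | .src e => (s.nd (.src e)).wkV
    | .tgt e => (s.nd (.tgt e)).wkV
  ed := s.ed
  lb := s.lb
  cn := s.cn

/-- A substitution under an edge quantifier. -/
def Subst.upE (s : Subst σ σ' n m k n' m' k') : Subst σ σ' n (m + 1) k n' (m' + 1) k' where
  nd := fun
    | .const v => (s.nd (.const v)).wkE
    | .var i => (s.nd (.var i)).wkE
    | .src (.const e) => (s.nd (.src (.const e))).wkE
    | .src (.var i) => Fin.cases (.src (.var 0)) (fun j => (s.nd (.src (.var j))).wkE) i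
    | .tgt (.const e) => (s.nd (.tgt (.const e))).wkE
    | .tgt (.var i) => Fin.cases (.tgt (.var 0)) (fun j => (s.nd (.tgt (.var j))).wkE) i
  ed := fun
    | .const e => (s.ed (.const e)).wk
    | .var i => Fin.cases (.var 0) (fun j => (s.ed (.var j)).wk) i
  lb := s.lb
  cn := s.cn

/-- A substitution under a label quantifier. -/
def Subst.upL (s : Subst σ σ' n m k n' m' k') : Subst σ σ' n m (k + 1) n' m' (k' + 1) where
  nd := s.nd
  ed := s.ed
  lb := fun
    | .free x => (s.lb (.free x)).wk
    | .var i => Fin.cases (.var 0) (fun j => (s.lb (.var j)).wk) i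
  cn := s.cn

def ITerm.subst (s : Subst σ σ' n m k n' m' k') : ITerm σ n m k → ITerm σ' n' m' k'
  | .num z => .num z
  | .var x => .var (s.lb x)
  | .add a b => .add (a.subst s) (b.subst s)
  | .sub a b => .sub (a.subst s) (b.subst s)
  | .mul a b => .mul (a.subst s) (b.subst s)
  | .div a b => .div (a.subst s) (b.subst s)
  | .indeg t => .indeg (s.nd t)
  | .outdeg t => .outdeg (s.nd t)
  | .lenA x => .lenA (s.lb x)
  | .lenS x => .lenS (s.lb x)
  | .lenL x => .lenL (s.lb x)
  | .sym c => .sym (s.cn c)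

def STerm.subst {X Y : Type} (f : LVar X k → LVar Y k') : STerm X k → STerm Y k'
  | .lit s => .lit s
  | .charVar x => .charVar (f x)
  | .strVar x => .strVar (f x)
  | .cat a b => .cat (a.subst f) (b.subst f)

def LTerm.subst (s : Subst σ σ' n m k n' m' k') : LTerm σ n m k → LTerm σ' n' m' k'
  | .empty => .empty
  | .int t => .int (t.subst s)
  | .str t => .str (t.subst s.lb)
  | .atomVar x => .atomVar (s.lb x)
  | .listVar x => .listVar (s.lb x)
  | .app a b => .app (a.subst s) (b.subst s)
  | .labV t => .labV (s.nd t)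
  | .labE t => .labE (s.ed t)

def VMTerm.subst (s : Subst σ σ' n m k n' m' k') : VMTerm σ n m → VMTerm σ' n' m'
  | .lit q => .lit q
  | .mark t => .mark (s.nd t)

def EMTerm.subst (s : Subst σ σ' n m k n' m' k') : EMTerm σ m → EMTerm σ' m'
  | .lit q => .lit q
  | .mark t => .mark (s.ed t)

def Atomic.subst (s : Subst σ σ' n m k n' m' k') : Atomic σ n m k → Atomic σ' n' m' k'
  | .typ q x => .typ q (s.lb x)
  | .root t => .root (s.nd t)
  | .cmp o a b => .cmp o (a.subst s) (b.subst s)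
  | .nodeRel o a b => .nodeRel o (s.nd a) (s.nd b)
  | .edgeRel o a b => .edgeRel o (s.ed a) (s.ed b)
  | .listRel o a b => .listRel o (a.subst s) (b.subst s)
  | .vmRel o a b => .vmRel o (a.subst s) (b.subst s)
  | .emRel o a b => .emRel o (a.subst s) (b.subst s)

end Substitution

def Form.subst {σ σ' : Sig} : {n m k n' m' k' : ℕ} → Subst σ σ' n m k n' m' k' →
    Form σ n m k → Form σ' n' m' k'
  | _, _, _, _, _, _, _, .tt => .tt
  | _, _, _, _, _, _, _, .ff => .ff
  | _, _, _, _, _, _, s, .atom a => .atom (a.subst s)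
  | _, _, _, _, _, _, s, .and c c' => .and (c.subst s) (c'.subst s)
  | _, _, _, _, _, _, s, .or c c' => .or (c.subst s) (c'.subst s)
  | _, _, _, _, _, _, s, .not c => .not (c.subst s)
  | _, _, _, _, _, _, s, .exV c => .exV (c.subst s.upV)
  | _, _, _, _, _, _, s, .exE c => .exE (c.subst s.upE)
  | _, _, _, _, _, _, s, .exL c => .exL (c.subst s.upL)

section Substitutions

variable {σ : Sig} {n m k : ℕ}

/-- Weakening by an edge variable. -/
def Subst.wkE : Subst σ σ n m k n (m + 1) k := ⟨NTerm.wkE, ETerm.wk, fun x => x, fun c => c⟩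

/-- Replacement of the innermost node variable by a node constant. -/
def Subst.instV (v : σ.nd) : Subst σ σ (n + 1) m k n m k where
  nd := fun
    | .const u => .const u
    | .var i => Fin.cases (.const v) (fun j => .var j) i
    | .src e => .src e
    | .tgt e => .tgt e
  ed := fun e => e
  lb := fun x => x
  cn := fun c => c

def ETerm.inst (e : σ.ed) : ETerm σ (m + 1) → ETerm σ m
  | .const e' => .const e'
  | .var i => Fin.cases (.const e) (fun j => .var j) i

/-- Replacement of the innermost edge variable by an edge constant. -/
def Subst.instE (e : σ.ed) : Subst σ σ n (m + 1) k n m k where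
  nd := fun
    | .const u => .const u
    | .var i => .var i
    | .src t => .src (t.inst e)
    | .tgt t => .tgt (t.inst e)
  ed := ETerm.inst e
  lb := fun x => x
  cn := fun c => c

/-- Replacement of the source `s(x)` of the innermost edge variable by a node constant. -/
def Subst.replSrc (v : σ.nd) : Subst σ σ n (m + 1) k n (m + 1) k where
  nd := fun
    | .src (.var i) => Fin.cases (.const v) (fun j => .src (.var j.succ)) i
    | t => t
  ed := fun e => e
  lb := fun x => x
  cn := fun c => c

/-- Replacement of the target `t(x)` of the innermost edge variable by a node constant. -/
def Subst.replTgt (v : σ.nd) : Subst σ σ n (m + 1) k n (m + 1) k where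
  nd := fun
    | .tgt (.var i) => Fin.cases (.const v) (fun j => .tgt (.var j.succ)) i
    | t => t
  ed := fun e => e
  lb := fun x => x
  cn := fun c => c

/-- A closed formula as a formula over any signature. -/
def Subst.ofClosed : Subst Sig.closed σ 0 0 0 0 0 0 where
  nd := fun
    | .const u => Empty.elim u
    | .var i => .var i
    | .src (.const e) => Empty.elim e
    | .src (.var i) => .src (.var i)
    | .tgt (.const e) => Empty.elim e
    | .tgt (.var i) => .tgt (.var i)
  ed := fun
    | .const e => Empty.elim e
    | .var i => .var i
  lb := fun
    | .free x => Empty.elim x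
    | .var i => .var i
  cn := Empty.elim

end Substitutions

/-! ### Abbreviations -/

section Abbreviations

variable {σ : Sig} {n m k : ℕ}

def bigAnd : List (Form σ n m k) → Form σ n m k
  | [] => .tt
  | c :: l => .and c (bigAnd l)

def bigOr : List (Form σ n m k) → Form σ n m k
  | [] => .ff
  | c :: l => .or c (bigOr l)

/-- The predicate `edge(u, v, l, q)` with optional label and mark: there is an edge from `u` to
`v` (with the given label and mark). -/
def Form.edge (u v : NTerm σ n m) (l : Option (LTerm σ n m k)) (q : Option (Wild EMark)) :
    Form σ n m k :=
  .exE (bigAnd (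
    [.atom (.nodeRel .eq (.src (.var 0)) u.wkE), .atom (.nodeRel .eq (.tgt (.var 0)) v.wkE)] ++
    (l.map (fun t => Form.atom (.listRel .eq (.labE (.var 0)) (t.subst Subst.wkE)))).toList ++
    (q.map (fun t => Form.atom (.emRel .eq (.mark (.var 0)) (.lit t)))).toList))

end Abbreviations

/-- The elements of a finite set of identifiers in increasing order. -/
def enum (S : Finset ℕ) : List S := List.ofFn (fun i : Fin S.card => S.orderIsoOfFin rfl i)

/-! ### Rule expressions and application conditions as terms and formulas -/

section Translation

variable {p : ℕ} {τ : Fin p → LSort} {I : Finset ℕ} {σ : Sig} {n m k : ℕ}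

/-- An expression as a term, where `din` and `dout` translate the degree operators. -/
def IntExp.toTerm (lb : Fin p → σ.lb) (din dout : I → ITerm σ n m k) :
    IntExp τ I → ITerm σ n m k
  | .num z => .num z
  | .var x => .var (.free (lb x.1))
  | .add a b => .add (a.toTerm lb din dout) (b.toTerm lb din dout)
  | .sub a b => .sub (a.toTerm lb din dout) (b.toTerm lb din dout)
  | .mul a b => .mul (a.toTerm lb din dout) (b.toTerm lb din dout)
  | .div a b => .div (a.toTerm lb din dout) (b.toTerm lb din dout)
  | .indeg v => din v
  | .outdeg v => dout v
  | .lenA x => .lenA (.free (lb x.1))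
  | .lenS x => .lenS (.free (lb x.1))
  | .lenL x => .lenL (.free (lb x.1))

def StrExp.toTerm {X : Type} (lb : Fin p → X) : StrExp τ → STerm X k
  | .lit s => .lit s
  | .charVar x => .charVar (.free (lb x.1))
  | .strVar x => .strVar (.free (lb x.1))
  | .cat a b => .cat (a.toTerm lb) (b.toTerm lb)

def LExp.toTerm (lb : Fin p → σ.lb) (din dout : I → ITerm σ n m k) :
    LExp τ I → LTerm σ n m k
  | .empty => .empty
  | .int e => .int (e.toTerm lb din dout)
  | .str e => .str (e.toTerm lb)
  | .atomVar x => .atomVar (.free (lb x.1))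
  | .listVar x => .listVar (.free (lb x.1))
  | .app a b => .app (a.toTerm lb din dout) (b.toTerm lb din dout)

/-- The signature of conditions over a rule graph. -/
abbrev Sig.over (p : ℕ) (V E : Finset ℕ) : Sig := ⟨V, E, Fin p, Empty⟩

/-- The condition `Γ^∨` over the left-hand graph. -/
def Cond.toForm {E : Finset ℕ} : Cond τ I → Form (Sig.over p I E) 0 0 0
  | .typ s x => .atom (.typ s (.free x))
  | .listRel o a b => .atom (.listRel o
      (a.toTerm id (fun v => .indeg (.const v)) (fun v => .outdeg (.const v)))
      (b.toTerm id (fun v => .indeg (.const v)) (fun v => .outdeg (.const v))))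
  | .cmp o a b => .atom (.cmp o
      (a.toTerm id (fun v => .indeg (.const v)) (fun v => .outdeg (.const v)))
      (b.toTerm id (fun v => .indeg (.const v)) (fun v => .outdeg (.const v))))
  | .edge u v l => Form.edge (.const u) (.const v)
      (l.map (fun q =>
        q.1.toTerm id (fun v => .indeg (.const v)) (fun v => .outdeg (.const v))))
      (l.bind (fun q => q.2))
  | .not c => .not c.toForm
  | .and c c' => .and c.toForm c'.toForm
  | .or c c' => .or c.toForm c'.toForm

end Translation

/-! ## Generalised rules -/

inductive Side : Type
  | left | right

def Side.swap : Side → Side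
  | .left => .right
  | .right => .left

/-- Unrestricted rule schemata. The graph on the side `side` is the one whose match is used to
evaluate expressions: degree operators refer to the host graph on that side. -/
structure URule : Type where
  p : ℕ
  τ : Fin p → LSort
  VL : Finset ℕ
  EL : Finset ℕ
  VR : Finset ℕ
  ER : Finset ℕ
  VK : Finset ℕ
  KL : VK ⊆ VL
  KR : VK ⊆ VR
  I : Finset ℕ
  L : RuleGraph τ VL EL I
  R : RuleGraph τ VR ER I
  side : Side

abbrev URule.sigL (r : URule) : Sig := Sig.over r.p r.VL r.EL
abbrev URule.sigR (r : URule) : Sig := Sig.over r.p r.VR r.ER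

def URule.inv (r : URule) : URule where
  p := r.p
  τ := r.τ
  VL := r.VR
  EL := r.ER
  VR := r.VL
  ER := r.EL
  VK := r.VK
  KL := r.KR
  KR := r.KL
  I := r.I
  L := r.R
  R := r.L
  side := r.side.swap

structure GenRule : Type where
  r : URule
  acL : Form r.sigL 0 0 0
  acR : Form r.sigR 0 0 0

def GenRule.inv (w : GenRule) : GenRule where
  r := w.r.inv
  acL := w.acR
  acR := w.acL

def RuleSchema.toURule (r : RuleSchema) : URule where
  p := r.p
  τ := r.τ
  VL := r.VL
  EL := r.EL
  VR := r.VR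
  ER := r.ER
  VK := r.VK
  KL := r.KL
  KR := r.KR
  I := r.VL
  L := r.L
  R := r.R
  side := .left

/-- The generalised rule `r^∨ = ⟨⟨L ← K → R⟩, Γ^∨, true⟩`. -/
def RuleSchema.gen (r : RuleSchema) : GenRule where
  r := r.toURule
  acL := r.Γ.toForm
  acR := .tt

/-! ## Split -/

section Split

variable (r : URule) {n m k : ℕ}

/-- The disjunction over the possibilities for the source and the target of the edge variable. -/
def URule.inc (f : Form r.sigL n (m + 1) k) : Form r.sigL n (m + 1) k :=
  let S (o : EqOp) (v : r.VL) : Form r.sigL n (m + 1) k :=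
    .atom (.nodeRel o (.src (.var 0)) (.const v))
  let T (o : EqOp) (v : r.VL) : Form r.sigL n (m + 1) k :=
    .atom (.nodeRel o (.tgt (.var 0)) (.const v))
  .or
    (bigOr ((enum r.VL).map (fun v =>
      .or (bigOr ((enum r.VL).map (fun u =>
          .and (S .eq v) (.and (T .eq u) ((f.subst (.replSrc v)).subst (.replTgt u))))))
        (.or
          (.and (S .eq v) (.and (bigAnd ((enum r.VL).map (T .ne))) (f.subst (.replSrc v))))
          (.and (bigAnd ((enum r.VL).map (S .ne))) (.and (T .eq v) (f.subst (.replTgt v))))))))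
    (.and (bigAnd ((enum r.VL).map (S .ne))) (.and (bigAnd ((enum r.VL).map (T .ne))) f))

/-- The transformation Split. The result of replacing a variable in `c` and then splitting is the
same formula as that of splitting `c` and then replacing the variable. -/
def URule.split : {n m k : ℕ} → Form r.sigL n m k → Form r.sigL n m k
  | _, _, _, .tt => .tt
  | _, _, _, .ff => .ff
  | _, _, _, .atom a => .atom a
  | _, _, _, .and c c' => .and (URule.split c) (URule.split c')
  | _, _, _, .or c c' => .or (URule.split c) (URule.split c')
  | _, _, _, .not c => .not (URule.split c)
  | _, _, _, .exV c =>
      .or (bigOr ((enum r.VL).map (fun v => (URule.split c).subst (.instV v))))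
        (.exV (.and
          (bigAnd ((enum r.VL).map (fun v => .atom (.nodeRel .ne (.var 0) (.const v)))))
          (URule.split c)))
  | _, _, _, .exE c =>
      .or (bigOr ((enum r.EL).map (fun e => (URule.split c).subst (.instE e))))
        (.exE (.and
          (bigAnd ((enum r.EL).map (fun e => .atom (.edgeRel .ne (.var 0) (.const e)))))
          (r.inc (URule.split c))))
  | _, _, _, .exL c => .exL (URule.split c)

end Split

/-! ## The dangling condition -/

def URule.dang (r : URule) : Form r.sigL 0 0 0 :=
  bigAnd (((enum r.VL).filter (fun v => v.1 ∉ r.VK)).map (fun v =>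
    .and (.atom (.listRel .eq (.int (.indeg (.const v))) (.int (.num (r.L.indeg v)))))
      (.atom (.listRel .eq (.int (.outdeg (.const v))) (.int (.num (r.L.outdeg v)))))))

/-! ## Val -/

/-- The auxiliary symbols: `incon v` and `outcon v` stand for the numbers of edges outside the
rule graph that enter resp. leave the interface node `v`; `indegAt i` and `outdegAt i` stand for
the values of the degree operators in the expressions of the rule. -/
inductive URule.ConSym (r : URule) : Type
  | incon (v : r.VK)
  | outcon (v : r.VK)
  | indegAt (i : r.I)
  | outdegAt (i : r.I)

/-- The signature of valuated conditions. -/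
abbrev URule.sigV (r : URule) : Sig := ⟨r.VL, r.EL, Fin r.p, r.ConSym⟩

def Form.ofBool {σ : Sig} {n m k : ℕ} (b : Bool) : Form σ n m k := if b then .tt else .ff

/-- A comparison of known values. -/
def Form.ofEqOp {σ : Sig} {n m k : ℕ} : EqOp → Bool → Form σ n m k
  | .eq, b => Form.ofBool b
  | .ne, b => Form.ofBool (!b)

/-- Negation, simplified by means of double negation and De Morgan's laws. -/
def Form.neg {σ : Sig} : {n m k : ℕ} → Form σ n m k → Form σ n m k
  | _, _, _, .tt => .ff
  | _, _, _, .ff => .tt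
  | _, _, _, .not c => c
  | _, _, _, .and c c' => .or c.neg c'.neg
  | _, _, _, .or c c' => .and c.neg c'.neg
  | _, _, _, c => .not c

section Val

variable (r : URule) {n m k : ℕ}

def URule.valE : ETerm r.sigL m → ETerm r.sigV m
  | .const e => .const e
  | .var i => .var i

def URule.valN : NTerm r.sigL n m → NTerm r.sigV n m
  | .const v => .const v
  | .var i => .var i
  | .src (.const e) => .const (r.L.src e)
  | .src (.var i) => .src (.var i)
  | .tgt (.const e) => .const (r.L.tgt e)
  | .tgt (.var i) => .tgt (.var i)

def URule.valExp (e : LExp r.τ r.I) : LTerm r.sigV n m k :=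
  e.toTerm id (fun i => .sym (.indegAt i)) (fun i => .sym (.outdegAt i))

/-- The degree of a constant is a number for deleted nodes, and the degree in the rule graph plus
the number of further edges for interface nodes. -/
def URule.valI : ITerm r.sigL n m k → ITerm r.sigV n m k
  | .num z => .num z
  | .var x => .var x
  | .add a b => .add (URule.valI a) (URule.valI b)
  | .sub a b => .sub (URule.valI a) (URule.valI b)
  | .mul a b => .mul (URule.valI a) (URule.valI b)
  | .div a b => .div (URule.valI a) (URule.valI b)
  | .indeg t => match r.valN t with
      | .const v =>
          if h : v.1 ∈ r.VK then .add (.sym (.incon ⟨v.1, h⟩)) (.num (r.L.indeg v))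
          else .num (r.L.indeg v)
      | t' => .indeg t'
  | .outdeg t => match r.valN t with
      | .const v =>
          if h : v.1 ∈ r.VK then .add (.sym (.outcon ⟨v.1, h⟩)) (.num (r.L.outdeg v))
          else .num (r.L.outdeg v)
      | t' => .outdeg t'
  | .lenA x => .lenA x
  | .lenS x => .lenS x
  | .lenL x => .lenL x
  | .sym c => Empty.elim c

def URule.valL : LTerm r.sigL n m k → LTerm r.sigV n m k
  | .empty => .empty
  | .int t => .int (r.valI t)
  | .str t => .str t
  | .atomVar x => .atomVar x
  | .listVar x => .listVar x
  | .app a b => .app (URule.valL a) (URule.valL b)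
  | .labV t => match r.valN t with
      | .const v => r.valExp (r.L.labV v)
      | t' => .labV t'
  | .labE (.const e) => r.valExp (r.L.labE e)
  | .labE (.var i) => .labE (.var i)

/-- The mark of a constant is known unless it is the wildcard on both sides of the rule, in which
case the mark is preserved and the term is kept. -/
def URule.valVM : VMTerm r.sigL n m → VMTerm r.sigV n m
  | .lit q => .lit q
  | .mark t => match r.valN t with
      | .const v =>
          if ∃ h : v.1 ∈ r.VK, r.L.markV v = .any ∧ r.R.markV ⟨v.1, r.KR h⟩ = .any
          then .mark (.const v) else .lit (r.L.markV v)
      | t' => .mark t'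

def URule.valEM : EMTerm r.sigL m → EMTerm r.sigV m
  | .lit q => .lit q
  | .mark (.const e) =>
      if ∃ h : e.1 ∈ r.ER, r.L.markE e = .any ∧ r.R.markE ⟨e.1, h⟩ = .any
      then .mark (.const e) else .lit (r.L.markE e)
  | .mark (.var i) => .mark (.var i)

def URule.valAtomic : Atomic r.sigL n m k → Form r.sigV n m k
  | .typ s x => .atom (.typ s x)
  | .root t => match r.valN t with
      | .const v => Form.ofBool (r.L.root v)
      | t' => .atom (.root t')
  | .cmp o a b => .atom (.cmp o (r.valI a) (r.valI b))
  | .nodeRel o s t => match r.valN s, r.valN t with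
      | .const u, .const v => Form.ofEqOp o (decide (u = v))
      | s', t' => .atom (.nodeRel o s' t')
  | .edgeRel o s t => match r.valE s, r.valE t with
      | .const e, .const f => Form.ofEqOp o (decide (e = f))
      | s', t' => .atom (.edgeRel o s' t')
  | .listRel o s t => .atom (.listRel o (r.valL s) (r.valL t))
  | .vmRel o s t => match r.valVM s, r.valVM t with
      | .lit x, .lit y => Form.ofEqOp o (Wild.agree VMark.none x y)
      | s', t' => .atom (.vmRel o s' t')
  | .emRel o s t => match r.valEM s, r.valEM t with
      | .lit x, .lit y => Form.ofEqOp o (Wild.agree EMark.none x y)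
      | s', t' => .atom (.emRel o s' t')

/-- The transformation Val: terms with constant arguments are replaced by their values in the
left-hand graph, and the result is simplified. -/
def URule.val : {n m k : ℕ} → Form r.sigL n m k → Form r.sigV n m k
  | _, _, _, .tt => .tt
  | _, _, _, .ff => .ff
  | _, _, _, .atom a => r.valAtomic a
  | _, _, _, .and c c' => .and (URule.val c) (URule.val c')
  | _, _, _, .or c c' => .or (URule.val c) (URule.val c')
  | _, _, _, .not c => (URule.val c).neg
  | _, _, _, .exV c => .exV (URule.val c)
  | _, _, _, .exE c => .exE (URule.val c)
  | _, _, _, .exL c => .exL (URule.val c)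

end Val

/-! ## Lift -/

def lift (c : Sentence) (w : GenRule) : Form w.r.sigV 0 0 0 :=
  w.r.val (.and (w.r.split (.and (c.subst .ofClosed) w.acL)) w.r.dang)

/-! ## Adj -/

section Adj

variable (r : URule) {n m k : ℕ}

/-- The value of the operator `indeg(i)` in an expression of the rule, as a term over the
right-hand graph. -/
def URule.indegAt (i : r.I) : ITerm r.sigR n m k :=
  match r.side with
  | .left =>
      if h : i.1 ∈ r.VK then
        .add (.sub (.indeg (.const ⟨i.1, r.KR h⟩)) (.num (r.R.indeg ⟨i.1, r.KR h⟩)))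
          (.num (r.L.indeg ⟨i.1, r.KL h⟩))
      else if h : i.1 ∈ r.VL then .num (r.L.indeg ⟨i.1, h⟩) else .num 0
  | .right => if h : i.1 ∈ r.VR then .indeg (.const ⟨i.1, h⟩) else .num 0

/-- The value of the operator `outdeg(i)` in an expression of the rule, as a term over the
right-hand graph. -/
def URule.outdegAt (i : r.I) : ITerm r.sigR n m k :=
  match r.side with
  | .left =>
      if h : i.1 ∈ r.VK then
        .add (.sub (.outdeg (.const ⟨i.1, r.KR h⟩)) (.num (r.R.outdeg ⟨i.1, r.KR h⟩)))
          (.num (r.L.outdeg ⟨i.1, r.KL h⟩))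
      else if h : i.1 ∈ r.VL then .num (r.L.outdeg ⟨i.1, h⟩) else .num 0
  | .right => if h : i.1 ∈ r.VR then .outdeg (.const ⟨i.1, h⟩) else .num 0

def URule.adjSym : r.ConSym → ITerm r.sigR n m k
  | .incon v => .sub (.indeg (.const ⟨v.1, r.KR v.2⟩)) (.num (r.R.indeg ⟨v.1, r.KR v.2⟩))
  | .outcon v => .sub (.outdeg (.const ⟨v.1, r.KR v.2⟩)) (.num (r.R.outdeg ⟨v.1, r.KR v.2⟩))
  | .indegAt i => r.indegAt i
  | .outdegAt i => r.outdegAt i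

/-- Edge constants of the left-hand graph have no counterpart over the right-hand graph. -/
def URule.adjE : ETerm r.sigV m → Option (ETerm r.sigR m)
  | .const _ => none
  | .var i => some (.var i)

/-- Node constants outside the interface have no counterpart over the right-hand graph. -/
def URule.adjN : NTerm r.sigV n m → Option (NTerm r.sigR n m)
  | .const v => if h : v.1 ∈ r.VK then some (.const ⟨v.1, r.KR h⟩) else none
  | .var i => some (.var i)
  | .src e => (r.adjE e).map .src
  | .tgt e => (r.adjE e).map .tgt

def URule.adjI : ITerm r.sigV n m k → Option (ITerm r.sigR n m k)
  | .num z => some (.num z)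
  | .var x => some (.var x)
  | .add a b => Option.map₂ .add (URule.adjI a) (URule.adjI b)
  | .sub a b => Option.map₂ .sub (URule.adjI a) (URule.adjI b)
  | .mul a b => Option.map₂ .mul (URule.adjI a) (URule.adjI b)
  | .div a b => Option.map₂ .div (URule.adjI a) (URule.adjI b)
  | .indeg t => (r.adjN t).map .indeg
  | .outdeg t => (r.adjN t).map .outdeg
  | .lenA x => some (.lenA x)
  | .lenS x => some (.lenS x)
  | .lenL x => some (.lenL x)
  | .sym c => some (r.adjSym c)

def URule.adjL : LTerm r.sigV n m k → Option (LTerm r.sigR n m k)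
  | .empty => some .empty
  | .int t => (r.adjI t).map .int
  | .str t => some (.str t)
  | .atomVar x => some (.atomVar x)
  | .listVar x => some (.listVar x)
  | .app a b => Option.map₂ .app (URule.adjL a) (URule.adjL b)
  | .labV t => (r.adjN t).map .labV
  | .labE t => (r.adjE t).map .labE

def URule.adjVM : VMTerm r.sigV n m → Option (VMTerm r.sigR n m)
  | .lit q => some (.lit q)
  | .mark t => (r.adjN t).map .mark

/-- The term `m_E(e)` for a constant `e` remains only if the mark of `e` is preserved. -/
def URule.adjEM : EMTerm r.sigV m → Option (EMTerm r.sigR m)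
  | .lit q => some (.lit q)
  | .mark (.const e) => if h : e.1 ∈ r.ER then some (.mark (.const ⟨e.1, h⟩)) else none
  | .mark (.var i) => some (.mark (.var i))

/-- An equation or inequation, which is false resp. true if one of its sides has no counterpart
over the right-hand graph. -/
def adjRel {A : Type} {σ : Sig} {n m k : ℕ} (o : EqOp) (f : A → A → Atomic σ n m k) :
    Option A → Option A → Form σ n m k
  | some s, some t => .atom (f s t)
  | _, _ => match o with
      | .eq => .ff
      | .ne => .tt

/-- The adjustment of atomic formulas. The last alternative in the cases of `root` and of the
comparisons does not arise for valuated conditions. -/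
def URule.adjAtomic : Atomic r.sigV n m k → Form r.sigR n m k
  | .typ s x => .atom (.typ s x)
  | .root t => match r.adjN t with
      | some t' => .atom (.root t')
      | none => .ff
  | .cmp o a b => match r.adjI a, r.adjI b with
      | some a', some b' => .atom (.cmp o a' b')
      | _, _ => .ff
  | .nodeRel o s t => adjRel o (.nodeRel o) (r.adjN s) (r.adjN t)
  | .edgeRel o s t => adjRel o (.edgeRel o) (r.adjE s) (r.adjE t)
  | .listRel o s t => adjRel o (.listRel o) (r.adjL s) (r.adjL t)
  | .vmRel o s t => adjRel o (.vmRel o) (r.adjVM s) (r.adjVM t)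
  | .emRel o s t => adjRel o (.emRel o) (r.adjEM s) (r.adjEM t)

/-- The transformation Adj. -/
def URule.adj : {n m k : ℕ} → Form r.sigV n m k → Form r.sigR n m k
  | _, _, _, .tt => .tt
  | _, _, _, .ff => .ff
  | _, _, _, .atom a => r.adjAtomic a
  | _, _, _, .and c c' => .and (URule.adj c) (URule.adj c')
  | _, _, _, .or c c' => .or (URule.adj c) (URule.adj c')
  | _, _, _, .not c => .not (URule.adj c)
  | _, _, _, .exV c => .exV (.and
      (bigAnd (((enum r.VR).filter (fun v => v.1 ∉ r.VK)).map
        (fun v => .atom (.nodeRel .ne (.var 0) (.const v)))))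
      (URule.adj c))
  | _, _, _, .exE c => .exE (.and
      (bigAnd ((enum r.ER).map (fun e => .atom (.edgeRel .ne (.var 0) (.const e)))))
      (URule.adj c))
  | _, _, _, .exL c => .exL (URule.adj c)

end Adj

/-! ## Shift -/

/-- The typing predicate for a label variable. -/
def typeForm {σ : Sig} {n m k : ℕ} (x : LVar σ.lb k) : LSort → Form σ n m k
  | .list => .tt
  | s => .atom (.typ s x)

/-- An expression of the rule as a term over the right-hand graph. -/
def URule.expR (r : URule) (e : LExp r.τ r.I) : LTerm r.sigR 0 0 0 :=
  e.toTerm id r.indegAt r.outdegAt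

/-- The specification of the right-hand graph. The typing predicates range over all variables
declared in the rule. -/
def URule.spec (r : URule) : Form r.sigR 0 0 0 :=
  .and (bigAnd (List.ofFn (fun x : Fin r.p => typeForm (.free x) (r.τ x))))
    (.and
      (bigAnd ((enum r.VR).map (fun v =>
        .and (.atom (.listRel .eq (.labV (.const v)) (r.expR (r.R.labV v))))
          (.and (.atom (.vmRel .eq (.mark (.const v)) (.lit (r.R.markV v))))
            (if r.R.root v then .atom (.root (.const v))
              else .not (.atom (.root (.const v))))))))
      (bigAnd ((enum r.ER).map (fun e =>
        .and (.atom (.nodeRel .eq (.src (.const e)) (.const (r.R.src e))))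
          (.and (.atom (.nodeRel .eq (.tgt (.const e)) (.const (r.R.tgt e))))
            (.and (.atom (.listRel .eq (.labE (.const e)) (r.expR (r.R.labE e))))
              (.atom (.emRel .eq (.mark (.const e)) (.lit (r.R.markE e))))))))))

def shift (c : Sentence) (w : GenRule) : Form w.r.sigR 0 0 0 :=
  .and (w.r.adj (lift c w)) (.and w.acR (.and w.r.spec w.r.inv.dang))

/-! ## Var and Post -/

/-- The position of an identifier. -/
def idx (S : Finset ℕ) (v : S) : Fin S.card := (S.orderIsoOfFin rfl).symm v

/-- Replacement of node and edge constants and of free label variables by variables. -/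
def Subst.close (p : ℕ) (V E : Finset ℕ) :
    Subst (Sig.over p V E) Sig.closed 0 0 0 V.card E.card p where
  nd := fun
    | .const v => .var (idx V v)
    | .var i => Fin.elim0 i
    | .src (.const e) => .src (.var (idx E e))
    | .src (.var i) => Fin.elim0 i
    | .tgt (.const e) => .tgt (.var (idx E e))
    | .tgt (.var i) => Fin.elim0 i
  ed := fun
    | .const e => .var (idx E e)
    | .var i => Fin.elim0 i
  lb := fun
    | .free x => .var x
    | .var i => Fin.elim0 i
  cn := Empty.elim

/-- The pairs `i < j` in `Fin n`. -/
def pairs (n : ℕ) : List (Fin n × Fin n) :=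
  ((List.finRange n).product (List.finRange n)).filter (fun q => q.1 < q.2)

/-- The formula Var: constants become pairwise distinct variables. -/
def variablise {p : ℕ} {V E : Finset ℕ} (c : Form (Sig.over p V E) 0 0 0) :
    Form Sig.closed V.card E.card p :=
  .and (bigAnd ((pairs V.card).map (fun q => .atom (.nodeRel .ne (.var q.1) (.var q.2)))))
    (.and (bigAnd ((pairs E.card).map (fun q => .atom (.edgeRel .ne (.var q.1) (.var q.2)))))
      (c.subst (Subst.close p V E)))

def exVs {σ : Sig} {m k : ℕ} : (n : ℕ) → Form σ n m k → Form σ 0 m k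
  | 0, c => c
  | n + 1, c => exVs n (.exV c)

def exEs {σ : Sig} {n k : ℕ} : (m : ℕ) → Form σ n m k → Form σ n 0 k
  | 0, c => c
  | m + 1, c => exEs m (.exE c)

def exLs {σ : Sig} {n m : ℕ} : (k : ℕ) → Form σ n m k → Form σ n m 0
  | 0, c => c
  | k + 1, c => exLs k (.exL c)

/-- The formula Post. -/
def post (c : Sentence) (w : GenRule) : Sentence :=
  exVs _ (exEs _ (exLs _ (variablise (shift c w))))

/-- The formula `Slp(c, r)`. -/
def slp (c : Sentence) (r : RuleSchema) : Sentence := post c r.gen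

/-- The formula `Slp(c, r⁻¹)`. -/
def slpInv (c : Sentence) (r : RuleSchema) : Sentence := post c r.gen.inv

end GP2

namespace GP2

/-! The predicate "every result of `r` at `G` satisfies `d`" is itself a weakest liberal
precondition, and two weakest ones imply each other. Everything therefore reduces to
`models_slpInv`: the formula `slpInv c r` holds at `G` iff some result of `r` at `G` satisfies `c`.
The theorem is this equivalence for the negation of `d`, negated.

Let `u` be the inverse rule, so that its right-hand graph is matched in `G` and its left-hand graph
occurs in the result `H`. By `models_closure`, the quantifiers and inequations of Post assert an
injective assignment of items of `G` to the constants. By `RuleSchema.Matches.exists_isMatch` and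
`RuleSchema.IsMatch.matches`, the conjuncts for the application condition, Spec and Dang say that
this assignment is a match satisfying the dangling condition. Such a match extends to a natural
double-pushout (`RuleSchema.exists_produces`). Conversely, the two pushouts exhibit `G` and `H` as
gluings of the rule graphs with one common graph `D` along the interface (`gluing_of_isPushout`);
the resulting data are collected in `URule.Step`.

What remains is `URule.Step.sat_adj_lift`: Adj(Lift(c)) holds in `G` iff `c` holds in `H`. Split
does not change the meaning in `H` (`URule.sat_split`), but afterwards the remaining node and edge
quantifiers range only outside the occurrence of the rule graph, and endpoints of edges inside it
have become constants. Each term is then either determined by the rule, which Val computes, or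
denotes an item of `D`. Outside the interface, nodes of `D` have the same label, mark, root flag and
degrees in `G` and `H`, so Adj may read them in `G`. Formulas between Val and Adj are never
interpreted: the composite in `G` is compared directly with the original in `H`. Since Split
instantiates variables by constants, the induction needs a statement stable under substitution,
which is `URule.Step.Good`; `URule.Step.good_split` proves it for every split formula. -/

theorem mem_enum {S : Finset ℕ} (x : S) : x ∈ enum S := by
  simp only [enum, List.mem_ofFn]
  exact ⟨(S.orderIsoOfFin rfl).symm x, by simp⟩

/-! ### Finite conjunctions and disjunctions, substitution and iterated quantifiers -/

section Basic

variable {σ σ' σ'' : Sig} {G : HostGraph} {n m k n' m' k' n'' m'' k'' : ℕ}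

theorem sat_bigAnd (a : Assignment σ G n m k) (l : List (Form σ n m k)) :
    (bigAnd l).sat a ↔ ∀ c ∈ l, c.sat a := by
  induction l with
  | nil => simp [bigAnd, Form.sat]
  | cons c l ih => simp [bigAnd, Form.sat, ih]

theorem sat_bigOr (a : Assignment σ G n m k) (l : List (Form σ n m k)) :
    (bigOr l).sat a ↔ ∃ c ∈ l, c.sat a := by
  induction l with
  | nil => simp [bigOr, Form.sat]
  | cons c l ih => simp [bigOr, Form.sat, ih]

theorem subst_bigAnd (s : Subst σ σ' n m k n' m' k') (l : List (Form σ n m k)) :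
    (bigAnd l).subst s = bigAnd (l.map (Form.subst s)) := by
  induction l with
  | nil => simp [bigAnd, Form.subst]
  | cons c l ih => simp [bigAnd, Form.subst, ih]

theorem subst_bigOr (s : Subst σ σ' n m k n' m' k') (l : List (Form σ n m k)) :
    (bigOr l).subst s = bigOr (l.map (Form.subst s)) := by
  induction l with
  | nil => simp [bigOr, Form.subst]
  | cons c l ih => simp [bigOr, Form.subst, ih]

/-! ### Evaluation of weakened terms -/

theorem ETerm.eval_pushV (a : Assignment σ G n m k) (x : G.V) (e : ETerm σ m) :
    e.eval (a.pushV x) = e.eval a := by cases e <;> rfl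

theorem ETerm.eval_pushL (a : Assignment σ G n m k) (x : GPList) (e : ETerm σ m) :
    e.eval (a.pushL x) = e.eval a := by cases e <;> rfl

theorem ETerm.eval_wk (a : Assignment σ G n m k) (x : G.E) (e : ETerm σ m) :
    e.wk.eval (a.pushE x) = e.eval a := by cases e <;> rfl

theorem NTerm.eval_wkV (a : Assignment σ G n m k) (x : G.V) (t : NTerm σ n m) :
    t.wkV.eval (a.pushV x) = t.eval a := by
  cases t <;> simp [NTerm.wkV, NTerm.eval, ETerm.eval_pushV] <;> rfl

theorem NTerm.eval_wkE (a : Assignment σ G n m k) (x : G.E) (t : NTerm σ n m) :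
    t.wkE.eval (a.pushE x) = t.eval a := by
  cases t <;> simp [NTerm.wkE, NTerm.eval, ETerm.eval_wk] <;> rfl

theorem NTerm.eval_pushL (a : Assignment σ G n m k) (x : GPList) (t : NTerm σ n m) :
    t.eval (a.pushL x) = t.eval a := by
  cases t <;> simp [NTerm.eval, ETerm.eval_pushL] <;> rfl

theorem LVar.eval_wk {X : Type} (lb : X → GPList) (vl : Fin k → GPList) (l : GPList)
    (x : LVar X k) : x.wk.eval lb (Fin.cons l vl : Fin (k + 1) → GPList) = x.eval lb vl := by
  cases x <;> rfl

/-! ### Composition of substitutions -/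

@[ext]
theorem Subst.ext {s s' : Subst σ σ' n m k n' m' k'} (h₁ : ∀ t, s.nd t = s'.nd t)
    (h₂ : ∀ t, s.ed t = s'.ed t) (h₃ : ∀ t, s.lb t = s'.lb t) (h₄ : ∀ t, s.cn t = s'.cn t) :
    s = s' := by
  cases s; cases s'
  simp only [Subst.mk.injEq]
  exact ⟨funext h₁, funext h₂, funext h₃, funext h₄⟩

def Subst.comp (s : Subst σ σ' n m k n' m' k') (s' : Subst σ' σ'' n' m' k' n'' m'' k'') :
    Subst σ σ'' n m k n'' m'' k'' where
  nd t := s'.nd (s.nd t)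
  ed t := s'.ed (s.ed t)
  lb t := s'.lb (s.lb t)
  cn t := s'.cn (s.cn t)

def Subst.refl : Subst σ σ n m k n m k := ⟨fun t => t, fun t => t, fun t => t, fun t => t⟩

theorem Subst.upV_nd_wkV (s : Subst σ σ' n m k n' m' k') (t : NTerm σ n m) :
    s.upV.nd t.wkV = (s.nd t).wkV := by cases t <;> rfl

theorem Subst.upE_ed_wk (s : Subst σ σ' n m k n' m' k') (t : ETerm σ m) :
    s.upE.ed t.wk = (s.ed t).wk := by cases t <;> rfl

theorem Subst.upE_nd_wkE (s : Subst σ σ' n m k n' m' k') (t : NTerm σ n m) :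
    s.upE.nd t.wkE = (s.nd t).wkE := by
  rcases t with _ | _ | (_ | _) | (_ | _) <;> rfl

theorem Subst.upL_lb_wk (s : Subst σ σ' n m k n' m' k') (t : LVar σ.lb k) :
    s.upL.lb t.wk = (s.lb t).wk := by cases t <;> rfl

theorem Subst.upV_comp (s : Subst σ σ' n m k n' m' k')
    (s' : Subst σ' σ'' n' m' k' n'' m'' k'') : (s.comp s').upV = s.upV.comp s'.upV := by
  ext t
  · rcases t with v | i | e | e
    · exact (Subst.upV_nd_wkV s' _).symm
    · refine Fin.cases rfl (fun j => ?_) i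
      exact (Subst.upV_nd_wkV s' _).symm
    · exact (Subst.upV_nd_wkV s' _).symm
    · exact (Subst.upV_nd_wkV s' _).symm
  all_goals rfl

theorem Subst.upE_comp (s : Subst σ σ' n m k n' m' k')
    (s' : Subst σ' σ'' n' m' k' n'' m'' k'') : (s.comp s').upE = s.upE.comp s'.upE := by
  ext t
  · rcases t with v | i | (e | i) | (e | i)
    · exact (Subst.upE_nd_wkE s' _).symm
    · exact (Subst.upE_nd_wkE s' _).symm
    · exact (Subst.upE_nd_wkE s' _).symm
    · refine Fin.cases rfl (fun j => ?_) i
      exact (Subst.upE_nd_wkE s' _).symm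
    · exact (Subst.upE_nd_wkE s' _).symm
    · refine Fin.cases rfl (fun j => ?_) i
      exact (Subst.upE_nd_wkE s' _).symm
  · rcases t with e | i
    · exact (Subst.upE_ed_wk s' _).symm
    · refine Fin.cases rfl (fun j => ?_) i
      exact (Subst.upE_ed_wk s' _).symm
  all_goals rfl

theorem Subst.upL_comp (s : Subst σ σ' n m k n' m' k')
    (s' : Subst σ' σ'' n' m' k' n'' m'' k'') : (s.comp s').upL = s.upL.comp s'.upL := by
  ext t
  · rfl
  · rfl
  · rcases t with e | i
    · exact (Subst.upL_lb_wk s' _).symm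
    · refine Fin.cases rfl (fun j => ?_) i
      exact (Subst.upL_lb_wk s' _).symm
  · rfl

theorem Subst.upV_refl : (Subst.refl : Subst σ σ n m k n m k).upV = Subst.refl := by
  ext t
  · rcases t with v | i | e | e
    · rfl
    · refine Fin.cases rfl (fun j => rfl) i
    · rfl
    · rfl
  all_goals rfl

theorem Subst.upE_refl : (Subst.refl : Subst σ σ n m k n m k).upE = Subst.refl := by
  ext t
  · rcases t with v | i | (e | i) | (e | i)
    · rfl
    · rfl
    · rfl
    · refine Fin.cases rfl (fun j => rfl) i
    · rfl
    · refine Fin.cases rfl (fun j => rfl) i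
  · rcases t with e | i
    · rfl
    · refine Fin.cases rfl (fun j => rfl) i
  all_goals rfl

theorem Subst.upL_refl : (Subst.refl : Subst σ σ n m k n m k).upL = Subst.refl := by
  ext t
  · rfl
  · rfl
  · rcases t with e | i
    · rfl
    · refine Fin.cases rfl (fun j => rfl) i
  · rfl

theorem ITerm.subst_subst (s : Subst σ σ' n m k n' m' k')
    (s' : Subst σ' σ'' n' m' k' n'' m'' k'') (t : ITerm σ n m k) :
    (t.subst s).subst s' = t.subst (s.comp s') := by
  induction t <;> simp_all [ITerm.subst, Subst.comp]

theorem STerm.subst_subst {X Y Z : Type} (f : LVar X k → LVar Y k') (f' : LVar Y k' → LVar Z k'')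
    (t : STerm X k) : (t.subst f).subst f' = t.subst (fun x => f' (f x)) := by
  induction t <;> simp_all [STerm.subst]

theorem LTerm.subst_subst (s : Subst σ σ' n m k n' m' k')
    (s' : Subst σ' σ'' n' m' k' n'' m'' k'') (t : LTerm σ n m k) :
    (t.subst s).subst s' = t.subst (s.comp s') := by
  induction t <;> simp_all [LTerm.subst, ITerm.subst_subst, STerm.subst_subst] <;>
    simp [Subst.comp]

theorem VMTerm.subst_subst (s : Subst σ σ' n m k n' m' k')
    (s' : Subst σ' σ'' n' m' k' n'' m'' k'') (t : VMTerm σ n m) :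
    (t.subst s).subst s' = t.subst (s.comp s') := by cases t <;> rfl

theorem EMTerm.subst_subst (s : Subst σ σ' n m k n' m' k')
    (s' : Subst σ' σ'' n' m' k' n'' m'' k'') (t : EMTerm σ m) :
    (t.subst s).subst s' = t.subst (s.comp s') := by cases t <;> rfl

/-- Split creates substituted copies of a body. This fusion law turns an instance of such a copy
into an instance of the body itself, to which an induction hypothesis quantified over all
substitutions applies. -/
theorem Form.subst_subst (s : Subst σ σ' n m k n' m' k')
    (s' : Subst σ' σ'' n' m' k' n'' m'' k'') (c : Form σ n m k) :
    (c.subst s).subst s' = c.subst (s.comp s') := by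
  induction c generalizing n' m' k' n'' m'' k'' with
  | tt => rfl
  | ff => rfl
  | atom a =>
    cases a <;> simp [Form.subst, Atomic.subst, ITerm.subst_subst, LTerm.subst_subst,
      VMTerm.subst_subst, EMTerm.subst_subst] <;> simp [Subst.comp]
  | and c c' ih ih' => simp [Form.subst, ih, ih']
  | or c c' ih ih' => simp [Form.subst, ih, ih']
  | not c ih => simp [Form.subst, ih]
  | exV c ih => simp [Form.subst, ih, Subst.upV_comp]
  | exE c ih => simp [Form.subst, ih, Subst.upE_comp]
  | exL c ih => simp [Form.subst, ih, Subst.upL_comp]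

theorem ITerm.subst_refl (t : ITerm σ n m k) : t.subst Subst.refl = t := by
  induction t <;> simp_all [ITerm.subst] <;> rfl

theorem STerm.subst_refl {X : Type} (t : STerm X k) : t.subst (fun x => x) = t := by
  induction t <;> simp_all [STerm.subst]

theorem LTerm.subst_refl (t : LTerm σ n m k) : t.subst Subst.refl = t := by
  induction t with
  | int t => simp [LTerm.subst, ITerm.subst_refl]
  | str t => exact congrArg LTerm.str (STerm.subst_refl t)
  | app a b iha ihb => simp [LTerm.subst, iha, ihb]
  | _ => rfl

theorem Form.subst_refl (c : Form σ n m k) : c.subst Subst.refl = c := by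
  induction c with
  | tt => rfl
  | ff => rfl
  | atom a =>
    cases a with
    | vmRel o s t => cases s <;> cases t <;> rfl
    | emRel o s t => cases s <;> cases t <;> rfl
    | cmp o s t => simp [Form.subst, Atomic.subst, ITerm.subst_refl]
    | listRel o s t => simp [Form.subst, Atomic.subst, LTerm.subst_refl]
    | _ => rfl
  | and c c' ih ih' => simp [Form.subst, ih, ih']
  | or c c' ih ih' => simp [Form.subst, ih, ih']
  | not c ih => simp [Form.subst, ih]
  | exV c ih => simp [Form.subst, ih, Subst.upV_refl]
  | exE c ih => simp [Form.subst, ih, Subst.upE_refl]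
  | exL c ih => simp [Form.subst, ih, Subst.upL_refl]

/-! ### The substitution lemma -/

/-- The values of the terms substituted by `s` under `a` are the values of the original terms
under `a'`. -/
structure Subst.Realizes (s : Subst σ σ' n m k n' m' k') (a : Assignment σ' G n' m' k')
    (a' : Assignment σ G n m k) : Prop where
  nd : ∀ t, (s.nd t).eval a = t.eval a'
  ed : ∀ t, (s.ed t).eval a = t.eval a'
  lb : ∀ x, (s.lb x).eval a.lb a.vl = x.eval a'.lb a'.vl
  cn : ∀ c, a.cn (s.cn c) = a'.cn c

section Realizes

variable {s : Subst σ σ' n m k n' m' k'} {a : Assignment σ' G n' m' k'}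
  {a' : Assignment σ G n m k}

theorem Subst.Realizes.pushV (h : s.Realizes a a') (x : G.V) :
    s.upV.Realizes (a.pushV x) (a'.pushV x) where
  nd t := by
    rcases t with v | i | e | e
    · exact (NTerm.eval_wkV _ _ _).trans (h.nd _)
    · refine Fin.cases rfl (fun j => ?_) i
      exact (NTerm.eval_wkV _ _ _).trans (h.nd _)
    · exact (NTerm.eval_wkV _ _ _).trans ((h.nd _).trans (by
        simp [NTerm.eval, ETerm.eval_pushV]))
    · exact (NTerm.eval_wkV _ _ _).trans ((h.nd _).trans (by
        simp [NTerm.eval, ETerm.eval_pushV]))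
  ed t := by rw [ETerm.eval_pushV, ETerm.eval_pushV]; exact h.ed t
  lb := h.lb
  cn := h.cn

theorem Subst.Realizes.pushE (h : s.Realizes a a') (x : G.E) :
    s.upE.Realizes (a.pushE x) (a'.pushE x) where
  nd t := by
    rcases t with v | i | (e | i) | (e | i)
    · exact (NTerm.eval_wkE _ _ _).trans (h.nd _)
    · exact (NTerm.eval_wkE _ _ _).trans (h.nd _)
    · exact (NTerm.eval_wkE _ _ _).trans (h.nd _)
    · refine Fin.cases rfl (fun j => ?_) i
      exact (NTerm.eval_wkE _ _ _).trans (h.nd _)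
    · exact (NTerm.eval_wkE _ _ _).trans (h.nd _)
    · refine Fin.cases rfl (fun j => ?_) i
      exact (NTerm.eval_wkE _ _ _).trans (h.nd _)
  ed t := by
    rcases t with e | i
    · exact (ETerm.eval_wk _ _ _).trans (h.ed _)
    · refine Fin.cases rfl (fun j => ?_) i
      exact (ETerm.eval_wk _ _ _).trans (h.ed _)
  lb := h.lb
  cn := h.cn

theorem Subst.Realizes.pushL (h : s.Realizes a a') (x : GPList) :
    s.upL.Realizes (a.pushL x) (a'.pushL x) where
  nd t := by rw [NTerm.eval_pushL, NTerm.eval_pushL]; exact h.nd t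
  ed t := by rw [ETerm.eval_pushL, ETerm.eval_pushL]; exact h.ed t
  lb t := by
    rcases t with e | i
    · exact (LVar.eval_wk _ _ _ _).trans (h.lb _)
    · refine Fin.cases rfl (fun j => ?_) i
      exact (LVar.eval_wk _ _ _ _).trans (h.lb _)
  cn := h.cn

theorem Subst.Realizes.iterm (h : s.Realizes a a') (t : ITerm σ n m k) :
    (t.subst s).eval a = t.eval a' := by
  induction t <;> simp_all [ITerm.subst, ITerm.eval, h.nd, h.lb, h.cn]

theorem Subst.Realizes.sterm (h : s.Realizes a a') (t : STerm σ.lb k) :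
    (t.subst s.lb).eval a.lb a.vl = t.eval a'.lb a'.vl := by
  induction t <;> simp_all [STerm.subst, STerm.eval, h.lb]

theorem Subst.Realizes.lterm (h : s.Realizes a a') (t : LTerm σ n m k) :
    (t.subst s).eval a = t.eval a' := by
  induction t <;> simp_all [LTerm.subst, LTerm.eval, h.nd, h.ed, h.lb, h.iterm, h.sterm]

theorem Subst.Realizes.atomic (h : s.Realizes a a') (b : Atomic σ n m k) :
    (b.subst s).sat a ↔ b.sat a' := by
  cases b with
  | vmRel o t t' => cases t <;> cases t' <;> simp [Atomic.subst, Atomic.sat, VMTerm.subst,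
      VMTerm.eval, h.nd]
  | emRel o t t' => cases t <;> cases t' <;> simp [Atomic.subst, Atomic.sat, EMTerm.subst,
      EMTerm.eval, h.ed]
  | _ => simp [Atomic.subst, Atomic.sat, h.nd, h.ed, h.lb, h.iterm, h.lterm]

end Realizes

/-- Substitutions here rewrite whole node terms: the source of an edge variable may be replaced
while the variable itself stays. Agreement is therefore assumed on all node and edge terms instead
of being derived from agreement on variables, and the induction only has to carry it under the
quantifiers. -/
theorem Subst.Realizes.sat {s : Subst σ σ' n m k n' m' k'} {a : Assignment σ' G n' m' k'}
    {a' : Assignment σ G n m k} (h : s.Realizes a a') (c : Form σ n m k) :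
    (c.subst s).sat a ↔ c.sat a' := by
  induction c generalizing n' m' k' with
  | tt => rfl
  | ff => rfl
  | atom b => exact h.atomic b
  | and c c' ih ih' => simp [Form.subst, Form.sat, ih h, ih' h]
  | or c c' ih ih' => simp [Form.subst, Form.sat, ih h, ih' h]
  | not c ih => simp [Form.subst, Form.sat, ih h]
  | exV c ih => exact exists_congr fun x => ih (h.pushV x)
  | exE c ih => exact exists_congr fun x => ih (h.pushE x)
  | exL c ih => exact exists_congr fun x => ih (h.pushL x)

theorem Subst.realizes_instV (v : σ.nd) (a : Assignment σ G n m k) :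
    (Subst.instV v).Realizes a (a.pushV (a.nd v)) where
  nd t := by
    rcases t with u | i | e | e
    · rfl
    · exact Fin.cases rfl (fun j => rfl) i
    · simp [Subst.instV, NTerm.eval, ETerm.eval_pushV]
    · simp [Subst.instV, NTerm.eval, ETerm.eval_pushV]
  ed t := (ETerm.eval_pushV _ _ _).symm
  lb _ := rfl
  cn _ := rfl

theorem ETerm.eval_inst (e : σ.ed) (a : Assignment σ G n m k) (t : ETerm σ (m + 1)) :
    (t.inst e).eval a = t.eval (a.pushE (a.ed e)) := by
  rcases t with f | i
  · rfl
  · exact Fin.cases rfl (fun j => rfl) i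

theorem Subst.realizes_instE (e : σ.ed) (a : Assignment σ G n m k) :
    (Subst.instE e).Realizes a (a.pushE (a.ed e)) where
  nd t := by
    rcases t with u | i | t | t
    · rfl
    · rfl
    · exact congrArg G.src (ETerm.eval_inst e a t)
    · exact congrArg G.tgt (ETerm.eval_inst e a t)
  ed t := ETerm.eval_inst e a t
  lb _ := rfl
  cn _ := rfl

/-- Replacing the source by a constant is harmless only where the two are equal; in `URule.inc` the
guard of the disjunct supplies this equation. -/
theorem Subst.realizes_replSrc {v : σ.nd} {a : Assignment σ G n (m + 1) k}
    (h : G.src (a.ve 0) = a.nd v) : (Subst.replSrc v).Realizes a a where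
  nd t := by
    rcases t with u | i | (e | i) | t
    · rfl
    · rfl
    · rfl
    · exact Fin.cases h.symm (fun j => rfl) i
    · rfl
  ed _ := rfl
  lb _ := rfl
  cn _ := rfl

theorem Subst.realizes_replTgt {v : σ.nd} {a : Assignment σ G n (m + 1) k}
    (h : G.tgt (a.ve 0) = a.nd v) : (Subst.replTgt v).Realizes a a where
  nd t := by
    rcases t with u | i | t | (e | i)
    · rfl
    · rfl
    · rfl
    · rfl
    · exact Fin.cases h.symm (fun j => rfl) i
  ed _ := rfl
  lb _ := rfl
  cn _ := rfl

theorem Subst.realizes_wkE (a : Assignment σ G n m k) (x : G.E) :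
    (Subst.wkE).Realizes (a.pushE x) a where
  nd _ := NTerm.eval_wkE _ _ _
  ed _ := ETerm.eval_wk _ _ _
  lb _ := rfl
  cn _ := rfl

/-- Over the closed signature and in the empty scope there are no node terms, edge terms or label
variables, so the claim is vacuous. -/
theorem Subst.realizes_ofClosed (a : Assignment σ G 0 0 0) (a' : Assignment Sig.closed G 0 0 0) :
    Subst.ofClosed.Realizes a a' where
  nd t := by
    rcases t with u | i | (e | i) | (e | i)
    · exact u.elim
    · exact i.elim0
    · exact e.elim
    · exact i.elim0
    · exact e.elim
    · exact i.elim0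
  ed t := by
    rcases t with e | i
    · exact e.elim
    · exact i.elim0
  lb t := by
    rcases t with e | i
    · exact e.elim
    · exact i.elim0
  cn c := c.elim

/-! ### Iterated quantifiers -/

theorem sat_exVs (n : ℕ) (c : Form σ n m k) (a : Assignment σ G 0 m k) :
    (exVs n c).sat a ↔ ∃ vn : Fin n → G.V, c.sat ⟨a.nd, a.ed, a.lb, a.cn, vn, a.ve, a.vl⟩ := by
  induction n with
  | zero =>
    refine ⟨fun h => ⟨a.vn, h⟩, fun ⟨vn, h⟩ => ?_⟩
    have : vn = a.vn := funext fun i => i.elim0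
    subst this; exact h
  | succ n ih =>
    rw [exVs, ih]
    constructor
    · rintro ⟨vn, x, h⟩
      exact ⟨_, h⟩
    · rintro ⟨vn, h⟩
      -- Index `0` belongs to the innermost quantifier: the outer ones choose the tail, the last one
      -- the head.
      refine ⟨Fin.tail vn, vn 0, ?_⟩
      simpa [Assignment.pushV, Fin.cons_self_tail] using h

theorem sat_exEs (m : ℕ) (c : Form σ n m k) (a : Assignment σ G n 0 k) :
    (exEs m c).sat a ↔ ∃ ve : Fin m → G.E, c.sat ⟨a.nd, a.ed, a.lb, a.cn, a.vn, ve, a.vl⟩ := by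
  induction m with
  | zero =>
    refine ⟨fun h => ⟨a.ve, h⟩, fun ⟨ve, h⟩ => ?_⟩
    have : ve = a.ve := funext fun i => i.elim0
    subst this; exact h
  | succ n ih =>
    rw [exEs, ih]
    constructor
    · rintro ⟨vn, x, h⟩
      exact ⟨_, h⟩
    · rintro ⟨vn, h⟩
      refine ⟨Fin.tail vn, vn 0, ?_⟩
      simpa [Assignment.pushE, Fin.cons_self_tail] using h

theorem sat_exLs (k : ℕ) (c : Form σ n m k) (a : Assignment σ G n m 0) :
    (exLs k c).sat a ↔
      ∃ vl : Fin k → GPList, c.sat ⟨a.nd, a.ed, a.lb, a.cn, a.vn, a.ve, vl⟩ := by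
  induction k with
  | zero =>
    refine ⟨fun h => ⟨a.vl, h⟩, fun ⟨vl, h⟩ => ?_⟩
    have : vl = a.vl := funext fun i => i.elim0
    subst this; exact h
  | succ n ih =>
    rw [exLs, ih]
    constructor
    · rintro ⟨vn, x, h⟩
      exact ⟨_, h⟩
    · rintro ⟨vn, h⟩
      refine ⟨Fin.tail vn, vn 0, ?_⟩
      simpa [Assignment.pushL, Fin.cons_self_tail] using h

end Basic

/-! ### Split preserves the meaning of formulas -/

section Split

variable (r : URule) {G : HostGraph} {n m k : ℕ}

/-- The guards cover all positions of source and target relative to the named nodes, and under each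
guard the replaced endpoints have the values of the constants replacing them. -/
theorem URule.sat_inc (f : Form r.sigL n (m + 1) k) (a : Assignment r.sigL G n (m + 1) k) :
    (r.inc f).sat a ↔ f.sat a := by
  have hs : ∀ v, G.src (a.ve 0) = a.nd v → ((f.subst (.replSrc v)).sat a ↔ f.sat a) :=
    fun v h => (Subst.realizes_replSrc h).sat f
  have ht : ∀ (f' : Form r.sigL n (m + 1) k) v, G.tgt (a.ve 0) = a.nd v →
      ((f'.subst (.replTgt v)).sat a ↔ f'.sat a) :=
    fun f' v h => (Subst.realizes_replTgt h).sat f'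
  simp only [URule.inc, Form.sat, sat_bigOr, sat_bigAnd, List.mem_map, mem_enum, true_and,
    exists_exists_eq_and, forall_exists_index, forall_apply_eq_imp_iff, Atomic.sat, EqOp.holds,
    NTerm.eval, ETerm.eval]
  constructor
  · rintro (⟨v, ⟨u, h1, h2, h3⟩ | ⟨h1, -, h3⟩ | ⟨-, h2, h3⟩⟩ | ⟨-, -, h⟩)
    · rwa [ht _ _ h2, hs _ h1] at h3
    · rwa [hs _ h1] at h3
    · rwa [ht _ _ h2] at h3
    · exact h
  · intro h
    by_cases h1 : ∃ v, G.src (a.ve 0) = a.nd v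
    · obtain ⟨v, h1⟩ := h1
      by_cases h2 : ∃ v, G.tgt (a.ve 0) = a.nd v
      · obtain ⟨u, h2⟩ := h2
        exact Or.inl ⟨v, Or.inl ⟨u, h1, h2, by rwa [ht _ _ h2, hs _ h1]⟩⟩
      · exact Or.inl ⟨v, Or.inr (Or.inl ⟨h1, not_exists.1 h2, by rwa [hs _ h1]⟩)⟩
    · by_cases h2 : ∃ v, G.tgt (a.ve 0) = a.nd v
      · obtain ⟨u, h2⟩ := h2
        exact Or.inl ⟨u, Or.inr (Or.inr ⟨not_exists.1 h1, h2, by rwa [ht _ _ h2]⟩)⟩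
      · exact Or.inr ⟨not_exists.1 h1, not_exists.1 h2, h⟩

/-- A witness either is the value of some constant, and then the instantiated disjunct applies, or
differs from all of them, and then the guarded quantifier applies. The argument needs no injectivity
of the assignment. -/
theorem URule.sat_split (c : Form r.sigL n m k) (a : Assignment r.sigL G n m k) :
    (r.split c).sat a ↔ c.sat a := by
  induction c with
  | tt => rfl
  | ff => rfl
  | atom b => rfl
  | and c c' ih ih' => simp [URule.split, Form.sat, ih, ih']
  | or c c' ih ih' => simp [URule.split, Form.sat, ih, ih']
  | not c ih => simp [URule.split, Form.sat, ih]
  | exV c ih =>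
    simp only [URule.split, Form.sat, sat_bigOr, sat_bigAnd, List.mem_map, mem_enum, true_and,
      exists_exists_eq_and, forall_exists_index, forall_apply_eq_imp_iff, Atomic.sat, EqOp.holds,
      NTerm.eval, ih, (Subst.realizes_instV _ _).sat]
    constructor
    · rintro (⟨v, h⟩ | ⟨x, -, h⟩)
      · exact ⟨_, h⟩
      · exact ⟨_, h⟩
    · rintro ⟨x, h⟩
      by_cases hx : ∃ v, x = a.nd v
      · obtain ⟨v, rfl⟩ := hx
        exact Or.inl ⟨v, h⟩
      · exact Or.inr ⟨x, fun v hv => hx ⟨v, hv⟩, h⟩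
  | exE c ih =>
    simp only [URule.split, Form.sat, sat_bigOr, sat_bigAnd, List.mem_map, mem_enum, true_and,
      exists_exists_eq_and, forall_exists_index, forall_apply_eq_imp_iff, Atomic.sat, EqOp.holds,
      ETerm.eval, ih, URule.sat_inc, (Subst.realizes_instE _ _).sat]
    constructor
    · rintro (⟨v, h⟩ | ⟨x, -, h⟩)
      · exact ⟨_, h⟩
      · exact ⟨_, h⟩
    · rintro ⟨x, h⟩
      by_cases hx : ∃ v, x = a.ed v
      · obtain ⟨v, rfl⟩ := hx
        exact Or.inl ⟨v, h⟩
      · exact Or.inr ⟨x, fun v hv => hx ⟨v, hv⟩, h⟩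
  | exL c ih => simp [URule.split, Form.sat, ih]

end Split

/-! ### Rule expressions as terms -/

theorem asInt_of_dom {l : GPList} (h : l ∈ LSort.int.dom) : asInt l = some ((asInt l).getD 0) := by
  obtain ⟨z, rfl⟩ := h; rfl

theorem asAtom_of_dom {l : GPList} (h : l ∈ LSort.atom.dom) :
    ∃ b, l = [b] ∧ asAtom l = some b := by
  obtain ⟨z, rfl⟩ := h; exact ⟨z, rfl, rfl⟩

theorem asStr_of_dom {l : GPList} (h : l ∈ LSort.string.dom) :
    asStr l = some ((asStr l).getD []) := by
  obtain ⟨z, rfl⟩ := h; rfl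

theorem asChar_of_dom {l : GPList} (h : l ∈ LSort.char.dom) :
    asChar l = some ((asChar l).getD []) := by
  obtain ⟨z, rfl⟩ := h; rfl

section Expressions

variable {p : ℕ} {τ : Fin p → LSort} {I : Finset ℕ} {val : Fin p → GPList} {σ : Sig}
  {G G' : HostGraph} {n m k : ℕ}

theorem TVar.mem_dom (hval : ∀ x, val x ∈ (τ x).dom) {q : LSort} (x : TVar τ q) :
    val x.1 ∈ q.dom := by
  have := hval x.1
  rwa [x.2] at this

/-- Terms are partial and rule expressions are total with defaults; typed values keep the terms
defined, so no default is reached. The translation of the degree operators is left abstract because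
it differs between application conditions (degrees of constants) and rule labels (`indegAt`,
`outdegAt`). -/
theorem IntExp.eval_toTerm (hval : ∀ x, val x ∈ (τ x).dom) {a : Assignment σ G' n m k}
    {lb : Fin p → σ.lb} (hlb : ∀ x, a.lb (lb x) = val x) {g : I → G.V}
    {din dout : I → ITerm σ n m k} (hin : ∀ i, (din i).eval a = some (G.indeg (g i)))
    (hout : ∀ i, (dout i).eval a = some (G.outdeg (g i))) (e : IntExp τ I) :
    (e.toTerm lb din dout).eval a = some (e.eval G g val) := by
  induction e with
  | num z => rfl
  | var x =>
    simpa only [IntExp.toTerm, ITerm.eval, LVar.eval, hlb, IntExp.eval] using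
      asInt_of_dom (TVar.mem_dom hval x)
  | indeg v => exact hin v
  | outdeg v => exact hout v
  | lenA x =>
    obtain ⟨b, -, h⟩ := asAtom_of_dom (TVar.mem_dom hval x)
    simp [IntExp.toTerm, ITerm.eval, LVar.eval, hlb, IntExp.eval, h]
  | lenS x =>
    have h := asStr_of_dom (TVar.mem_dom hval x)
    simp only [IntExp.toTerm, ITerm.eval, LVar.eval, hlb, IntExp.eval]
    rw [h]; rfl
  | lenL x => simp [IntExp.toTerm, ITerm.eval, LVar.eval, hlb, IntExp.eval]
  | _ => simp_all [IntExp.toTerm, ITerm.eval, IntExp.eval]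

theorem StrExp.eval_toTerm (hval : ∀ x, val x ∈ (τ x).dom) {X : Type} {lb : X → GPList}
    {vl : Fin k → GPList} {f : Fin p → X} (hlb : ∀ x, lb (f x) = val x) (e : StrExp τ) :
    (e.toTerm f).eval lb vl = some (e.eval val) := by
  induction e with
  | lit z => rfl
  | charVar x =>
    simpa only [StrExp.toTerm, STerm.eval, LVar.eval, hlb, StrExp.eval] using
      asChar_of_dom (TVar.mem_dom hval x)
  | strVar x =>
    simpa only [StrExp.toTerm, STerm.eval, LVar.eval, hlb, StrExp.eval] using
      asStr_of_dom (TVar.mem_dom hval x)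
  | cat a b iha ihb => simp [StrExp.toTerm, STerm.eval, iha, ihb, StrExp.eval]

theorem LExp.eval_toTerm (hval : ∀ x, val x ∈ (τ x).dom) {a : Assignment σ G' n m k}
    {lb : Fin p → σ.lb} (hlb : ∀ x, a.lb (lb x) = val x) {g : I → G.V}
    {din dout : I → ITerm σ n m k} (hin : ∀ i, (din i).eval a = some (G.indeg (g i)))
    (hout : ∀ i, (dout i).eval a = some (G.outdeg (g i))) (e : LExp τ I) :
    (e.toTerm lb din dout).eval a = some (e.eval G g val) := by
  induction e with
  | empty => rfl
  | int e => simp [LExp.toTerm, LTerm.eval, LExp.eval, IntExp.eval_toTerm hval hlb hin hout]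
  | str e => simp [LExp.toTerm, LTerm.eval, LExp.eval, StrExp.eval_toTerm hval hlb]
  | atomVar x =>
    obtain ⟨b, h, -⟩ := asAtom_of_dom (TVar.mem_dom hval x)
    simp [LExp.toTerm, LTerm.eval, LVar.eval, hlb, LExp.eval, h, asAtom]
  | listVar x => simp [LExp.toTerm, LTerm.eval, LVar.eval, hlb, LExp.eval]
  | app a b iha ihb => simp [LExp.toTerm, LTerm.eval, LExp.eval, iha, ihb]

theorem Cond.sat_toForm {E : Finset ℕ} (hval : ∀ x, val x ∈ (τ x).dom)
    (a : Assignment (Sig.over p I E) G 0 0 0) (hlb : a.lb = val) (c : Cond τ I) :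
    c.toForm.sat a ↔ c.holds G a.nd val := by
  have hL : ∀ e : LExp τ I, (e.toTerm (σ := Sig.over p I E) (n := 0) (m := 0) (k := 0) id
      (fun v => .indeg (.const v)) (fun v => .outdeg (.const v))).eval a =
        some (e.eval G a.nd val) := fun e =>
    LExp.eval_toTerm hval (fun x => by rw [hlb]; rfl) (fun _ => rfl) (fun _ => rfl) e
  have hI : ∀ e : IntExp τ I, (e.toTerm (σ := Sig.over p I E) (n := 0) (m := 0) (k := 0) id
      (fun v => .indeg (.const v)) (fun v => .outdeg (.const v))).eval a =
        some (e.eval G a.nd val) := fun e =>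
    IntExp.eval_toTerm hval (fun x => by rw [hlb]; rfl) (fun _ => rfl) (fun _ => rfl) e
  induction c with
  | typ s x => simp [Cond.toForm, Form.sat, Atomic.sat, LVar.eval, hlb, Cond.holds]
  | listRel o e e' => simp [Cond.toForm, Form.sat, Atomic.sat, hL, Cond.holds]
  | cmp o e e' => simp [Cond.toForm, Form.sat, Atomic.sat, hI, Cond.holds]
  | edge u v l =>
    simp only [Cond.toForm, Form.edge, Form.sat, Cond.holds, sat_bigAnd]
    refine exists_congr fun e => ?_
    rcases l with _ | ⟨l, _ | q⟩
    · simp [Form.sat, Atomic.sat, NTerm.eval, ETerm.eval, EqOp.holds, NTerm.wkE]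
      simp [Assignment.pushE]
    · simp [Form.sat, Atomic.sat, NTerm.eval, ETerm.eval, EqOp.holds, NTerm.wkE, LTerm.eval,
        (Subst.realizes_wkE _ _).lterm, hL]
      simp [Assignment.pushE]
    · simp [Form.sat, Atomic.sat, NTerm.eval, ETerm.eval, EqOp.holds, NTerm.wkE, LTerm.eval,
        (Subst.realizes_wkE _ _).lterm, hL, EMTerm.eval]
      simp [Assignment.pushE]
  | not c ih => simp [Cond.toForm, Form.sat, Cond.holds, ih]
  | and c c' ih ih' => simp [Cond.toForm, Form.sat, Cond.holds, ih, ih']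
  | or c c' ih ih' => simp [Cond.toForm, Form.sat, Cond.holds, ih, ih']

end Expressions

/-! ### Gluings -/

/-- The node set `VG` and the edge set `EG` are obtained by gluing two graphs along a discrete
graph with nodes `VK`. -/
structure Gluing {VK VX EX VD ED VG EG : Type} (i : VK → VX) (k : VK → VD) (mV : VX → VG)
    (mE : EX → EG) (dV : VD → VG) (dE : ED → EG) : Prop where
  mV_inj : Function.Injective mV
  mE_inj : Function.Injective mE
  dV_inj : Function.Injective dV
  dE_inj : Function.Injective dE
  comm : ∀ a, mV (i a) = dV (k a)
  coverV : ∀ x, (∃ v, mV v = x) ∨ ∃ y, dV y = x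
  coverE : ∀ x, (∃ v, mE v = x) ∨ ∃ y, dE y = x
  meetV : ∀ v y, mV v = dV y → ∃ a, i a = v ∧ k a = y
  meetE : ∀ v y, mE v ≠ dE y

section Gluing

variable {VK VX EX VD ED VG EG : Type} {i : VK → VX} {k : VK → VD} {mV : VX → VG}
  {mE : EX → EG} {dV : VD → VG} {dE : ED → EG}
  {sG : EG → VG} {sX : EX → VX} {sD : ED → VD}

/-- The interface has no edges, so the edges of the glued graph are the disjoint union of the two
edge sets. The endpoint map `sG` stands for either the source or the target map, which serves out-
and indegrees alike. -/
theorem Gluing.card_eq (h : Gluing i k mV mE dV dE) [Finite EX] [Finite ED]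
    (hX : ∀ e, sG (mE e) = mV (sX e)) (hD : ∀ e, sG (dE e) = dV (sD e)) (x : VG) :
    Nat.card {e // sG e = x} = Nat.card {e // mV (sX e) = x} + Nat.card {e // dV (sD e) = x} := by
  rw [← Nat.card_sum]
  refine (Nat.card_congr (Equiv.ofBijective
    (Sum.elim (fun e => ⟨mE e.1, (hX _).trans e.2⟩) (fun e => ⟨dE e.1, (hD _).trans e.2⟩) :
      {e // mV (sX e) = x} ⊕ {e // dV (sD e) = x} → {e // sG e = x}) ⟨?_, ?_⟩)).symm
  · rintro (⟨e, he⟩ | ⟨e, he⟩) (⟨f, hf⟩ | ⟨f, hf⟩) hef <;> simp only [Sum.elim_inl, Sum.elim_inr,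
      Subtype.mk.injEq] at hef
    · simp [h.mE_inj hef]
    · exact (h.meetE _ _ hef).elim
    · exact (h.meetE _ _ hef.symm).elim
    · simp [h.dE_inj hef]
  · rintro ⟨e, he⟩
    rcases h.coverE e with ⟨f, rfl⟩ | ⟨f, rfl⟩
    · exact ⟨.inl ⟨f, (hX _).symm.trans he⟩, rfl⟩
    · exact ⟨.inr ⟨f, (hD _).symm.trans he⟩, rfl⟩

/-- No edge of `X` can end at a node of `D` outside the interface, because a common node must come
from the interface. -/
theorem Gluing.card_outside (h : Gluing i k mV mE dV dE) [Finite EX] [Finite ED]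
    (hX : ∀ e, sG (mE e) = mV (sX e)) (hD : ∀ e, sG (dE e) = dV (sD e)) {y : VD}
    (hy : ∀ a, k a ≠ y) : Nat.card {e // sG e = dV y} = Nat.card {e // sD e = y} := by
  rw [h.card_eq hX hD]
  have : IsEmpty {e // mV (sX e) = dV y} := ⟨fun e => by
    obtain ⟨a, -, ha⟩ := h.meetV _ _ e.2
    exact hy a ha⟩
  simp [h.dV_inj.eq_iff]

/-- Dually, no edge of `D` touches a node of `X` outside the interface. For deleted nodes this is
the dangling condition. -/
theorem Gluing.card_removed (h : Gluing i k mV mE dV dE) [Finite EX] [Finite ED]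
    (hX : ∀ e, sG (mE e) = mV (sX e)) (hD : ∀ e, sG (dE e) = dV (sD e)) {v : VX}
    (hv : ∀ a, i a ≠ v) : Nat.card {e // sG e = mV v} = Nat.card {e // sX e = v} := by
  rw [h.card_eq hX hD]
  have : IsEmpty {e // dV (sD e) = mV v} := ⟨fun e => by
    obtain ⟨a, ha, -⟩ := h.meetV _ _ e.2.symm
    exact hv a ha⟩
  simp [h.mV_inj.eq_iff]

theorem Gluing.card_interface (h : Gluing i k mV mE dV dE) [Finite EX] [Finite ED]
    (hX : ∀ e, sG (mE e) = mV (sX e)) (hD : ∀ e, sG (dE e) = dV (sD e)) (a : VK) :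
    Nat.card {e // sG e = mV (i a)} =
      Nat.card {e // sX e = i a} + Nat.card {e // sD e = k a} := by
  rw [h.card_eq hX hD]
  simp only [h.mV_inj.eq_iff]
  simp only [h.comm, h.dV_inj.eq_iff]

end Gluing

/-! ### Degrees in rule graphs as cardinalities -/

section Degrees

variable {p : ℕ} {τ : Fin p → LSort} {V E I : Finset ℕ}

theorem RuleGraph.indeg_eq (M : RuleGraph τ V E I) (v : V) :
    M.indeg v = (Nat.card {e // M.tgt e = v} : ℤ) := by
  rw [RuleGraph.indeg, Nat.card_eq_fintype_card, Fintype.card_subtype]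

theorem RuleGraph.outdeg_eq (M : RuleGraph τ V E I) (v : V) :
    M.outdeg v = (Nat.card {e // M.src e = v} : ℤ) := by
  rw [RuleGraph.outdeg, Nat.card_eq_fintype_card, Fintype.card_subtype]

end Degrees

/-! ### Transformation steps -/

/-- A graph `H` arises from a graph `G` by replacing an occurrence of the right-hand graph of `u`
by the left-hand graph. -/
structure URule.Step (u : URule) (G H : HostGraph) : Type 1 where
  gI : u.I → G.V
  val : Fin u.p → GPList
  val_mem : ∀ x, val x ∈ (u.τ x).dom
  DV : Type
  DE : Type
  finE : Finite DE
  dsrc : DE → DV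
  dtgt : DE → DV
  k : u.VK → DV
  gV : u.VR → G.V
  gE : u.ER → G.E
  dGV : DV → G.V
  dGE : DE → G.E
  hV : u.VL → H.V
  hE : u.EL → H.E
  dHV : DV → H.V
  dHE : DE → H.E
  glueG : Gluing (fun v : u.VK => (⟨v.1, u.KR v.2⟩ : u.VR)) k gV gE dGV dGE
  glueH : Gluing (fun v : u.VK => (⟨v.1, u.KL v.2⟩ : u.VL)) k hV hE dHV dHE
  gsrc : ∀ e, G.src (gE e) = gV (u.R.src e)
  gtgt : ∀ e, G.tgt (gE e) = gV (u.R.tgt e)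
  hsrc : ∀ e, H.src (hE e) = hV (u.L.src e)
  htgt : ∀ e, H.tgt (hE e) = hV (u.L.tgt e)
  dGsrc : ∀ e, G.src (dGE e) = dGV (dsrc e)
  dGtgt : ∀ e, G.tgt (dGE e) = dGV (dtgt e)
  dHsrc : ∀ e, H.src (dHE e) = dHV (dsrc e)
  dHtgt : ∀ e, H.tgt (dHE e) = dHV (dtgt e)
  labV : ∀ y, (∀ a, k a ≠ y) → G.labV (dGV y) = H.labV (dHV y)
  markV : ∀ y, (∀ a, k a ≠ y) → G.markV (dGV y) = H.markV (dHV y)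
  root : ∀ y, (∀ a, k a ≠ y) → G.root (dGV y) = H.root (dHV y)
  labE : ∀ e, G.labE (dGE e) = H.labE (dHE e)
  markE : ∀ e, G.markE (dGE e) = H.markE (dHE e)
  hlabV : ∀ v, H.labV (hV v) = (u.L.labV v).eval G gI val
  hlabE : ∀ e, H.labE (hE e) = (u.L.labE e).eval G gI val
  hroot : ∀ v, H.root (hV v) = u.L.root v
  hmarkV : ∀ v, u.L.markV v = .mk (H.markV (hV v)) ∨ u.L.markV v = .any ∧
    ∃ h : v.1 ∈ u.VK, u.R.markV ⟨v.1, u.KR h⟩ = .any ∧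
      G.markV (gV ⟨v.1, u.KR h⟩) = H.markV (hV v)
  hmarkE : ∀ e, u.L.markE e = .mk (H.markE (hE e)) ∨ u.L.markE e = .any ∧
    ∃ h : e.1 ∈ u.ER, u.R.markE ⟨e.1, h⟩ = .any ∧ G.markE (gE ⟨e.1, h⟩) = H.markE (hE e)
  indegAt : ∀ {n m k : ℕ} (a : Assignment u.sigR G n m k), a.nd = gV → ∀ i,
    (u.indegAt i).eval a = some (G.indeg (gI i))
  outdegAt : ∀ {n m k : ℕ} (a : Assignment u.sigR G n m k), a.nd = gV → ∀ i,
    (u.outdegAt i).eval a = some (G.outdeg (gI i))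

namespace URule.Step

variable {u : URule} {G H : HostGraph} (st : u.Step G H)

theorem indeg_outside (y : st.DV) (hy : ∀ a, st.k a ≠ y) :
    G.indeg (st.dGV y) = H.indeg (st.dHV y) := by
  have := st.finE
  rw [HostGraph.indeg, HostGraph.indeg, st.glueG.card_outside st.gtgt st.dGtgt hy,
    st.glueH.card_outside st.htgt st.dHtgt hy]

theorem outdeg_outside (y : st.DV) (hy : ∀ a, st.k a ≠ y) :
    G.outdeg (st.dGV y) = H.outdeg (st.dHV y) := by
  have := st.finE
  rw [HostGraph.outdeg, HostGraph.outdeg, st.glueG.card_outside st.gsrc st.dGsrc hy,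
    st.glueH.card_outside st.hsrc st.dHsrc hy]

theorem indeg_removed (v : u.VL) (hv : v.1 ∉ u.VK) : H.indeg (st.hV v) = u.L.indeg v := by
  have := st.finE
  rw [HostGraph.indeg, st.glueH.card_removed st.htgt st.dHtgt, RuleGraph.indeg_eq]
  rintro a rfl
  exact hv a.2

theorem outdeg_removed (v : u.VL) (hv : v.1 ∉ u.VK) : H.outdeg (st.hV v) = u.L.outdeg v := by
  have := st.finE
  rw [HostGraph.outdeg, st.glueH.card_removed st.hsrc st.dHsrc, RuleGraph.outdeg_eq]
  rintro a rfl
  exact hv a.2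

/-- The degree at an interface node is the contribution of the rule graph plus that of `D`. The
latter is the same for `G` and `H` and is what `incon` stands for. -/
theorem indeg_interface (a : u.VK) :
    G.indeg (st.gV ⟨a.1, u.KR a.2⟩) - u.R.indeg ⟨a.1, u.KR a.2⟩ + u.L.indeg ⟨a.1, u.KL a.2⟩ =
      H.indeg (st.hV ⟨a.1, u.KL a.2⟩) := by
  have := st.finE
  have h1 := st.glueG.card_interface st.gtgt st.dGtgt a
  have h2 := st.glueH.card_interface st.htgt st.dHtgt a
  simp only [HostGraph.indeg, RuleGraph.indeg_eq]
  omega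

theorem outdeg_interface (a : u.VK) :
    G.outdeg (st.gV ⟨a.1, u.KR a.2⟩) - u.R.outdeg ⟨a.1, u.KR a.2⟩ + u.L.outdeg ⟨a.1, u.KL a.2⟩ =
      H.outdeg (st.hV ⟨a.1, u.KL a.2⟩) := by
  have := st.finE
  have h1 := st.glueG.card_interface st.gsrc st.dGsrc a
  have h2 := st.glueH.card_interface st.hsrc st.dHsrc a
  simp only [HostGraph.outdeg, RuleGraph.outdeg_eq]
  omega

end URule.Step

/-! ### Distribution of Val and Adj -/

section Distribution

variable {u : URule} {G : HostGraph} {n m k : ℕ}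

/-- Val pushes negations inwards by De Morgan, and Adj is applied afterwards. Since valuated
formulas have no interpretation of their own here, the agreement of the two negations is stated
after Adj. -/
theorem URule.sat_adj_neg (f : Form u.sigV n m k) (a : Assignment u.sigR G n m k) :
    (u.adj f.neg).sat a ↔ ¬ (u.adj f).sat a := by
  induction f with
  | and c c' ih ih' => simp [Form.neg, URule.adj, Form.sat, ih, ih']; tauto
  | or c c' ih ih' => simp [Form.neg, URule.adj, Form.sat, ih, ih']
  | not c ih => simp [Form.neg, URule.adj, Form.sat]
  | _ => simp [Form.neg, URule.adj, Form.sat]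

theorem URule.val_bigAnd (l : List (Form u.sigL n m k)) :
    u.val (bigAnd l) = bigAnd (l.map u.val) := by
  induction l with
  | nil => rfl
  | cons c l ih => simp [bigAnd, URule.val, ih]

theorem URule.val_bigOr (l : List (Form u.sigL n m k)) :
    u.val (bigOr l) = bigOr (l.map u.val) := by
  induction l with
  | nil => rfl
  | cons c l ih => simp [bigOr, URule.val, ih]

theorem URule.adj_bigAnd (l : List (Form u.sigV n m k)) :
    u.adj (bigAnd l) = bigAnd (l.map u.adj) := by
  induction l with
  | nil => rfl
  | cons c l ih => simp [bigAnd, URule.adj, ih]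

theorem URule.adj_bigOr (l : List (Form u.sigV n m k)) :
    u.adj (bigOr l) = bigOr (l.map u.adj) := by
  induction l with
  | nil => rfl
  | cons c l ih => simp [bigOr, URule.adj, ih]

theorem sat_ofBool {σ : Sig} (b : Bool) (a : Assignment σ G n m k) :
    (Form.ofBool b : Form σ n m k).sat a ↔ b = true := by
  cases b <;> simp [Form.ofBool, Form.sat]

theorem URule.adj_ofBool (b : Bool) :
    u.adj (Form.ofBool b : Form u.sigV n m k) = Form.ofBool b := by
  cases b <;> rfl

theorem URule.sat_adj_ofEqOp (o : EqOp) (b : Bool) (a : Assignment u.sigR G n m k) :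
    (u.adj (Form.ofEqOp o b)).sat a ↔ o.holds (b = true) := by
  cases o <;> simp [Form.ofEqOp, URule.adj_ofBool, sat_ofBool, EqOp.holds]

end Distribution

namespace URule.Step

variable {u : URule} {G H : HostGraph} (st : u.Step G H)

/-! ### Corresponding assignments -/

/-- Corresponding assignments in the graphs of a step: the constants denote the occurrences of the
rule graphs, and the variables denote corresponding items outside these occurrences. -/
structure Rel {n m k : ℕ} (a : Assignment u.sigR G n m k) (b : Assignment u.sigL H n m k) :
    Prop where
  and : a.nd = st.gV
  aed : a.ed = st.gE
  alb : a.lb = st.val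
  bnd : b.nd = st.hV
  bed : b.ed = st.hE
  blb : b.lb = st.val
  vn : ∀ i, ∃ y, (∀ c, st.k c ≠ y) ∧ st.dGV y = a.vn i ∧ st.dHV y = b.vn i
  ve : ∀ i, ∃ e, st.dGE e = a.ve i ∧ st.dHE e = b.ve i
  vl : a.vl = b.vl

/-- A node term that is either a constant or denotes a node outside the left-hand graph. -/
def Fine {n m k : ℕ} (b : Assignment u.sigL H n m k) (t : NTerm u.sigL n m) : Prop :=
  (∃ v, u.valN t = .const v) ∨ ∀ v, t.eval b ≠ st.hV v

/-- A substitution that preserves constants and whose values on node terms are fine. -/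
structure Resolved {n m k n' m' k' : ℕ} (s : Subst u.sigL u.sigL n m k n' m' k')
    (b : Assignment u.sigL H n' m' k') : Prop where
  fine : ∀ t, st.Fine b (s.nd t)
  nd_const : ∀ v, s.nd (.const v) = .const v
  ed_const : ∀ e, s.ed (.const e) = .const e

variable {st} {n m k n' m' k' : ℕ} {a : Assignment u.sigR G n' m' k'}
  {b : Assignment u.sigL H n' m' k'}

theorem Rel.lvar (hR : st.Rel a b) (x : LVar (Fin u.p) k') :
    x.eval a.lb a.vl = x.eval b.lb b.vl := by
  rw [hR.alb, hR.blb, hR.vl]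

theorem Rel.valE_cases (hR : st.Rel a b) (t : ETerm u.sigL m') :
    (∃ e, t = .const e ∧ t.eval b = st.hE e) ∨
      ∃ i, t = .var i ∧ ∃ d, a.ve i = st.dGE d ∧ t.eval b = st.dHE d := by
  rcases t with e | i
  · exact Or.inl ⟨e, rfl, by simp [ETerm.eval, hR.bed]⟩
  · obtain ⟨d, h1, h2⟩ := hR.ve i
    exact Or.inr ⟨i, rfl, d, h1.symm, h2.symm⟩

/-- Val turns endpoints of edge constants into node constants. What remains is a variable or an
endpoint of an edge variable, which survives Adj and denotes a node of `D`; for an endpoint this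
node may still belong to the interface. -/
theorem Rel.valN_cases (hR : st.Rel a b) (t : NTerm u.sigL n' m') :
    (∃ v, u.valN t = .const v ∧ t.eval b = st.hV v) ∨
      ((∀ v, u.valN t ≠ .const v) ∧ ∃ t' y, u.adjN (u.valN t) = some t' ∧
        t'.eval a = st.dGV y ∧ t.eval b = st.dHV y) := by
  rcases t with v | i | (e | i) | (e | i)
  · exact Or.inl ⟨v, rfl, by simp [NTerm.eval, hR.bnd]⟩
  · obtain ⟨y, -, h1, h2⟩ := hR.vn i
    exact Or.inr ⟨fun v h => by simp [valN] at h, _, y, rfl, h1.symm, h2.symm⟩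
  · exact Or.inl ⟨_, rfl, by simp [NTerm.eval, ETerm.eval, hR.bed, st.hsrc]⟩
  · obtain ⟨d, h1, h2⟩ := hR.ve i
    refine Or.inr ⟨fun v h => by simp [valN] at h, _, st.dsrc d, rfl, ?_, ?_⟩
    · simp [NTerm.eval, ETerm.eval, ← h1, st.dGsrc]
    · simp [NTerm.eval, ETerm.eval, ← h2, st.dHsrc]
  · exact Or.inl ⟨_, rfl, by simp [NTerm.eval, ETerm.eval, hR.bed, st.htgt]⟩
  · obtain ⟨d, h1, h2⟩ := hR.ve i
    refine Or.inr ⟨fun v h => by simp [valN] at h, _, st.dtgt d, rfl, ?_, ?_⟩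
    · simp [NTerm.eval, ETerm.eval, ← h1, st.dGtgt]
    · simp [NTerm.eval, ETerm.eval, ← h2, st.dHtgt]

/-- Fineness excludes the interface from the second case. This is essential for labels, marks, roots
and degrees, which the step may change at interface nodes. -/
theorem Rel.fine_cases (hR : st.Rel a b) {t : NTerm u.sigL n' m'} (ht : st.Fine b t) :
    (∃ v, u.valN t = .const v ∧ t.eval b = st.hV v) ∨
      ((∀ v, u.valN t ≠ .const v) ∧ ∃ t' y, u.adjN (u.valN t) = some t' ∧
        t'.eval a = st.dGV y ∧ t.eval b = st.dHV y ∧ ∀ c, st.k c ≠ y) := by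
  rcases hR.valN_cases t with h | ⟨h, t', y, h1, h2, h3⟩
  · exact Or.inl h
  · refine Or.inr ⟨h, t', y, h1, h2, h3, ?_⟩
    rintro c rfl
    rcases ht with ⟨v, hv⟩ | ht
    · exact h v hv
    · exact ht ⟨c.1, u.KL c.2⟩ (h3.trans (st.glueH.comm c).symm)

/-! ### Terms -/

section Terms

variable {s : Subst u.sigL u.sigL n m k n' m' k'}

/-- There are three cases: at an interface constant the rule contribution is exchanged, at a
constant outside the interface the degree is the one in the rule graph, and at a node of `D` outside
the interface the degrees in `G` and `H` coincide. -/
theorem Rel.indeg_term (hR : st.Rel a b) {t : NTerm u.sigL n' m'} (ht : st.Fine b t) :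
    ∃ t', u.adjI (u.valI (.indeg t : ITerm u.sigL n' m' k')) = some t' ∧
      t'.eval a = some (H.indeg (t.eval b)) := by
  rcases hR.fine_cases ht with ⟨v, h, h'⟩ | ⟨h, t', y, h1, h2, h3, h4⟩
  · by_cases hv : v.1 ∈ u.VK
    · refine ⟨_, by simp only [valI, h, dif_pos hv]; rfl, ?_⟩
      rw [h', ← st.indeg_interface ⟨v.1, hv⟩]
      simp [ITerm.eval, NTerm.eval, adjSym, hR.and]
    · refine ⟨_, by simp only [valI, h, dif_neg hv]; rfl, ?_⟩
      rw [h', st.indeg_removed v hv]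
      rfl
  · refine ⟨.indeg t', ?_, ?_⟩
    · rw [valI]
      split
      · rename_i v hv; exact (h v hv).elim
      · simp [adjI, h1]
    · simp [ITerm.eval, h2, h3, st.indeg_outside y h4]

theorem Rel.outdeg_term (hR : st.Rel a b) {t : NTerm u.sigL n' m'} (ht : st.Fine b t) :
    ∃ t', u.adjI (u.valI (.outdeg t : ITerm u.sigL n' m' k')) = some t' ∧
      t'.eval a = some (H.outdeg (t.eval b)) := by
  rcases hR.fine_cases ht with ⟨v, h, h'⟩ | ⟨h, t', y, h1, h2, h3, h4⟩
  · by_cases hv : v.1 ∈ u.VK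
    · refine ⟨_, by simp only [valI, h, dif_pos hv]; rfl, ?_⟩
      rw [h', ← st.outdeg_interface ⟨v.1, hv⟩]
      simp [ITerm.eval, NTerm.eval, adjSym, hR.and]
    · refine ⟨_, by simp only [valI, h, dif_neg hv]; rfl, ?_⟩
      rw [h', st.outdeg_removed v hv]
      rfl
  · refine ⟨.outdeg t', ?_, ?_⟩
    · rw [valI]
      split
      · rename_i v hv; exact (h v hv).elim
      · simp [adjI, h1]
    · simp [ITerm.eval, h2, h3, st.outdeg_outside y h4]

theorem Rel.iterm (hR : st.Rel a b) (hs : st.Resolved s b) (t : ITerm u.sigL n m k) :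
    ∃ t', u.adjI (u.valI (t.subst s)) = some t' ∧ t'.eval a = (t.subst s).eval b := by
  induction t with
  | num z => exact ⟨_, rfl, rfl⟩
  | var x => exact ⟨_, rfl, by simp [ITerm.subst, ITerm.eval, hR.lvar]⟩
  | indeg t => exact hR.indeg_term (hs.fine t)
  | outdeg t => exact hR.outdeg_term (hs.fine t)
  | lenA x => exact ⟨_, rfl, by simp [ITerm.subst, ITerm.eval, hR.lvar]⟩
  | lenS x => exact ⟨_, rfl, by simp [ITerm.subst, ITerm.eval, hR.lvar]⟩
  | lenL x => exact ⟨_, rfl, by simp [ITerm.subst, ITerm.eval, hR.lvar]⟩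
  | sym c => exact c.elim
  | add c d ihc ihd =>
    obtain ⟨c', hc1, hc2⟩ := ihc
    obtain ⟨d', hd1, hd2⟩ := ihd
    exact ⟨.add c' d', by simp [ITerm.subst, valI, adjI, hc1, hd1], by
      simp [ITerm.subst, ITerm.eval, hc2, hd2]⟩
  | sub c d ihc ihd =>
    obtain ⟨c', hc1, hc2⟩ := ihc
    obtain ⟨d', hd1, hd2⟩ := ihd
    exact ⟨.sub c' d', by simp [ITerm.subst, valI, adjI, hc1, hd1], by
      simp [ITerm.subst, ITerm.eval, hc2, hd2]⟩
  | mul c d ihc ihd =>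
    obtain ⟨c', hc1, hc2⟩ := ihc
    obtain ⟨d', hd1, hd2⟩ := ihd
    exact ⟨.mul c' d', by simp [ITerm.subst, valI, adjI, hc1, hd1], by
      simp [ITerm.subst, ITerm.eval, hc2, hd2]⟩
  | div c d ihc ihd =>
    obtain ⟨c', hc1, hc2⟩ := ihc
    obtain ⟨d', hd1, hd2⟩ := ihd
    exact ⟨.div c' d', by simp [ITerm.subst, valI, adjI, hc1, hd1], by
      simp [ITerm.subst, ITerm.eval, hc2, hd2]⟩

theorem adjI_toTerm (e : IntExp u.τ u.I) :
    u.adjI (e.toTerm id (fun i => .sym (.indegAt i)) (fun i => .sym (.outdegAt i)) :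
      ITerm u.sigV n m k) = some (e.toTerm (σ := u.sigR) id u.indegAt u.outdegAt) := by
  induction e <;> simp_all [IntExp.toTerm, adjI, adjSym]

theorem adjL_valExp (e : LExp u.τ u.I) :
    u.adjL (u.valExp e : LTerm u.sigV n m k) =
      some (e.toTerm (σ := u.sigR) id u.indegAt u.outdegAt) := by
  unfold valExp
  induction e <;> simp_all [LExp.toTerm, adjL, adjI_toTerm]

/-- A label in `H` may mention degrees, but degree operators inside rule expressions refer to the
graph `G` of the match. Val protects them by auxiliary symbols, so that they are not confused with
the degrees in `H` occurring in the formula. -/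
theorem Rel.eval_exp (hR : st.Rel a b) (e : LExp u.τ u.I) :
    (e.toTerm (σ := u.sigR) id u.indegAt u.outdegAt).eval a = some (e.eval G st.gI st.val) :=
  LExp.eval_toTerm st.val_mem (fun x => by rw [hR.alb]; rfl) (st.indegAt a hR.and)
    (st.outdegAt a hR.and) e

theorem Rel.sterm (hR : st.Rel a b) (t : STerm (Fin u.p) k') :
    t.eval a.lb a.vl = t.eval b.lb b.vl := by rw [hR.alb, hR.blb, hR.vl]

theorem Rel.lterm (hR : st.Rel a b) (hs : st.Resolved s b) (t : LTerm u.sigL n m k) :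
    ∃ t', u.adjL (u.valL (t.subst s)) = some t' ∧ t'.eval a = (t.subst s).eval b := by
  induction t with
  | empty => exact ⟨_, rfl, rfl⟩
  | int t =>
    obtain ⟨t', h1, h2⟩ := hR.iterm hs t
    exact ⟨.int t', by simp [LTerm.subst, valL, adjL, h1], by simp [LTerm.subst, LTerm.eval, h2]⟩
  | str t => exact ⟨_, rfl, by simp only [LTerm.subst, LTerm.eval, hR.sterm]⟩
  | atomVar x => exact ⟨_, rfl, by simp [LTerm.subst, LTerm.eval, hR.lvar]⟩
  | listVar x => exact ⟨_, rfl, by simp [LTerm.subst, LTerm.eval, hR.lvar]⟩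
  | app c d ihc ihd =>
    obtain ⟨c', hc1, hc2⟩ := ihc
    obtain ⟨d', hd1, hd2⟩ := ihd
    exact ⟨.app c' d', by simp [LTerm.subst, valL, adjL, hc1, hd1], by
      simp [LTerm.subst, LTerm.eval, hc2, hd2]⟩
  | labV t =>
    rcases hR.fine_cases (hs.fine t) with ⟨v, h, h'⟩ | ⟨h, t', y, h1, h2, h3, h4⟩
    · refine ⟨_, by simp only [LTerm.subst, valL, h]; exact adjL_valExp _, ?_⟩
      rw [hR.eval_exp, LTerm.subst, LTerm.eval, h', st.hlabV]
    · refine ⟨.labV t', ?_, ?_⟩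
      · rw [LTerm.subst, valL]
        split
        · rename_i v hv; exact (h v hv).elim
        · simp [adjL, h1]
      · simp [LTerm.subst, LTerm.eval, h2, h3, st.labV y h4]
  | labE t =>
    rcases hR.valE_cases (s.ed t) with ⟨e, h, h'⟩ | ⟨i, h, d, h1, h2⟩
    · refine ⟨_, by simp only [LTerm.subst, valL, h]; exact adjL_valExp _, ?_⟩
      rw [hR.eval_exp, LTerm.subst, LTerm.eval, h', st.hlabE]
    · refine ⟨_, by simp only [LTerm.subst, valL, h]; rfl, ?_⟩
      rw [LTerm.subst, LTerm.eval, LTerm.eval, h2, ← st.labE, ← h1]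
      rfl

theorem Rel.vmterm (hR : st.Rel a b) (hs : st.Resolved s b) (t : VMTerm u.sigL n m) :
    ∃ t', u.adjVM (u.valVM (t.subst s)) = some t' ∧ t'.eval a = (t.subst s).eval b := by
  rcases t with q | t
  · exact ⟨_, rfl, rfl⟩
  · rcases hR.fine_cases (hs.fine t) with ⟨v, h, h'⟩ | ⟨h, t', y, h1, h2, h3, h4⟩
    · simp only [VMTerm.subst, valVM, h]
      split
      · rename_i hv
        obtain ⟨hk, hv, hv'⟩ := hv
        refine ⟨.mark (.const ⟨v.1, u.KR hk⟩), by simp [adjVM, adjN, hk], ?_⟩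
        -- The mark is `any` in both rule graphs, so the first alternative is contradictory and the
        -- second says that the mark in `G` equals that in `H`.
        rcases st.hmarkV v with h | ⟨-, hk', -, h⟩
        · rw [hv] at h; cases h
        · rw [VMTerm.eval, VMTerm.eval, h', ← h, NTerm.eval, hR.and]
      · rename_i hv
        refine ⟨_, rfl, ?_⟩
        rcases st.hmarkV v with h | ⟨h1, hk', h2, -⟩
        · simp [VMTerm.eval, h', h]
        · exact (hv ⟨hk', h1, h2⟩).elim
    · refine ⟨.mark t', ?_, ?_⟩
      · rw [VMTerm.subst, valVM]
        split
        · rename_i v hv; exact (h v hv).elim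
        · simp [adjVM, h1]
      · simp [VMTerm.subst, VMTerm.eval, h2, h3, st.markV y h4]

theorem Rel.emterm (hR : st.Rel a b) (t : EMTerm u.sigL m) :
    ∃ t', u.adjEM (u.valEM (t.subst s)) = some t' ∧ t'.eval a = (t.subst s).eval b := by
  rcases t with q | t
  · exact ⟨_, rfl, rfl⟩
  · rcases hR.valE_cases (s.ed t) with ⟨v, h, h'⟩ | ⟨i, h, d, h1, h2⟩
    · simp only [EMTerm.subst, valEM, h]
      rw [h] at h'
      split
      · rename_i hv
        obtain ⟨hk, hv, hv'⟩ := hv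
        refine ⟨.mark (.const ⟨v.1, hk⟩), by simp [adjEM, hk], ?_⟩
        rcases st.hmarkE v with h | ⟨-, hk', -, h⟩
        · rw [hv] at h; cases h
        · rw [EMTerm.eval, EMTerm.eval, h', ← h, ETerm.eval, hR.aed]
      · rename_i hv
        refine ⟨_, rfl, ?_⟩
        rcases st.hmarkE v with h | ⟨h1, hk', h2, -⟩
        · rw [EMTerm.eval, EMTerm.eval, h', h]
        · exact (hv ⟨hk', h1, h2⟩).elim
    · refine ⟨_, by simp only [EMTerm.subst, valEM, h]; rfl, ?_⟩
      rw [EMTerm.subst, EMTerm.eval, EMTerm.eval, h2, ← st.markE, ← h1]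
      rfl

/-! ### Atomic formulas -/

/-- Equality of nodes, unlike labels or degrees, can be decided inside `D`, so no fineness is
needed. This is what allows the guards of Split to be transferred before the terms are resolved. -/
theorem Rel.nodeRel (hR : st.Rel a b) (o : EqOp) (t t' : NTerm u.sigL n' m') :
    (u.adj (u.valAtomic (.nodeRel o t t' : Atomic u.sigL n' m' k'))).sat a ↔
      o.holds (t.eval b = t'.eval b) := by
  -- A constant is compared with a node of `D`. An interface constant is itself a node of `D`, and
  -- both maps out of `D` are injective; a constant outside the interface is never equal to such a
  -- node, which is why Adj may replace the equation by false.
  have key : ∀ (v : u.VL) (q : NTerm u.sigR n' m') y z, q.eval a = st.dGV y → z = st.dHV y →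
      (∃ hv : v.1 ∈ u.VK, (a.nd ⟨v.1, u.KR hv⟩ = q.eval a ↔ st.hV v = z)) ∨
        (v.1 ∉ u.VK ∧ st.hV v ≠ z) := by
    rintro v q y z hq rfl
    by_cases hv : v.1 ∈ u.VK
    · refine Or.inl ⟨hv, ?_⟩
      rw [hq, hR.and]
      have h1 := st.glueG.comm ⟨v.1, hv⟩
      have h2 := st.glueH.comm ⟨v.1, hv⟩
      simp only [Subtype.coe_eta] at h1 h2
      rw [h1, h2, st.glueG.dV_inj.eq_iff, st.glueH.dV_inj.eq_iff]
    · refine Or.inr ⟨hv, fun h => ?_⟩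
      obtain ⟨c, rfl, -⟩ := st.glueH.meetV _ _ h
      exact hv c.2
  rcases hR.valN_cases t with ⟨v, h, h'⟩ | ⟨h, q, y, h1, h2, h3⟩ <;>
    rcases hR.valN_cases t' with ⟨v', g, g'⟩ | ⟨g, q', y', g1, g2, g3⟩
  · simp only [valAtomic, h, g, sat_adj_ofEqOp, h', g', st.glueH.mV_inj.eq_iff,
      decide_eq_true_eq]
  · have : u.valAtomic (.nodeRel o t t' : Atomic u.sigL n' m' k') =
        .atom (.nodeRel o (.const v) (u.valN t')) := by
      rw [valAtomic, h]
      split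
      · rename_i v' _ hv; exact (g v' hv).elim
      · rfl
    rw [this, adj, adjAtomic, g1, h']
    rcases key v q' y' _ g2 g3 with ⟨hv, hk⟩ | ⟨hv, hk⟩
    · simp only [adjN, dif_pos hv, adjRel, Form.sat, Atomic.sat, ← hk]
      rfl
    · cases o <;> simp [adjN, hv, adjRel, Form.sat, hk, EqOp.holds]
  · have : u.valAtomic (.nodeRel o t t' : Atomic u.sigL n' m' k') =
        .atom (.nodeRel o (u.valN t) (.const v')) := by
      rw [valAtomic, g]
      split
      · rename_i v' _ hv _; exact (h _ hv).elim
      · rfl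
    rw [this, adj, adjAtomic, h1, g']
    rcases key v' q y _ h2 h3 with ⟨hv, hk⟩ | ⟨hv, hk⟩
    · simp only [adjN, dif_pos hv, adjRel, Form.sat, Atomic.sat, eq_comm (b := st.hV v'), ← hk]
      rw [eq_comm]
      rfl
    · cases o <;> simp [adjN, hv, adjRel, Form.sat, Ne.symm hk, EqOp.holds]
  · have : u.valAtomic (.nodeRel o t t' : Atomic u.sigL n' m' k') =
        .atom (.nodeRel o (u.valN t) (u.valN t')) := by
      rw [valAtomic]
      split
      · rename_i v' _ hv _; exact (h _ hv).elim
      · rfl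
    rw [this, adj, adjAtomic, h1, g1]
    simp [adjRel, Form.sat, Atomic.sat, h2, h3, g2, g3, st.glueG.dV_inj.eq_iff,
      st.glueH.dV_inj.eq_iff]

/-- The interface has no edges, so an edge constant is never equal to an edge of `D`. This matches
the treatment of edge equations by Adj. -/
theorem Rel.edgeRel (hR : st.Rel a b) (o : EqOp) (t t' : ETerm u.sigL m') :
    (u.adj (u.valAtomic (.edgeRel o t t' : Atomic u.sigL n' m' k'))).sat a ↔
      o.holds (t.eval b = t'.eval b) := by
  rcases hR.valE_cases t with ⟨v, rfl, h'⟩ | ⟨i, rfl, d, h1, h2⟩ <;>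
    rcases hR.valE_cases t' with ⟨v', rfl, g'⟩ | ⟨i', rfl, d', g1, g2⟩
  · simp only [valAtomic, valE, sat_adj_ofEqOp, h', g', st.glueH.mE_inj.eq_iff,
      decide_eq_true_eq]
  · rw [h', g2]
    have := st.glueH.meetE v d'
    cases o <;> simp [valAtomic, valE, adj, adjAtomic, adjE, adjRel, Form.sat, EqOp.holds,
      this]
  · rw [g', h2]
    have := (st.glueH.meetE v' d).symm
    cases o <;> simp [valAtomic, valE, adj, adjAtomic, adjE, adjRel, Form.sat, EqOp.holds,
      this]
  · rw [h2, g2]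
    simp [valAtomic, valE, adj, adjAtomic, adjE, adjRel, Form.sat, Atomic.sat, ETerm.eval,
      h1, g1, st.glueH.dE_inj.eq_iff, st.glueG.dE_inj.eq_iff]

theorem Rel.atomic (hR : st.Rel a b) (hs : st.Resolved s b) (c : Atomic u.sigL n m k) :
    (u.adj (u.val (.atom (c.subst s)))).sat a ↔ (c.subst s).sat b := by
  rcases c with ⟨q, x⟩ | t | ⟨o, c, d⟩ | ⟨o, c, d⟩ | ⟨o, c, d⟩ | ⟨o, c, d⟩ | ⟨o, c, d⟩ | ⟨o, c, d⟩
  · simp [Atomic.subst, URule.val, valAtomic, adj, adjAtomic, Form.sat, Atomic.sat, hR.lvar]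
  · rcases hR.fine_cases (hs.fine t) with ⟨v, h, h'⟩ | ⟨h, t', y, h1, h2, h3, h4⟩
    · simp only [Atomic.subst, URule.val, valAtomic, h, adj_ofBool, sat_ofBool, Atomic.sat, h',
        st.hroot]
    · have : u.valAtomic (.root (s.nd t) : Atomic u.sigL n' m' k') =
          .atom (.root (u.valN (s.nd t))) := by
        rw [valAtomic]
        split
        · rename_i v hv; exact (h v hv).elim
        · rfl
      simp [Atomic.subst, URule.val, this, adj, adjAtomic, h1, Form.sat, Atomic.sat, h2, h3,
        st.root y h4]
  · obtain ⟨c', hc1, hc2⟩ := hR.iterm hs c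
    obtain ⟨d', hd1, hd2⟩ := hR.iterm hs d
    simp [Atomic.subst, URule.val, valAtomic, adj, adjAtomic, hc1, hd1, Form.sat, Atomic.sat, hc2, hd2]
  · exact hR.nodeRel o _ _
  · exact hR.edgeRel o _ _
  · obtain ⟨c', hc1, hc2⟩ := hR.lterm hs c
    obtain ⟨d', hd1, hd2⟩ := hR.lterm hs d
    simp [Atomic.subst, URule.val, valAtomic, adj, adjAtomic, hc1, hd1, adjRel, Form.sat, Atomic.sat,
      hc2, hd2]
  · obtain ⟨c', hc1, hc2⟩ := hR.vmterm hs c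
    obtain ⟨d', hd1, hd2⟩ := hR.vmterm hs d
    rw [Atomic.subst, URule.val, valAtomic, Atomic.sat, ← hc2, ← hd2]
    split
    · rename_i x y hx hy
      rw [hx, adjVM, Option.some.injEq] at hc1
      rw [hy, adjVM, Option.some.injEq] at hd1
      subst hc1 hd1
      rw [sat_adj_ofEqOp]; rfl
    · simp [adj, adjAtomic, hc1, hd1, adjRel, Form.sat, Atomic.sat]
  · obtain ⟨c', hc1, hc2⟩ := hR.emterm (s := s) c
    obtain ⟨d', hd1, hd2⟩ := hR.emterm (s := s) d
    rw [Atomic.subst, URule.val, valAtomic, Atomic.sat, ← hc2, ← hd2]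
    split
    · rename_i x y hx hy
      rw [hx, adjEM, Option.some.injEq] at hc1
      rw [hy, adjEM, Option.some.injEq] at hd1
      subst hc1 hd1
      rw [sat_adj_ofEqOp]; rfl
    · simp [adj, adjAtomic, hc1, hd1, adjRel, Form.sat, Atomic.sat]

end Terms

end URule.Step

end GP2

namespace GP2
namespace URule.Step

variable {u : URule} {G H : HostGraph} {st : u.Step G H} {n m k n' m' k' n'' m'' k'' : ℕ}

/-! ### Extension of corresponding assignments -/

section Extension

variable {a : Assignment u.sigR G n m k} {b : Assignment u.sigL H n m k}

theorem Rel.pushV (hR : st.Rel a b) (y : st.DV) (hy : ∀ c, st.k c ≠ y) :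
    st.Rel (a.pushV (st.dGV y)) (b.pushV (st.dHV y)) where
  and := hR.and
  aed := hR.aed
  alb := hR.alb
  bnd := hR.bnd
  bed := hR.bed
  blb := hR.blb
  vn i := Fin.cases ⟨y, hy, rfl, rfl⟩ hR.vn i
  ve := hR.ve
  vl := hR.vl

theorem Rel.pushE (hR : st.Rel a b) (e : st.DE) :
    st.Rel (a.pushE (st.dGE e)) (b.pushE (st.dHE e)) where
  and := hR.and
  aed := hR.aed
  alb := hR.alb
  bnd := hR.bnd
  bed := hR.bed
  blb := hR.blb
  vn := hR.vn
  ve i := Fin.cases ⟨e, rfl, rfl⟩ hR.ve i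
  vl := hR.vl

theorem Rel.pushL (hR : st.Rel a b) (l : GPList) : st.Rel (a.pushL l) (b.pushL l) where
  and := hR.and
  aed := hR.aed
  alb := hR.alb
  bnd := hR.bnd
  bed := hR.bed
  blb := hR.blb
  vn := hR.vn
  ve := hR.ve
  vl := by simp [Assignment.pushL, hR.vl]

theorem valN_wkV {t : NTerm u.sigL n m} {v} (h : u.valN t = .const v) :
    u.valN t.wkV = .const v := by
  rcases t with _ | _ | (_ | _) | (_ | _) <;> simp_all [valN, NTerm.wkV]

theorem valN_wkE {t : NTerm u.sigL n m} {v} (h : u.valN t = .const v) :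
    u.valN t.wkE = .const v := by
  rcases t with _ | _ | (_ | _) | (_ | _) <;> simp_all [valN, NTerm.wkE, ETerm.wk]

theorem Fine.wkV {t : NTerm u.sigL n m} (h : st.Fine b t) (x : H.V) :
    st.Fine (b.pushV x) t.wkV := by
  rcases h with ⟨v, h⟩ | h
  · exact Or.inl ⟨v, valN_wkV h⟩
  · exact Or.inr (by simpa only [NTerm.eval_wkV] using h)

theorem Fine.wkE {t : NTerm u.sigL n m} (h : st.Fine b t) (x : H.E) :
    st.Fine (b.pushE x) t.wkE := by
  rcases h with ⟨v, h⟩ | h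
  · exact Or.inl ⟨v, valN_wkE h⟩
  · exact Or.inr (by simpa only [NTerm.eval_wkE] using h)

theorem Fine.pushL {t : NTerm u.sigL n m} (h : st.Fine b t) (x : GPList) :
    st.Fine (b.pushL x) t := by
  simpa only [Fine, NTerm.eval_pushL] using h

theorem dHV_ne_hV {y : st.DV} (hy : ∀ c, st.k c ≠ y) (v : u.VL) : st.dHV y ≠ st.hV v := by
  intro h
  obtain ⟨c, -, hc⟩ := st.glueH.meetV _ _ h.symm
  exact hy c hc

end Extension

/-! ### Resolved substitutions under quantifiers -/

section Resolved

variable {s : Subst u.sigL u.sigL n m k n' m' k'} {b : Assignment u.sigL H n' m' k'}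

/-- The new variable is not a constant, so it is fine only if its value avoids the occurrence of the
left-hand graph. The guard of the split quantifier provides this. -/
theorem Resolved.upV (hs : st.Resolved s b) {x : H.V} (hx : ∀ v, x ≠ st.hV v) :
    st.Resolved s.upV (b.pushV x) where
  fine t := by
    rcases t with v | i | e | e
    · exact (hs.fine _).wkV x
    · refine Fin.cases ?_ (fun j => (hs.fine _).wkV x) i
      exact Or.inr hx
    · exact (hs.fine _).wkV x
    · exact (hs.fine _).wkV x
  nd_const v := by
    change (s.nd (.const v)).wkV = _
    rw [hs.nd_const]; rfl
  ed_const := hs.ed_const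

theorem Resolved.upL (hs : st.Resolved s b) (x : GPList) :
    st.Resolved s.upL (b.pushL x) where
  fine t := (hs.fine t).pushL x
  nd_const := hs.nd_const
  ed_const := hs.ed_const

theorem Resolved.upE_nd_const (hs : st.Resolved s b) (v : u.VL) :
    s.upE.nd (.const v) = .const v := by
  change (s.nd (.const v)).wkE = _
  rw [hs.nd_const]; rfl

theorem Resolved.upE_ed_const (hs : st.Resolved s b) (e : u.EL) :
    s.upE.ed (.const e) = .const e := by
  change (s.ed (.const e)).wk = _
  rw [hs.ed_const]; rfl

theorem fine_const (b : Assignment u.sigL H n m k) (v : u.VL) : st.Fine b (.const v) :=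
  Or.inl ⟨v, rfl⟩

/-- Every value of the outer substitution `s` on node terms is already fine, so precomposing with an
instantiation requires nothing new. -/
theorem Resolved.instV {s : Subst u.sigL u.sigL n m k n' m' k'}
    (hs : st.Resolved s b) (v : u.VL) : st.Resolved ((Subst.instV v).comp s) b where
  fine _ := hs.fine _
  nd_const := hs.nd_const
  ed_const := hs.ed_const

theorem Resolved.instE {s : Subst u.sigL u.sigL n m k n' m' k'}
    (hs : st.Resolved s b) (e : u.EL) : st.Resolved ((Subst.instE e).comp s) b where
  fine _ := hs.fine _
  nd_const := hs.nd_const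
  ed_const := hs.ed_const

/-- Fineness of the substituted node terms under an edge quantifier. -/
theorem Resolved.upE_fine (hs : st.Resolved s b) (x : H.E) (t : NTerm u.sigL n (m + 1))
    (hsrc : t ≠ .src (.var 0)) (htgt : t ≠ .tgt (.var 0)) :
    st.Fine (b.pushE x) (s.upE.nd t) := by
  rcases t with v | i | (e | i) | (e | i)
  · exact (hs.fine _).wkE x
  · exact (hs.fine _).wkE x
  · exact (hs.fine _).wkE x
  · induction i using Fin.cases with
    | zero => exact (hsrc rfl).elim
    | succ j => exact (hs.fine _).wkE x
  · exact (hs.fine _).wkE x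
  · induction i using Fin.cases with
    | zero => exact (htgt rfl).elim
    | succ j => exact (hs.fine _).wkE x

/-- A substitution for the innermost edge variable's source and target that resolves them. -/
theorem Resolved.upE_comp (hs : st.Resolved s b) (x : H.E)
    {q : Subst u.sigL u.sigL n (m + 1) k n (m + 1) k}
    (hq : ∀ t, t ≠ .src (.var 0) → t ≠ .tgt (.var 0) → q.nd t = t)
    (hed : ∀ e, q.ed e = e)
    (hsrc : (∃ v, q.nd (.src (.var 0)) = .const v) ∨
      q.nd (.src (.var 0)) = .src (.var 0) ∧ ∀ v, H.src x ≠ st.hV v)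
    (htgt : (∃ v, q.nd (.tgt (.var 0)) = .const v) ∨
      q.nd (.tgt (.var 0)) = .tgt (.var 0) ∧ ∀ v, H.tgt x ≠ st.hV v) :
    st.Resolved (q.comp s.upE) (b.pushE x) where
  fine t := by
    change st.Fine _ (s.upE.nd (q.nd t))
    by_cases h1 : t = .src (.var 0)
    · subst h1
      rcases hsrc with ⟨v, h⟩ | ⟨h, h'⟩
      · rw [h, hs.upE_nd_const]; exact fine_const _ _
      · rw [h]; exact Or.inr h'
    · by_cases h2 : t = .tgt (.var 0)
      · subst h2
        rcases htgt with ⟨v, h⟩ | ⟨h, h'⟩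
        · rw [h, hs.upE_nd_const]; exact fine_const _ _
        · rw [h]; exact Or.inr h'
      · rw [hq t h1 h2]
        exact hs.upE_fine x t h1 h2
  nd_const v := by
    change s.upE.nd (q.nd (.const v)) = _
    rw [hq _ (by simp) (by simp), hs.upE_nd_const]
  ed_const e := by
    change s.upE.ed (q.ed (.const e)) = _
    rw [hed, hs.upE_ed_const]

end Resolved

/-! ### Formulas whose truth value is preserved -/

variable (st) in
/-- A formula `f` over the left-hand graph is good if valuation and adjustment preserve the truth
of its resolved instances. -/
def Good (f : Form u.sigL n m k) : Prop :=
  ∀ {n' m' k' : ℕ} (s : Subst u.sigL u.sigL n m k n' m' k') (a : Assignment u.sigR G n' m' k')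
    (b : Assignment u.sigL H n' m' k'), st.Rel a b → st.Resolved s b →
      ((u.adj (u.val (f.subst s))).sat a ↔ (f.subst s).sat b)

theorem good_atom (c : Atomic u.sigL n m k) : st.Good (.atom c) :=
  fun _ _ _ hR hs => hR.atomic hs c

theorem Good.and {f g : Form u.sigL n m k} (hf : st.Good f) (hg : st.Good g) :
    st.Good (.and f g) :=
  fun s a b hR hs => and_congr (hf s a b hR hs) (hg s a b hR hs)

theorem Good.or {f g : Form u.sigL n m k} (hf : st.Good f) (hg : st.Good g) :
    st.Good (.or f g) :=
  fun s a b hR hs => or_congr (hf s a b hR hs) (hg s a b hR hs)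

theorem Good.not {f : Form u.sigL n m k} (hf : st.Good f) : st.Good (.not f) :=
  fun s a b hR hs => (URule.sat_adj_neg _ _).trans (not_congr (hf s a b hR hs))

theorem Good.bigAnd {l : List (Form u.sigL n m k)} (hl : ∀ f ∈ l, st.Good f) :
    st.Good (bigAnd l) := by
  induction l with
  | nil => exact fun s a b hR hs => Iff.rfl
  | cons f l ih =>
    exact Good.and (hl f (by simp)) (ih fun g hg => hl g (by simp [hg]))

theorem Good.bigOr {l : List (Form u.sigL n m k)} (hl : ∀ f ∈ l, st.Good f) :
    st.Good (bigOr l) := by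
  induction l with
  | nil => exact fun s a b hR hs => Iff.rfl
  | cons f l ih =>
    exact Good.or (hl f (by simp)) (ih fun g hg => hl g (by simp [hg]))

/-- This is the reason for quantifying over substitutions in `Good`: the instance by a constant is
absorbed into the substitution. -/
theorem Good.instV {f : Form u.sigL (n + 1) m k} (hf : st.Good f) (v : u.VL) :
    st.Good (f.subst (.instV v)) := by
  intro n' m' k' s a b hR hs
  rw [Form.subst_subst]
  exact hf _ a b hR (hs.instV v)

theorem Good.instE {f : Form u.sigL n (m + 1) k} (hf : st.Good f) (v : u.EL) :
    st.Good (f.subst (.instE v)) := by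
  intro n' m' k' s a b hR hs
  rw [Form.subst_subst]
  exact hf _ a b hR (hs.instE v)

theorem Good.exL {f : Form u.sigL n m (k + 1)} (hf : st.Good f) : st.Good (.exL f) :=
  fun _ _ _ hR hs => exists_congr fun l => hf _ _ _ (hR.pushL l) (hs.upL l)

theorem sat_adj_val_bigAnd (l : List (Form u.sigL n m k)) (a : Assignment u.sigR G n m k) :
    (u.adj (u.val (bigAnd l))).sat a ↔ ∀ f ∈ l, (u.adj (u.val f)).sat a := by
  rw [val_bigAnd, adj_bigAnd, sat_bigAnd]
  simp

theorem sat_adj_val_bigOr (l : List (Form u.sigL n m k)) (a : Assignment u.sigR G n m k) :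
    (u.adj (u.val (bigOr l))).sat a ↔ ∃ f ∈ l, (u.adj (u.val f)).sat a := by
  rw [val_bigOr, adj_bigOr, sat_bigOr]
  simp

/-- After Split and Adj the quantifier ranges in both graphs exactly over the nodes of `D` outside
the interface, so witnesses correspond through `D`. -/
theorem Good.exV {f : Form u.sigL (n + 1) m k} (hf : st.Good f) :
    st.Good (.exV (.and (GP2.bigAnd ((enum u.VL).map
      (fun v => .atom (.nodeRel .ne (.var 0) (.const v))))) f)) := by
  intro n' m' k' s a b hR hs
  have hc : ∀ v, s.upV.nd (.const v) = .const v := fun v => by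
    change (s.nd (.const v)).wkV = _
    rw [hs.nd_const]; rfl
  have h0 : s.upV.nd (.var 0) = .var 0 := rfl
  simp only [Form.subst, subst_bigAnd, URule.val, URule.adj, Form.sat, sat_adj_val_bigAnd,
    sat_bigAnd, List.mem_map, List.mem_filter, mem_enum, true_and, exists_exists_eq_and,
    forall_exists_index, forall_apply_eq_imp_iff, and_imp, decide_eq_true_eq,
    Atomic.subst, hc, h0]
  constructor
  · rintro ⟨x, h1, h2, h3⟩
    -- Two guards combine: the inequations of Split survive Adj for interface nodes, and the
    -- relativisation by Adj excludes the nodes of the right-hand graph outside the interface.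
    have hx : ∀ v, x ≠ st.gV v := by
      intro v
      by_cases hv : v.1 ∈ u.VK
      · have := h2 ⟨v.1, u.KL hv⟩
        simpa [URule.val, valAtomic, valN, URule.adj, adjAtomic, adjN, hv, adjRel, Form.sat,
          Atomic.sat, EqOp.holds, NTerm.eval, Assignment.pushV, hR.and] using this
      · have := h1 _ v hv rfl
        simpa [Form.sat, Atomic.sat, EqOp.holds, NTerm.eval, Assignment.pushV, hR.and] using this
    rcases st.glueG.coverV x with ⟨v, hv⟩ | ⟨y, rfl⟩
    · exact (hx v hv.symm).elim
    have hy : ∀ c, st.k c ≠ y := by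
      rintro c rfl
      exact hx _ (st.glueG.comm c).symm
    refine ⟨st.dHV y, fun v => ?_, (hf _ _ _ (hR.pushV y hy) (hs.upV (dHV_ne_hV hy))).1 h3⟩
    simpa [Atomic.sat, EqOp.holds, NTerm.eval, Assignment.pushV, hR.bnd] using dHV_ne_hV hy v
  · rintro ⟨x, h1, h2⟩
    have hx : ∀ v, x ≠ st.hV v := by
      intro v
      simpa [Atomic.sat, EqOp.holds, NTerm.eval, Assignment.pushV, hR.bnd] using h1 v
    rcases st.glueH.coverV x with ⟨v, hv⟩ | ⟨y, rfl⟩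
    · exact (hx v hv.symm).elim
    have hy : ∀ c, st.k c ≠ y := by
      rintro c rfl
      exact hx _ (st.glueH.comm c).symm
    have hy' : ∀ v, st.dGV y ≠ st.gV v := by
      intro v h
      obtain ⟨c, -, hc⟩ := st.glueG.meetV _ _ h.symm
      exact hy c hc
    refine ⟨st.dGV y, ?_, fun v => ?_, (hf _ _ _ (hR.pushV y hy) (hs.upV hx)).2 h2⟩
    · rintro _ v - rfl
      simpa [Form.sat, Atomic.sat, EqOp.holds, NTerm.eval, Assignment.pushV, hR.and] using hy' v
    · rw [(hR.pushV y hy).nodeRel]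
      simpa [Atomic.sat, EqOp.holds, NTerm.eval, Assignment.pushV, hR.bnd] using hx v

/-- Adjustment preserves the truth of the disjunction over the sources and targets of an edge. -/
theorem Good.inc {f : Form u.sigL n (m + 1) k} (hf : st.Good f)
    {s : Subst u.sigL u.sigL n m k n' m' k'} {a : Assignment u.sigR G n' m' k'}
    {b : Assignment u.sigL H n' m' k'} (hR : st.Rel a b) (hs : st.Resolved s b) (e : st.DE) :
    (u.adj (u.val ((u.inc f).subst s.upE))).sat (a.pushE (st.dGE e)) ↔
      ((u.inc f).subst s.upE).sat (b.pushE (st.dHE e)) := by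
  have hR' := hR.pushE e
  have hsrc : s.upE.nd (.src (.var 0)) = .src (.var 0) := rfl
  have htgt : s.upE.nd (.tgt (.var 0)) = .tgt (.var 0) := rfl
  simp only [URule.inc, Form.subst, subst_bigOr, subst_bigAnd, URule.val, URule.adj, Form.sat,
    sat_adj_val_bigAnd, sat_adj_val_bigOr, sat_bigAnd, sat_bigOr, List.mem_map, mem_enum,
    true_and, exists_exists_eq_and, forall_exists_index, forall_apply_eq_imp_iff, Atomic.subst,
    hR'.nodeRel, Atomic.sat, hsrc, htgt, hs.upE_nd_const, NTerm.eval, ETerm.eval, EqOp.holds,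
    Form.subst_subst]
  have hve : (b.pushE (st.dHE e)).ve 0 = st.dHE e := rfl
  have hnd : ∀ v, (b.pushE (st.dHE e)).nd v = st.hV v := fun v => by rw [hR'.bnd]
  simp only [hve, hnd]
  have q1 : ∀ v : u.VL, ∀ t : NTerm u.sigL n (m + 1), t ≠ .src (.var 0) →
      (Subst.replSrc (k := k) v).nd t = t := by
    rintro v (_ | _ | (_ | i) | _) ht <;> try rfl
    induction i using Fin.cases with
    | zero => exact (ht rfl).elim
    | succ j => rfl
  have q2 : ∀ v : u.VL, ∀ t : NTerm u.sigL n (m + 1), t ≠ .tgt (.var 0) →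
      (Subst.replTgt (k := k) v).nd t = t := by
    rintro v (_ | _ | _ | (_ | i)) ht <;> try rfl
    induction i using Fin.cases with
    | zero => exact (ht rfl).elim
    | succ j => rfl
  -- The guards have already been transferred by `Rel.nodeRel`. In each of the four cases the
  -- replacements, together with the guards that no node of the rule graph is met, make the
  -- substitution resolved, which weakening `s` alone does not ensure because an edge of `D` may end
  -- at an interface node.
  refine or_congr (exists_congr fun v => or_congr (exists_congr fun w => ?_)
    (or_congr ?_ ?_)) ?_
  · refine and_congr_right fun h1 => and_congr_right fun h2 => hf _ _ _ hR' ?_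
    exact hs.upE_comp (st.dHE e) (fun t h1 h2 => (congrArg _ (q1 v t h1)).trans (q2 w t h2))
      (fun _ => rfl) (Or.inl ⟨v, rfl⟩) (Or.inl ⟨w, rfl⟩)
  · refine and_congr_right fun h1 => and_congr_right fun h2 => hf _ _ _ hR' ?_
    exact hs.upE_comp (st.dHE e) (fun t h1 _ => q1 v t h1) (fun _ => rfl) (Or.inl ⟨v, rfl⟩)
      (Or.inr ⟨rfl, h2⟩)
  · refine and_congr_right fun h1 => and_congr_right fun h2 => hf _ _ _ hR' ?_
    exact hs.upE_comp (st.dHE e) (fun t _ h2 => q2 v t h2) (fun _ => rfl) (Or.inr ⟨rfl, h1⟩)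
      (Or.inl ⟨v, rfl⟩)
  · refine and_congr_right fun h1 => and_congr_right fun h2 => hf _ _ _ hR' ?_
    exact hs.upE_comp (st.dHE e) (q := Subst.refl) (fun _ _ _ => rfl) (fun _ => rfl)
      (Or.inr ⟨rfl, h1⟩) (Or.inr ⟨rfl, h2⟩)

theorem Good.exE {f : Form u.sigL n (m + 1) k} (hf : st.Good f) :
    st.Good (.exE (.and (GP2.bigAnd ((enum u.EL).map
      (fun e => .atom (.edgeRel .ne (.var 0) (.const e))))) (u.inc f))) := by
  intro n' m' k' s a b hR hs
  have h0 : s.upE.ed (.var 0) = .var 0 := rfl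
  simp only [Form.subst, subst_bigAnd, URule.val, URule.adj, Form.sat, sat_adj_val_bigAnd,
    sat_bigAnd, List.mem_map, mem_enum, true_and, exists_exists_eq_and,
    forall_exists_index, forall_apply_eq_imp_iff, Atomic.subst, hs.upE_ed_const, h0]
  constructor
  · rintro ⟨x, h1, -, h3⟩
    have hx : ∀ e, x ≠ st.gE e := fun e => by
      simpa [Atomic.sat, EqOp.holds, ETerm.eval, Assignment.pushE, hR.aed] using h1 e
    rcases st.glueG.coverE x with ⟨e, he⟩ | ⟨d, rfl⟩
    · exact (hx e he.symm).elim
    refine ⟨st.dHE d, fun e => ?_, (hf.inc hR hs d).1 h3⟩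
    simpa [Atomic.sat, EqOp.holds, ETerm.eval, Assignment.pushE, hR.bed] using
      (st.glueH.meetE e d).symm
  · rintro ⟨x, h1, h3⟩
    have hx : ∀ e, x ≠ st.hE e := fun e => by
      simpa [Atomic.sat, EqOp.holds, ETerm.eval, Assignment.pushE, hR.bed] using h1 e
    rcases st.glueH.coverE x with ⟨e, he⟩ | ⟨d, rfl⟩
    · exact (hx e he.symm).elim
    refine ⟨st.dGE d, fun e => ?_, fun e => ?_, (hf.inc hR hs d).2 h3⟩
    · simpa [Atomic.sat, EqOp.holds, ETerm.eval, Assignment.pushE, hR.aed] using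
        (st.glueG.meetE e d).symm
    · rw [(hR.pushE d).edgeRel]
      simpa [Atomic.sat, EqOp.holds, ETerm.eval, Assignment.pushE, hR.bed] using hx e

/-- Quantified formulas as such need not be good; Split yields instances by constants and a guarded
quantifier, and both parts are good. -/
theorem good_split (c : Form u.sigL n m k) : st.Good (u.split c) := by
  induction c with
  | tt => exact fun s a b hR hs => Iff.rfl
  | ff => exact fun s a b hR hs => Iff.rfl
  | atom c => exact good_atom c
  | and c c' ih ih' => exact ih.and ih'
  | or c c' ih ih' => exact ih.or ih'
  | not c ih => exact ih.not
  | exV c ih =>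
    refine Good.or (Good.bigOr ?_) ih.exV
    simp only [List.mem_map, mem_enum, true_and, forall_exists_index, forall_apply_eq_imp_iff]
    exact ih.instV
  | exE c ih =>
    refine Good.or (Good.bigOr ?_) ih.exE
    simp only [List.mem_map, mem_enum, true_and, forall_exists_index, forall_apply_eq_imp_iff]
    exact ih.instE
  | exL c ih => exact ih.exL

theorem good_dang : st.Good u.dang := by
  refine Good.bigAnd ?_
  simp only [List.mem_map, forall_exists_index, and_imp]
  rintro _ v - rfl
  exact Good.and (good_atom _) (good_atom _)

end URule.Step

/-! ### Correctness of Lift and Adj -/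

section

variable {u : URule} {G : HostGraph}

theorem URule.sat_dang (a : Assignment u.sigL G 0 0 0) :
    u.dang.sat a ↔ ∀ v : u.VL, v.1 ∉ u.VK →
      G.indeg (a.nd v) = u.L.indeg v ∧ G.outdeg (a.nd v) = u.L.outdeg v := by
  simp only [URule.dang, sat_bigAnd, List.mem_map, List.mem_filter, mem_enum, true_and,
    forall_exists_index, and_imp, decide_eq_true_eq]
  refine ⟨fun h v hv => ?_, ?_⟩
  · simpa [Form.sat, Atomic.sat, EqOp.holds, LTerm.eval, ITerm.eval, NTerm.eval] using
      h _ v hv rfl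
  · rintro h _ v hv rfl
    simpa [Form.sat, Atomic.sat, EqOp.holds, LTerm.eval, ITerm.eval, NTerm.eval] using h v hv

end

theorem URule.Step.sat_adj_lift {w : GenRule} {G H : HostGraph} (st : w.r.Step G H)
    (c : Sentence) (a : Assignment w.r.sigR G 0 0 0) (hnd : a.nd = st.gV) (hed : a.ed = st.gE)
    (hlb : a.lb = st.val) (b : Assignment w.r.sigL H 0 0 0) (bnd : b.nd = st.hV)
    (bed : b.ed = st.hE) (blb : b.lb = st.val) (hac : w.acL.sat b)
    (b' : Assignment Sig.closed H 0 0 0) :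
    (w.r.adj (lift c w)).sat a ↔ c.sat b' := by
  have hR : st.Rel a b := ⟨hnd, hed, hlb, bnd, bed, blb, fun i => i.elim0, fun i => i.elim0,
    funext fun i => i.elim0⟩
  -- With no variables in scope, every node term is a constant or an endpoint of an edge constant,
  -- and Val evaluates both.
  have hs : st.Resolved Subst.refl b := by
    refine ⟨fun t => ?_, fun _ => rfl, fun _ => rfl⟩
    rcases t with v | i | (e | i) | (e | i)
    · exact Or.inl ⟨v, rfl⟩
    · exact i.elim0
    · exact Or.inl ⟨_, rfl⟩
    · exact i.elim0
    · exact Or.inl ⟨_, rfl⟩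
    · exact i.elim0
  have key := Good.and (good_split (st := st) (.and (c.subst .ofClosed) w.acL))
    (good_dang (st := st)) _ a b hR hs
  rw [Form.subst_refl] at key
  rw [lift, key]
  -- The conjunct Dang of Lift holds in `H` automatically, by the way `H` is glued.
  have hd : w.r.dang.sat b := by
    rw [URule.sat_dang, bnd]
    exact fun v hv => ⟨st.indeg_removed v hv, st.outdeg_removed v hv⟩
  simp only [Form.sat, URule.sat_split, hac, hd, and_true]
  exact (Subst.realizes_ofClosed b b').sat c

/-! ### Natural pushouts of partially labelled graphs -/

section Pushouts

open CategoryTheory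

variable {VK : Finset ℕ} {X G : HostGraph} {D : PGraph} {i : interfaceGraph VK ⟶ X.toPGraph}
  {k : interfaceGraph VK ⟶ D} {m : X.toPGraph ⟶ G.toPGraph} {d : D ⟶ G.toPGraph}

theorem PGraph.hom_ext {A B : PGraph} {f g : A ⟶ B} (hV : ∀ v, f.fV v = g.fV v)
    (hE : ∀ e, f.fE e = g.fE e) : f = g :=
  PGraph.Hom.ext (funext hV) (funext hE)

open Classical in
/-- The graph obtained by gluing `X` and `D` along a discrete graph, where the labels at the
interface are those of `X`. -/
noncomputable def glued (i : interfaceGraph VK ⟶ X.toPGraph) (k : interfaceGraph VK ⟶ D) :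
    PGraph where
  V := D.V ⊕ {v : X.V // ∀ a, i.fV a ≠ v}
  E := D.E ⊕ X.E
  finV := by
    have := D.finV
    have := X.finV
    infer_instance
  finE := by
    have := D.finE
    have := X.finE
    infer_instance
  src := Sum.elim (fun e => .inl (D.src e)) (fun e =>
    if h : ∃ a, i.fV a = X.src e then .inl (k.fV h.choose) else .inr ⟨_, not_exists.1 h⟩)
  tgt := Sum.elim (fun e => .inl (D.tgt e)) (fun e =>
    if h : ∃ a, i.fV a = X.tgt e then .inl (k.fV h.choose) else .inr ⟨_, not_exists.1 h⟩)
  labV := Sum.elim (fun y => if h : ∃ a, k.fV a = y then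
    some (X.labV (i.fV h.choose), X.markV (i.fV h.choose)) else D.labV y)
    (fun v => some (X.labV v.1, X.markV v.1))
  labE := Sum.elim D.labE (fun e => (X.labE e, X.markE e))
  root := Sum.elim (fun y => if h : ∃ a, k.fV a = y then
    some (X.root (i.fV h.choose)) else D.root y) (fun v => some (X.root v.1))

open Classical in
/-- The map of the nodes of `X` to those of the glued graph. -/
noncomputable def gluedNode (i : interfaceGraph VK ⟶ X.toPGraph) (k : interfaceGraph VK ⟶ D)
    (v : X.V) : (glued i k).V :=
  if h : ∃ a, i.fV a = v then .inl (k.fV h.choose) else .inr ⟨_, not_exists.1 h⟩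

theorem gluedNode_interface (hi : Function.Injective i.fV) (a : (interfaceGraph VK).V) :
    gluedNode i k (i.fV a) = .inl (k.fV a) := by
  have h : ∃ b, i.fV b = i.fV a := ⟨a, rfl⟩
  refine (dif_pos h).trans ?_
  rw [hi h.choose_spec]

theorem gluedNode_outside {v : X.V} (hv : ∀ a, i.fV a ≠ v) :
    gluedNode i k v = .inr ⟨v, hv⟩ :=
  dif_neg (not_exists.2 hv)

theorem glued_labV_interface (hk : Function.Injective k.fV) (a : (interfaceGraph VK).V) :
    (glued i k).labV (.inl (k.fV a)) = X.toPGraph.labV (i.fV a) := by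
  have h : ∃ b, k.fV b = k.fV a := ⟨a, rfl⟩
  have h' := hk h.choose_spec
  simp only [glued, Sum.elim_inl, dif_pos h]
  rw [h']; rfl

theorem glued_root_interface (hk : Function.Injective k.fV) (a : (interfaceGraph VK).V) :
    (glued i k).root (.inl (k.fV a)) = X.toPGraph.root (i.fV a) := by
  have h : ∃ b, k.fV b = k.fV a := ⟨a, rfl⟩
  have h' := hk h.choose_spec
  simp only [glued, Sum.elim_inl, dif_pos h]
  rw [h']; rfl

theorem glued_labV_outside {y : D.V} (hy : ∀ a, k.fV a ≠ y) :
    (glued i k).labV (.inl y) = D.labV y :=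
  dif_neg (not_exists.2 hy)

theorem glued_root_outside {y : D.V} (hy : ∀ a, k.fV a ≠ y) :
    (glued i k).root (.inl y) = D.root y :=
  dif_neg (not_exists.2 hy)

noncomputable def gluedInX (hi : Function.Injective i.fV) (hk : Function.Injective k.fV) :
    X.toPGraph ⟶ glued i k :=
  PGraph.Hom.mk (G := X.toPGraph) (H := glued i k) (gluedNode i k) Sum.inr
    (fun _ => rfl) (fun _ => rfl)
    (fun v l hl => by
      by_cases hv : ∃ a, i.fV a = v
      · obtain ⟨a, rfl⟩ := hv
        rw [gluedNode_interface hi, glued_labV_interface hk, hl]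
      · rw [gluedNode_outside (not_exists.1 hv)]
        exact hl)
    (fun _ => rfl)
    (fun v l hl => by
      by_cases hv : ∃ a, i.fV a = v
      · obtain ⟨a, rfl⟩ := hv
        rw [gluedNode_interface hi, glued_root_interface hk, hl]
      · rw [gluedNode_outside (not_exists.1 hv)]
        exact hl)

theorem gluedNode_injective (hi : Function.Injective i.fV) (hk : Function.Injective k.fV) :
    Function.Injective (gluedNode i k) := by
  intro v v' h
  by_cases hv : ∃ a, i.fV a = v <;> by_cases hv' : ∃ a, i.fV a = v'
  · obtain ⟨a, rfl⟩ := hv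
    obtain ⟨a', rfl⟩ := hv'
    rw [gluedNode_interface hi, gluedNode_interface hi] at h
    rw [hk (Sum.inl_injective h)]
  · obtain ⟨a, rfl⟩ := hv
    rw [gluedNode_interface hi, gluedNode_outside (not_exists.1 hv')] at h
    cases h
  · obtain ⟨a, rfl⟩ := hv'
    rw [gluedNode_interface hi, gluedNode_outside (not_exists.1 hv)] at h
    cases h
  · rw [gluedNode_outside (not_exists.1 hv), gluedNode_outside (not_exists.1 hv')] at h
    exact congrArg Subtype.val (Sum.inr_injective h)

noncomputable def gluedInD (hk : Function.Injective k.fV)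
    (hlab : ∀ a l, D.labV (k.fV a) = some l → X.toPGraph.labV (i.fV a) = some l)
    (hroot : ∀ a l, D.root (k.fV a) = some l → X.toPGraph.root (i.fV a) = some l) :
    D ⟶ glued i k :=
  PGraph.Hom.mk (G := D) (H := glued i k) Sum.inl Sum.inl
    (fun _ => rfl) (fun _ => rfl)
    (fun y l hl => by
      by_cases hy : ∃ a, k.fV a = y
      · obtain ⟨a, rfl⟩ := hy
        rw [glued_labV_interface hk, hlab a l hl]
      · rw [glued_labV_outside (not_exists.1 hy)]
        exact hl)
    (fun _ => rfl)
    (fun y l hl => by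
      by_cases hy : ∃ a, k.fV a = y
      · obtain ⟨a, rfl⟩ := hy
        rw [glued_root_interface hk, hroot a l hl]
      · rw [glued_root_outside (not_exists.1 hy)]
        exact hl)

theorem gluing_glued (hi : Function.Injective i.fV) (hk : Function.Injective k.fV)
    (hlab : ∀ a l, D.labV (k.fV a) = some l → X.toPGraph.labV (i.fV a) = some l)
    (hroot : ∀ a l, D.root (k.fV a) = some l → X.toPGraph.root (i.fV a) = some l) :
    Gluing i.fV k.fV (gluedInX hi hk).fV (gluedInX hi hk).fE (gluedInD hk hlab hroot).fV
      (gluedInD hk hlab hroot).fE where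
  mV_inj := gluedNode_injective hi hk
  mE_inj := Sum.inr_injective
  dV_inj := Sum.inl_injective
  dE_inj := Sum.inl_injective
  comm := gluedNode_interface hi
  coverV x := by
    rcases x with y | v
    · exact Or.inr ⟨y, rfl⟩
    · exact Or.inl ⟨v.1, gluedNode_outside v.2⟩
  coverE x := by
    rcases x with y | e
    · exact Or.inr ⟨y, rfl⟩
    · exact Or.inl ⟨e, rfl⟩
  meetV v y h := by
    by_cases hv : ∃ a, i.fV a = v
    · obtain ⟨a, rfl⟩ := hv
      exact ⟨a, rfl, Sum.inl_injective ((gluedNode_interface hi a).symm.trans h)⟩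
    · exact (Sum.inr_ne_inl ((gluedNode_outside (not_exists.1 hv)).symm.trans h)).elim
  meetE _ _ := Sum.inr_ne_inl

/-- A label that `D` carries at an interface node must agree with that of `X`, since both are
preserved into the same node of `G`. Hence the glued graph may take its interface labels from `X`.
-/
theorem labV_of_comm (w : i ≫ m = k ≫ d) (a : (interfaceGraph VK).V) (l)
    (hl : D.labV (k.fV a) = some l) : X.toPGraph.labV (i.fV a) = some l := by
  have hw : m.fV (i.fV a) = d.fV (k.fV a) := congrFun (congrArg PGraph.Hom.fV w) a
  have h1 := d.labV _ _ hl
  have h2 := m.labV (i.fV a) _ rfl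
  rw [hw, h1] at h2
  rw [h2]
  rfl

theorem root_of_comm (w : i ≫ m = k ≫ d) (a : (interfaceGraph VK).V) (l)
    (hl : D.root (k.fV a) = some l) : X.toPGraph.root (i.fV a) = some l := by
  have hw : m.fV (i.fV a) = d.fV (k.fV a) := congrFun (congrArg PGraph.Hom.fV w) a
  have h1 := d.root _ _ hl
  have h2 := m.root (i.fV a) _ rfl
  rw [hw, h1] at h2
  rw [h2]
  rfl

theorem elim_gluedNode (hw : ∀ a, m.fV (i.fV a) = d.fV (k.fV a)) (v : X.V) :
    Sum.elim d.fV (fun v : {v : X.V // ∀ a, i.fV a ≠ v} => m.fV v.1) (gluedNode i k v) =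
      m.fV v := by
  by_cases h : ∃ a, i.fV a = v
  · refine (congrArg _ (dif_pos h)).trans ?_
    exact (hw _).symm.trans (congrArg m.fV h.choose_spec)
  · exact congrArg _ (dif_neg h)

/-- The comparison of the glued graph with any graph completing the square. -/
noncomputable def gluedDesc (hk : Function.Injective k.fV) (w : i ≫ m = k ≫ d) :
    glued i k ⟶ G.toPGraph := by
  have hw : ∀ a, m.fV (i.fV a) = d.fV (k.fV a) := fun a =>
    congrFun (congrArg PGraph.Hom.fV w) a
  exact PGraph.Hom.mk (G := glued i k) (H := G.toPGraph)
    (Sum.elim d.fV (fun v => m.fV v.1)) (Sum.elim d.fE m.fE)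
    (fun e => by
      rcases e with e | e
      · exact d.src e
      · exact (m.src e).trans (elim_gluedNode hw _).symm)
    (fun e => by
      rcases e with e | e
      · exact d.tgt e
      · exact (m.tgt e).trans (elim_gluedNode hw _).symm)
    (fun y l hl => by
      rcases y with y | v
      · by_cases hy : ∃ a, k.fV a = y
        · obtain ⟨a, rfl⟩ := hy
          rw [glued_labV_interface hk] at hl
          have := m.labV _ _ hl
          rwa [hw] at this
        · rw [glued_labV_outside (not_exists.1 hy)] at hl
          exact d.labV _ _ hl
      · exact m.labV _ _ hl)
    (fun e => by
      rcases e with e | e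
      · exact d.labE e
      · exact m.labE e)
    (fun y l hl => by
      rcases y with y | v
      · by_cases hy : ∃ a, k.fV a = y
        · obtain ⟨a, rfl⟩ := hy
          rw [glued_root_interface hk] at hl
          have := m.root _ _ hl
          rwa [hw] at this
        · rw [glued_root_outside (not_exists.1 hy)] at hl
          exact d.root _ _ hl
      · exact m.root _ _ hl)

/-- The universal property gives a morphism from `G` to the explicit gluing. Injectivity and
disjointness are reflected along it, and covering follows because the comparison map back to `G` is
a left inverse. It also shows that `D` must be labelled and rooted outside the interface. -/
theorem gluing_of_isPushout (hi : Function.Injective i.fV) (hk : Function.Injective k.fV)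
    (h : IsPushout i k m d) :
    Gluing i.fV k.fV m.fV m.fE d.fV d.fE ∧
      ∀ y, (∀ a, k.fV a ≠ y) → D.labV y = G.toPGraph.labV (d.fV y) ∧
        D.root y = G.toPGraph.root (d.fV y) := by
  have hw : ∀ a, m.fV (i.fV a) = d.fV (k.fV a) := fun a =>
    congrFun (congrArg PGraph.Hom.fV h.w) a
  have hwG : i ≫ gluedInX hi hk = k ≫ gluedInD hk (labV_of_comm h.w) (root_of_comm h.w) :=
    PGraph.hom_ext (fun a => gluedNode_interface hi a) (fun e => Empty.elim e)
  let φ : G.toPGraph ⟶ glued i k := h.desc _ _ hwG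
  have hφm : m ≫ φ = gluedInX hi hk := h.inl_desc _ _ hwG
  have hφd : d ≫ φ = gluedInD hk (labV_of_comm h.w) (root_of_comm h.w) := h.inr_desc _ _ hwG
  have vm : ∀ v, φ.fV (m.fV v) = gluedNode i k v := fun v =>
    congrFun (congrArg PGraph.Hom.fV hφm) v
  have em : ∀ e, φ.fE (m.fE e) = .inr e := fun v =>
    congrFun (congrArg PGraph.Hom.fE hφm) v
  have vd : ∀ v, φ.fV (d.fV v) = .inl v := fun v =>
    congrFun (congrArg PGraph.Hom.fV hφd) v
  have ed : ∀ e, φ.fE (d.fE e) = .inl e := fun v =>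
    congrFun (congrArg PGraph.Hom.fE hφd) v
  -- Both sides agree on the two pushout legs. Consequently every item of `G` is the value of
  -- `gluedDesc` on an item of the gluing.
  have hid : φ ≫ gluedDesc hk h.w = 𝟙 _ := by
    apply h.hom_ext
    · rw [← Category.assoc, hφm, Category.comp_id]
      exact PGraph.hom_ext (elim_gluedNode hw) (fun e => rfl)
    · rw [← Category.assoc, hφd, Category.comp_id]
      rfl
  have idV : ∀ x, (gluedDesc hk h.w).fV (φ.fV x) = x := fun x =>
    congrFun (congrArg PGraph.Hom.fV hid) x
  have idE : ∀ x, (gluedDesc hk h.w).fE (φ.fE x) = x := fun x =>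
    congrFun (congrArg PGraph.Hom.fE hid) x
  refine ⟨⟨fun v v' hv => ?_, fun e f hef => ?_, fun x y hxy => ?_, fun x y hxy => ?_, hw, fun x => ?_,
    fun x => ?_, fun v y hvy => ?_, fun e f hef => ?_⟩, fun y hy => ⟨?_, ?_⟩⟩
  · have := congrArg φ.fV hv
    rw [vm, vm] at this
    exact gluedNode_injective hi hk this
  · have := congrArg φ.fE hef
    rw [em, em] at this
    exact Sum.inr_injective this
  · have := congrArg φ.fV hxy
    rw [vd, vd] at this
    exact Sum.inl_injective this
  · have := congrArg φ.fE hxy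
    rw [ed, ed] at this
    exact Sum.inl_injective this
  · rw [← idV x]
    rcases φ.fV x with y | v
    · exact Or.inr ⟨y, rfl⟩
    · exact Or.inl ⟨v.1, rfl⟩
  · rw [← idE x]
    rcases φ.fE x with y | v
    · exact Or.inr ⟨y, rfl⟩
    · exact Or.inl ⟨v, rfl⟩
  · have := congrArg φ.fV hvy
    rw [vm, vd] at this
    by_cases hv : ∃ a, i.fV a = v
    · obtain ⟨a, rfl⟩ := hv
      rw [gluedNode_interface hi] at this
      exact ⟨a, rfl, Sum.inl_injective this⟩
    · rw [gluedNode_outside (not_exists.1 hv)] at this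
      cases this
  · have := congrArg φ.fE hef
    rw [em, ed] at this
    cases this
  · have := φ.labV (d.fV y) _ rfl
    rw [vd, glued_labV_outside hy] at this
    exact this
  · have := φ.root (d.fV y) _ rfl
    rw [vd, glued_root_outside hy] at this
    exact this

open Classical in
-- The mediating map is defined by cases on the two images. It preserves labels and roots because
-- outside the interface those of `D` are assumed to be defined; otherwise nothing would force the
-- target to carry the values found in `G`.
theorem isPushout_of_gluing (h : Gluing i.fV k.fV m.fV m.fE d.fV d.fE)
    (hlab : ∀ y, (∀ a, k.fV a ≠ y) → D.labV y ≠ none)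
    (hroot : ∀ y, (∀ a, k.fV a ≠ y) → D.root y ≠ none) : IsPushout i k m d := by
  have w : i ≫ m = k ≫ d := PGraph.hom_ext h.comm (fun e => Empty.elim e)
  refine ⟨⟨w⟩, ⟨Limits.PushoutCocone.IsColimit.mk w (fun s => ?_) ?_ ?_ ?_⟩⟩
  · have hs : ∀ a, s.inl.fV (i.fV a) = s.inr.fV (k.fV a) := fun a =>
      congrFun (congrArg PGraph.Hom.fV s.condition) a
    -- Nodes in the image of `m` follow the left leg, all others the right leg; on the overlap the
    -- legs agree by commutativity.
    let fV : G.V → s.pt.V := fun x =>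
      if hx : ∃ v, m.fV v = x then s.inl.fV hx.choose
      else s.inr.fV ((h.coverV x).resolve_left hx).choose
    let fE : G.E → s.pt.E := fun x =>
      if hx : ∃ v, m.fE v = x then s.inl.fE hx.choose
      else s.inr.fE ((h.coverE x).resolve_left hx).choose
    have fVm : ∀ v, fV (m.fV v) = s.inl.fV v := fun v => by
      have hx : ∃ u, m.fV u = m.fV v := ⟨v, rfl⟩
      simp only [fV, dif_pos hx]
      rw [h.mV_inj hx.choose_spec]
    have fEm : ∀ v, fE (m.fE v) = s.inl.fE v := fun v => by
      have hx : ∃ u, m.fE u = m.fE v := ⟨v, rfl⟩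
      simp only [fE, dif_pos hx]
      rw [h.mE_inj hx.choose_spec]
    have fVd : ∀ y, fV (d.fV y) = s.inr.fV y := fun y => by
      by_cases hx : ∃ v, m.fV v = d.fV y
      · obtain ⟨v, hv⟩ := hx
        obtain ⟨a, rfl, rfl⟩ := h.meetV _ _ hv
        rw [← hv, fVm, hs]
      · simp only [fV, dif_neg hx]
        rw [h.dV_inj ((h.coverV (d.fV y)).resolve_left hx).choose_spec]
    have fEd : ∀ y, fE (d.fE y) = s.inr.fE y := fun y => by
      have hx : ¬ ∃ v, m.fE v = d.fE y := fun ⟨v, hv⟩ => h.meetE _ _ hv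
      simp only [fE, dif_neg hx]
      rw [h.dE_inj ((h.coverE (d.fE y)).resolve_left hx).choose_spec]
    refine PGraph.Hom.mk (G := G.toPGraph) fV fE (fun e => ?_) (fun e => ?_) (fun x l hl => ?_)
      (fun e => ?_) (fun x l hl => ?_)
    · rcases h.coverE e with ⟨e, rfl⟩ | ⟨e, rfl⟩
      · rw [fEm, m.src, fVm, s.inl.src]
      · rw [fEd, d.src, fVd, s.inr.src]
    · rcases h.coverE e with ⟨e, rfl⟩ | ⟨e, rfl⟩
      · rw [fEm, m.tgt, fVm, s.inl.tgt]
      · rw [fEd, d.tgt, fVd, s.inr.tgt]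
    · by_cases hx : ∃ v, m.fV v = x
      · obtain ⟨v, rfl⟩ := hx
        rw [fVm]
        refine s.inl.labV v l ?_
        have := m.labV v _ rfl
        rw [hl] at this
        exact this.symm
      · obtain ⟨y, rfl⟩ := (h.coverV x).resolve_left hx
        rw [fVd]
        refine s.inr.labV y l ?_
        obtain ⟨l', hl'⟩ := Option.ne_none_iff_exists'.1 (hlab y fun a ha =>
          hx ⟨i.fV a, by rw [h.comm, ha]⟩)
        rw [← hl, d.labV y l' hl', hl']
    · rcases h.coverE e with ⟨e, rfl⟩ | ⟨e, rfl⟩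
      · rw [fEm, m.labE, s.inl.labE]
      · rw [fEd, d.labE, s.inr.labE]
    · by_cases hx : ∃ v, m.fV v = x
      · obtain ⟨v, rfl⟩ := hx
        rw [fVm]
        refine s.inl.root v l ?_
        have := m.root v _ rfl
        rw [hl] at this
        exact this.symm
      · obtain ⟨y, rfl⟩ := (h.coverV x).resolve_left hx
        rw [fVd]
        refine s.inr.root y l ?_
        obtain ⟨l', hl'⟩ := Option.ne_none_iff_exists'.1 (hroot y fun a ha =>
          hx ⟨i.fV a, by rw [h.comm, ha]⟩)
        rw [← hl, d.root y l' hl', hl']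
  · intro s
    refine PGraph.hom_ext (fun v => ?_) (fun e => ?_)
    · have hx : ∃ u, m.fV u = m.fV v := ⟨v, rfl⟩
      refine (dif_pos hx).trans ?_
      rw [h.mV_inj hx.choose_spec]
    · have hx : ∃ u, m.fE u = m.fE e := ⟨e, rfl⟩
      refine (dif_pos hx).trans ?_
      rw [h.mE_inj hx.choose_spec]
  · intro s
    refine PGraph.hom_ext (fun y => ?_) (fun y => ?_)
    · by_cases hx : ∃ v, m.fV v = d.fV y
      · refine (dif_pos hx).trans ?_
        obtain ⟨a, ha, ha'⟩ := h.meetV _ _ hx.choose_spec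
        rw [← ha, ← ha']
        exact congrFun (congrArg PGraph.Hom.fV s.condition) a
      · refine (dif_neg hx).trans ?_
        rw [h.dV_inj ((h.coverV (d.fV y)).resolve_left hx).choose_spec]
    · have hx : ¬ ∃ v, m.fE v = d.fE y := fun ⟨v, hv⟩ => h.meetE _ _ hv
      refine (dif_neg hx).trans ?_
      rw [h.dE_inj ((h.coverE (d.fE y)).resolve_left hx).choose_spec]
  · intro s f hf hf'
    have h1 : ∀ v, f.fV (m.fV v) = s.inl.fV v := fun v =>
      congrFun (congrArg PGraph.Hom.fV hf) v
    have h2 : ∀ v, f.fE (m.fE v) = s.inl.fE v := fun v =>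
      congrFun (congrArg PGraph.Hom.fE hf) v
    have h3 : ∀ v, f.fV (d.fV v) = s.inr.fV v := fun v =>
      congrFun (congrArg PGraph.Hom.fV hf') v
    have h4 : ∀ v, f.fE (d.fE v) = s.inr.fE v := fun v =>
      congrFun (congrArg PGraph.Hom.fE hf') v
    refine PGraph.hom_ext (fun x => ?_) (fun x => ?_)
    · by_cases hx : ∃ v, m.fV v = x
      · refine Eq.trans ?_ (dif_pos hx).symm
        rw [← h1, hx.choose_spec]
      · refine Eq.trans ?_ (dif_neg hx).symm
        rw [← h3, ((h.coverV x).resolve_left hx).choose_spec]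
    · by_cases hx : ∃ v, m.fE v = x
      · refine Eq.trans ?_ (dif_pos hx).symm
        rw [← h2, hx.choose_spec]
      · refine Eq.trans ?_ (dif_neg hx).symm
        rw [← h4, ((h.coverE x).resolve_left hx).choose_spec]

/-- The images share only the interface nodes, so a cone has no edges and its nodes factor uniquely
through the interface. As the interface is unlabelled and unrooted, this is a morphism only if `D`
forces undefined values there, whence the last two assumptions. -/
theorem isPullback_of_gluing (hi : Function.Injective i.fV)
    (h : Gluing i.fV k.fV m.fV m.fE d.fV d.fE)
    (hlab : ∀ a, D.labV (k.fV a) = none) (hroot : ∀ a, D.root (k.fV a) = none) :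
    IsPullback i k m d := by
  have w : i ≫ m = k ≫ d := PGraph.hom_ext h.comm (fun e => Empty.elim e)
  have hV : ∀ (s : Limits.PullbackCone m d) (t : s.pt.V), ∃ a, i.fV a = s.fst.fV t ∧
      k.fV a = s.snd.fV t := fun s t =>
    h.meetV _ _ (congrFun (congrArg PGraph.Hom.fV s.condition) t)
  have hE : ∀ (s : Limits.PullbackCone m d), s.pt.E → False := fun s t =>
    h.meetE _ _ (congrFun (congrArg PGraph.Hom.fE s.condition) t)
  choose f hf hf' using hV
  refine ⟨⟨w⟩, ⟨Limits.PullbackCone.IsLimit.mk w (fun s => ?_) ?_ ?_ ?_⟩⟩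
  · refine PGraph.Hom.mk (H := interfaceGraph VK) (f s) (fun e => (hE s e).elim)
      (fun e => (hE s e).elim) (fun e => (hE s e).elim) (fun t l hl => ?_)
      (fun e => (hE s e).elim) (fun t l hl => ?_)
    · have := s.snd.labV t l hl
      rw [← hf', hlab] at this
      cases this
    · have := s.snd.root t l hl
      rw [← hf', hroot] at this
      cases this
  · exact fun s => PGraph.hom_ext (hf s) (fun e => (hE s e).elim)
  · exact fun s => PGraph.hom_ext (hf' s) (fun e => (hE s e).elim)
  · intro s g hg _
    refine PGraph.hom_ext (fun t => hi ?_) (fun e => (hE s e).elim)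
    exact (congrFun (congrArg PGraph.Hom.fV hg) t).trans (hf s t).symm

theorem PGraph.exists_hostGraph (Z : PGraph) (hlab : ∀ v, Z.labV v ≠ none)
    (hroot : ∀ v, Z.root v ≠ none) : ∃ H : HostGraph, H.toPGraph = Z := by
  choose l hl using fun v => Option.ne_none_iff_exists'.1 (hlab v)
  choose b hb using fun v => Option.ne_none_iff_exists'.1 (hroot v)
  refine ⟨⟨Z.V, Z.E, Z.finV, Z.finE, Z.src, Z.tgt, fun v => (l v).1, fun v => (l v).2,
    fun e => (Z.labE e).1, fun e => (Z.labE e).2, b⟩, ?_⟩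
  cases Z
  simp only [HostGraph.toPGraph, PGraph.mk.injEq, heq_eq_eq, true_and]
  exact ⟨funext fun v => (hl v).symm, funext fun v => (hb v).symm⟩

end Pushouts
-- Satisfaction of indexed conjunctions and of list equations
theorem sat_bigAnd_map {σ : Sig} {G : HostGraph} {n m k : ℕ} {A : Type} (a : Assignment σ G n m k)
    (l : List A) (f : A → Form σ n m k) : (bigAnd (l.map f)).sat a ↔ ∀ x ∈ l, (f x).sat a := by
  simp [sat_bigAnd]

theorem sat_bigAnd_enum {σ : Sig} {G : HostGraph} {n m k : ℕ} {S : Finset ℕ}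
    (a : Assignment σ G n m k) (f : S → Form σ n m k) :
    (bigAnd ((enum S).map f)).sat a ↔ ∀ x, (f x).sat a := by
  rw [sat_bigAnd_map]
  exact ⟨fun h x => h x (mem_enum x), fun h x _ => h x⟩

theorem sat_listRel_eq {σ : Sig} {G : HostGraph} {n m k : ℕ} {a : Assignment σ G n m k}
    {s t : LTerm σ n m k} {x y : GPList} (hs : s.eval a = some x) (ht : t.eval a = some y) :
    (Form.atom (.listRel .eq s t)).sat a ↔ x = y := by
  simp [Form.sat, Atomic.sat, hs, ht, EqOp.holds]

/-! ### Closing a condition over a rule graph -/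

theorem mem_pairs {n : ℕ} (i j : Fin n) : (i, j) ∈ pairs n ↔ i < j := by
  simp [pairs, List.product]

theorem injective_iff_lt {n : ℕ} {A : Type} (f : Fin n → A) :
    Function.Injective f ↔ ∀ i j, i < j → f i ≠ f j := by
  refine ⟨fun h i j hij e => hij.ne (h e), fun h i j e => ?_⟩
  rcases lt_trichotomy i j with hij | hij | hij
  · exact (h i j hij e).elim
  · exact hij
  · exact (h j i hij e.symm).elim

/-- Positions of identifiers are in bijection with the identifiers, so choosing values for the fresh
variables is choosing an assignment, and the inequations over pairs `i < j` express injectivity. -/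
theorem models_closure {p : ℕ} {V E : Finset ℕ} (c : Form (Sig.over p V E) 0 0 0)
    (G : HostGraph) :
    Models G (exVs _ (exEs _ (exLs _ (variablise c)))) ↔
      ∃ a : Assignment (Sig.over p V E) G 0 0 0, Function.Injective a.nd ∧
        Function.Injective a.ed ∧ c.sat a := by
  have key : ∀ (a : Assignment Sig.closed G V.card E.card p)
      (b : Assignment (Sig.over p V E) G 0 0 0), (∀ v, b.nd v = a.vn (idx V v)) →
      (∀ v, b.ed v = a.ve (idx E v)) → b.lb = a.vl →
      ((variablise c).sat a ↔ Function.Injective b.nd ∧ Function.Injective b.ed ∧ c.sat b) := by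
    intro a b hnd hed hlb
    have hr : (Subst.close p V E).Realizes a b := by
      refine ⟨?_, ?_, ?_, fun c => c.elim⟩
      · rintro (v | i | (e | i) | (e | i))
        · exact (hnd v).symm
        · exact i.elim0
        · exact congrArg G.src (hed e).symm
        · exact i.elim0
        · exact congrArg G.tgt (hed e).symm
        · exact i.elim0
      · rintro (e | i)
        · exact (hed e).symm
        · exact i.elim0
      · rintro (x | i)
        · exact (congrFun hlb x).symm
        · exact i.elim0
    have h1 : Function.Injective b.nd ↔ Function.Injective a.vn := by
      rw [show b.nd = a.vn ∘ idx V from funext hnd]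
      exact (Equiv.injective_comp (V.orderIsoOfFin rfl).symm.toEquiv a.vn)
    have h2 : Function.Injective b.ed ↔ Function.Injective a.ve := by
      rw [show b.ed = a.ve ∘ idx E from funext hed]
      exact (Equiv.injective_comp (E.orderIsoOfFin rfl).symm.toEquiv a.ve)
    rw [h1, h2, injective_iff_lt, injective_iff_lt]
    simp only [variablise, Form.sat, sat_bigAnd_map, Prod.forall, mem_pairs, Atomic.sat, EqOp.holds, NTerm.eval,
      ETerm.eval, hr.sat, ne_eq]
  simp only [Models, sat_exVs, sat_exEs, sat_exLs]
  constructor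
  · rintro ⟨a, vn, ve, vl, h⟩
    exact ⟨⟨fun v => vn (idx V v), fun e => ve (idx E e), vl, Empty.elim, Fin.elim0, Fin.elim0,
      Fin.elim0⟩, (key _ _ (fun _ => rfl) (fun _ => rfl) rfl).1 h⟩
  · rintro ⟨b, hb⟩
    refine ⟨⟨Empty.elim, Empty.elim, Empty.elim, Empty.elim, Fin.elim0, Fin.elim0, Fin.elim0⟩,
      fun i => b.nd (V.orderIsoOfFin rfl i), fun i => b.ed (E.orderIsoOfFin rfl i), b.lb,
      (key _ b (fun v => ?_) (fun v => ?_) rfl).2 hb⟩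
    · simp [idx]
    · simp [idx]

/-! ### The specification of the left-hand graph -/

theorem sat_typeForm {σ : Sig} {G : HostGraph} {n m k : ℕ} (a : Assignment σ G n m k)
    (x : LVar σ.lb k) (s : LSort) :
    (typeForm x s : Form σ n m k).sat a ↔ x.eval a.lb a.vl ∈ s.dom := by
  cases s
  · simp [typeForm, Form.sat, LSort.dom]
  all_goals exact Iff.rfl

/-- For the inverse rule, the match used for evaluation lies on the right-hand side, so the degree
operator is simply the degree of the constant in `G`. -/
theorem RuleSchema.eval_indegAt (r : RuleSchema) {G : HostGraph} {n m k : ℕ}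
    (a : Assignment r.toURule.inv.sigR G n m k) (i : r.VL) :
    ITerm.eval a (r.toURule.inv.indegAt i) = some (G.indeg (a.nd i)) := by
  change ITerm.eval a (if h : i.1 ∈ r.VL then .indeg (.const ⟨i.1, h⟩) else .num 0) = _
  rw [dif_pos i.2]
  rfl

theorem RuleSchema.eval_outdegAt (r : RuleSchema) {G : HostGraph} {n m k : ℕ}
    (a : Assignment r.toURule.inv.sigR G n m k) (i : r.VL) :
    ITerm.eval a (r.toURule.inv.outdegAt i) = some (G.outdeg (a.nd i)) := by
  change ITerm.eval a (if h : i.1 ∈ r.VL then .outdeg (.const ⟨i.1, h⟩) else .num 0) = _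
  rw [dif_pos i.2]
  rfl

theorem RuleSchema.sat_spec (r : RuleSchema) {G : HostGraph}
    (a : Assignment (Sig.over r.p r.VL r.EL) G 0 0 0) :
    Form.sat a r.toURule.inv.spec ↔ (∀ x, a.lb x ∈ (r.τ x).dom) ∧
      (∀ v, G.labV (a.nd v) = (r.L.labV v).eval G a.nd a.lb ∧
        Wild.agree VMark.none (.mk (G.markV (a.nd v))) (r.L.markV v) = true ∧
        G.root (a.nd v) = r.L.root v) ∧
      ∀ e, G.src (a.ed e) = a.nd (r.L.src e) ∧ G.tgt (a.ed e) = a.nd (r.L.tgt e) ∧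
        G.labE (a.ed e) = (r.L.labE e).eval G a.nd a.lb ∧
        Wild.agree EMark.none (.mk (G.markE (a.ed e))) (r.L.markE e) = true := by
  have h1 : (bigAnd (List.ofFn (fun x : Fin r.p => typeForm (.free x) (r.τ x))) :
      Form (Sig.over r.p r.VL r.EL) 0 0 0).sat a ↔ ∀ x, a.lb x ∈ (r.τ x).dom := by
    rw [sat_bigAnd]
    simp only [List.mem_ofFn, forall_exists_index, forall_apply_eq_imp_iff, sat_typeForm]
    rfl
  refine (and_congr h1 (and_congr (sat_bigAnd_enum a _) (sat_bigAnd_enum a _))).trans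
    -- The typing conjunct is established first, because only typed values make the label terms
    -- defined.
    (and_congr_right fun hval => ?_)
  have hexp : ∀ e : LExp r.τ r.VL, LTerm.eval a (r.toURule.inv.expR e) =
      some (e.eval G a.nd a.lb) := fun e =>
    LExp.eval_toTerm hval (fun _ => rfl) (r.eval_indegAt a) (r.eval_outdegAt a) e
  refine and_congr (forall_congr' fun v => ?_) (forall_congr' fun e => ?_)
  · refine and_congr (sat_listRel_eq rfl (hexp _)) (and_congr Iff.rfl ?_)
    cases h : r.L.root v
    · have : (if r.L.root v then Form.atom (.root (.const v))
          else .not (.atom (.root (.const v))) : Form (Sig.over r.p r.VL r.EL) 0 0 0) =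
          .not (.atom (.root (.const v))) := by rw [h]; rfl
      refine (iff_of_eq (congrArg (Form.sat a) this)).trans ?_
      exact iff_of_eq (Bool.not_eq_true _)
    · have : (if r.L.root v then Form.atom (.root (.const v))
          else .not (.atom (.root (.const v))) : Form (Sig.over r.p r.VL r.EL) 0 0 0) =
          .atom (.root (.const v)) := by rw [h]; rfl
      exact iff_of_eq (congrArg (Form.sat a) this)
  · exact and_congr Iff.rfl (and_congr Iff.rfl (and_congr (sat_listRel_eq rfl (hexp _)) Iff.rfl))

open CategoryTheory

/-! ### Direct derivations and transformation steps -/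

variable {r : RuleSchema} {G H : HostGraph}

/-- `g` and `α` are a match of the left-hand graph satisfying the application condition. -/
def RuleSchema.IsMatch (r : RuleSchema) (G : HostGraph) (g : r.L.Premorphism G)
    (α : LabelAssignment r.τ) (m : (r.L.inst G g.fV α).toPGraph ⟶ G.toPGraph) : Prop :=
  m.fV = g.fV ∧ m.fE = g.fE ∧ r.Γ.holds G g.fV α.val

/-- The existence of a natural double-pushout for a given match. -/
def RuleSchema.Produces (r : RuleSchema) (G H : HostGraph) (g : r.L.Premorphism G)
    (α : LabelAssignment r.τ) (m : (r.L.inst G g.fV α).toPGraph ⟶ G.toPGraph) : Prop :=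
  ∃ (D : PGraph) (k : interfaceGraph r.VK ⟶ D) (dG : D ⟶ G.toPGraph)
    (dH : D ⟶ H.toPGraph) (gs : (r.R.inst G g.fV α).toPGraph ⟶ H.toPGraph),
    IsPushout (interfaceIncl r.KL r.L G g.fV α) k m dG ∧
    IsPullback (interfaceIncl r.KL r.L G g.fV α) k m dG ∧
    IsPushout (interfaceIncl r.KR r.R G g.fV α) k gs dH ∧
    IsPullback (interfaceIncl r.KR r.R G g.fV α) k gs dH

theorem RuleSchema.mem_results : H ∈ r.results G ↔ ∃ g α m, r.IsMatch G g α m ∧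
    r.Produces G H g α m := by
  constructor
  · rintro ⟨g, α, m, h1, h2, h3, h4⟩
    exact ⟨g, α, m, ⟨h1, h2, h3⟩, h4⟩
  · rintro ⟨g, α, m, ⟨h1, h2, h3⟩, h4⟩
    exact ⟨g, α, m, h1, h2, h3, h4⟩

theorem interfaceIncl_injective {p : ℕ} {τ : Fin p → LSort} {V E I VK : Finset ℕ} (h : VK ⊆ V)
    (M : RuleGraph τ V E I) (G : HostGraph) (g : I → G.V) (α : LabelAssignment τ) :
    Function.Injective (interfaceIncl h M G g α).fV :=
  fun _ _ hab => Subtype.ext (congrArg (fun x : V => x.1) hab)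

theorem RuleSchema.IsMatch.labV_markV {g : r.L.Premorphism G} {α : LabelAssignment r.τ}
    {m : (r.L.inst G g.fV α).toPGraph ⟶ G.toPGraph} (hm : r.IsMatch G g α m) (v : r.VL) :
    (G.labV (g.fV v), G.markV (g.fV v)) =
      ((r.L.labV v).eval G g.fV α.val, (r.L.markV v).resolve (α.muV v.1)) := by
  have h : (G.labV (m.fV v), G.markV (m.fV v)) =
      ((r.L.labV v).eval G g.fV α.val, (r.L.markV v).resolve (α.muV v.1)) :=
    Option.some_injective _ (m.labV v _ rfl)
  rwa [hm.1] at h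

theorem RuleSchema.IsMatch.labE_markE {g : r.L.Premorphism G} {α : LabelAssignment r.τ}
    {m : (r.L.inst G g.fV α).toPGraph ⟶ G.toPGraph} (hm : r.IsMatch G g α m) (e : r.EL) :
    (G.labE (g.fE e), G.markE (g.fE e)) =
      ((r.L.labE e).eval G g.fV α.val, (r.L.markE e).resolve (α.muE e.1)) := by
  have h : (G.labE (m.fE e), G.markE (m.fE e)) =
      ((r.L.labE e).eval G g.fV α.val, (r.L.markE e).resolve (α.muE e.1)) := m.labE e
  rwa [hm.2.1] at h

/-- Both pushout squares are read as gluings with the same `D`. The step is for the inverse rule, so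
`r.L` and `G` occupy its right-hand side and `r.R` and `H` its left-hand side. -/
theorem RuleSchema.Produces.exists_step {g : r.L.Premorphism G} {α : LabelAssignment r.τ}
    {m : (r.L.inst G g.fV α).toPGraph ⟶ G.toPGraph} (hm : r.IsMatch G g α m)
    (h : r.Produces G H g α m) :
    ∃ st : r.toURule.inv.Step G H, st.gV = g.fV ∧ st.gE = g.fE ∧ st.val = α.val := by
  have ⟨hmV, hmE, _⟩ := hm
  obtain ⟨D, k, dG, dH, gs, h1, -, h3, -⟩ := h
  have hiL := interfaceIncl_injective r.KL r.L G g.fV α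
  have hiR := interfaceIncl_injective r.KR r.R G g.fV α
  -- Injectivity of `k` follows from that of the match and of the interface inclusion by
  -- commutativity of the left square.
  have hk : Function.Injective k.fV := by
    intro a b hab
    have hw : ∀ a, m.fV ((interfaceIncl r.KL r.L G g.fV α).fV a) = dG.fV (k.fV a) := fun a =>
      congrFun (congrArg PGraph.Hom.fV h1.w) a
    have := (hw a).trans ((congrArg dG.fV hab).trans (hw b).symm)
    rw [hmV] at this
    exact hiL (g.injV this)
  obtain ⟨glueG, labG⟩ := gluing_of_isPushout hiL hk h1
  obtain ⟨glueH, labH⟩ := gluing_of_isPushout hiR hk h3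
  rw [hmV, hmE] at glueG
  have labV : ∀ y, (∀ a, k.fV a ≠ y) →
      (G.labV (dG.fV y), G.markV (dG.fV y)) = (H.labV (dH.fV y), H.markV (dH.fV y)) :=
    fun y hy => Option.some_injective _ ((labG y hy).1.symm.trans (labH y hy).1)
  have root : ∀ y, (∀ a, k.fV a ≠ y) → G.root (dG.fV y) = H.root (dH.fV y) :=
    fun y hy => Option.some_injective _ ((labG y hy).2.symm.trans (labH y hy).2)
  have labE : ∀ e, (G.labE (dG.fE e), G.markE (dG.fE e)) = (H.labE (dH.fE e), H.markE (dH.fE e)) :=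
    fun e => (dG.labE e).trans (dH.labE e).symm
  have hlabV : ∀ v, (H.labV (gs.fV v), H.markV (gs.fV v)) =
      ((r.R.labV v).eval G g.fV α.val, (r.R.markV v).resolve (α.muV v.1)) :=
    fun v => Option.some_injective _ (gs.labV v _ rfl)
  have hlabE : ∀ e, (H.labE (gs.fE e), H.markE (gs.fE e)) =
      ((r.R.labE e).eval G g.fV α.val, (r.R.markE e).resolve (α.muE e.1)) := gs.labE
  have glabV := hm.labV_markV
  have glabE := hm.labE_markE
  refine ⟨{
    gI := g.fV
    val := α.val
    val_mem := α.val_mem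
    DV := D.V
    DE := D.E
    finE := D.finE
    dsrc := D.src
    dtgt := D.tgt
    k := k.fV
    gV := g.fV
    gE := g.fE
    dGV := dG.fV
    dGE := dG.fE
    hV := gs.fV
    hE := gs.fE
    dHV := dH.fV
    dHE := dH.fE
    glueG := glueG
    glueH := glueH
    gsrc := g.src
    gtgt := g.tgt
    hsrc := gs.src
    htgt := gs.tgt
    dGsrc := dG.src
    dGtgt := dG.tgt
    dHsrc := dH.src
    dHtgt := dH.tgt
    labV := fun y hy => congrArg Prod.fst (labV y hy)
    markV := fun y hy => congrArg Prod.snd (labV y hy)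
    root := root
    labE := fun e => congrArg Prod.fst (labE e)
    markE := fun e => congrArg Prod.snd (labE e)
    hlabV := fun v => congrArg Prod.fst (hlabV v)
    hlabE := fun e => congrArg Prod.fst (hlabE e)
    hroot := fun v => Option.some_injective _ (gs.root v _ rfl)
    hmarkV := ?_
    hmarkE := ?_
    indegAt := ?_
    outdegAt := ?_ }, rfl, rfl, rfl⟩
  · intro v
    have hv : H.markV (gs.fV v) = (r.R.markV v).resolve (α.muV v.1) := congrArg Prod.snd (hlabV v)
    change r.R.markV v = .mk (H.markV (gs.fV v)) ∨ r.R.markV v = .any ∧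
      ∃ h : v.1 ∈ r.VK, r.L.markV ⟨v.1, r.KL h⟩ = .any ∧
        G.markV (g.fV ⟨v.1, r.KL h⟩) = H.markV (gs.fV v)
    rw [hv]
    cases h : r.R.markV v with
    | mk q => exact Or.inl rfl
    | any =>
      -- A wildcard in `R` sits at an interface node with a wildcard in `L`; both are resolved by
      -- the same assignment, so the mark is preserved.
      obtain ⟨hk, hL⟩ := r.anyV v h
      refine Or.inr ⟨rfl, hk, hL, ?_⟩
      have : G.markV (g.fV ⟨v.1, r.KL hk⟩) = _ := congrArg Prod.snd (glabV ⟨v.1, r.KL hk⟩)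
      rw [this, hL]
  · intro e
    have hv : H.markE (gs.fE e) = (r.R.markE e).resolve (α.muE e.1) := congrArg Prod.snd (hlabE e)
    change r.R.markE e = .mk (H.markE (gs.fE e)) ∨ r.R.markE e = .any ∧
      ∃ h : e.1 ∈ r.EL, r.L.markE ⟨e.1, h⟩ = .any ∧
        G.markE (g.fE ⟨e.1, h⟩) = H.markE (gs.fE e)
    rw [hv]
    cases h : r.R.markE e with
    | mk q => exact Or.inl rfl
    | any =>
      obtain ⟨hk, hL⟩ := r.anyE e h
      refine Or.inr ⟨rfl, hk, hL, ?_⟩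
      have : G.markE (g.fE ⟨e.1, hk⟩) = _ := congrArg Prod.snd (glabE ⟨e.1, hk⟩)
      rw [this, hL]
  · intro n m k a ha i
    exact (r.eval_indegAt a i).trans (by rw [ha])
  · intro n m k a ha i
    exact (r.eval_outdegAt a i).trans (by rw [ha])

/-- The dangling condition for an occurrence of the left-hand graph. -/
def RuleSchema.Dangling (r : RuleSchema) (G : HostGraph) (g : r.VL → G.V) : Prop :=
  ∀ v : r.VL, v.1 ∉ r.VK → G.indeg (g v) = r.L.indeg v ∧ G.outdeg (g v) = r.L.outdeg v

theorem URule.Step.dangling (st : r.toURule.inv.Step G H) : r.Dangling G st.gV := by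
  intro v hv
  have := st.finE
  have hne : ∀ a : r.VK, (⟨a.1, r.KL a.2⟩ : r.VL) ≠ v := by
    rintro a rfl
    exact hv a.2
  constructor
  · rw [HostGraph.indeg, st.glueG.card_removed st.gtgt st.dGtgt hne, RuleGraph.indeg_eq]; rfl
  · rw [HostGraph.outdeg, st.glueG.card_removed st.gsrc st.dGsrc hne, RuleGraph.outdeg_eq]; rfl

/-! ### Construction of natural double-pushouts -/

/-- Equal finite cardinalities make the injection of incident edges bijective. Thus the numerical
dangling condition says that every edge incident to a deleted node is matched. -/
theorem surjective_of_card {EX EG VX VG : Type} [Finite EG] {gE : EX → EG} {gV : VX → VG}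
    (hE : Function.Injective gE) {sX : EX → VX} {sG : EG → VG}
    (hs : ∀ e, sG (gE e) = gV (sX e)) {v : VX}
    (hc : Nat.card {e // sG e = gV v} = Nat.card {e // sX e = v}) (e : EG) (he : sG e = gV v) :
    ∃ e', gE e' = e := by
  have hinj : Function.Injective (fun e' : {e // sX e = v} =>
      (⟨gE e'.1, by rw [hs, e'.2]⟩ : {e // sG e = gV v})) := fun a b hab =>
    Subtype.ext (hE (congrArg Subtype.val hab))
  obtain ⟨e', h⟩ := ((Nat.bijective_iff_injective_and_card _).2 ⟨hinj, hc.symm⟩).2 ⟨e, he⟩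
  exact ⟨e'.1, congrArg Subtype.val h⟩

open Classical in
-- `D` is `G` without the deleted nodes and the matched edges, with labels and roots erased at the
-- interface; the result is the explicit gluing of `D` with the instance of `R`. The erasure makes
-- both squares pullbacks, and the labels kept elsewhere make them pushouts.
theorem RuleSchema.exists_produces {g : r.L.Premorphism G} {α : LabelAssignment r.τ}
    {m : (r.L.inst G g.fV α).toPGraph ⟶ G.toPGraph} (hm : r.IsMatch G g α m)
    (hd : r.Dangling G g.fV) : ∃ H, r.Produces G H g α m := by
  obtain ⟨hmV, hmE, -⟩ := hm
  have := G.finV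
  have := G.finE
  -- By the dangling condition an unmatched edge has no endpoint among the deleted nodes, so the
  -- edges of `D` end in `D`.
  have hsrc : ∀ e, (∀ e', g.fE e' ≠ e) → ∀ v : r.VL, v.1 ∉ r.VK → g.fV v ≠ G.src e := by
    intro e he v hv hve
    have hc := (hd v hv).2
    rw [HostGraph.outdeg, RuleGraph.outdeg_eq, Nat.cast_inj] at hc
    obtain ⟨e', h⟩ := surjective_of_card g.injE g.src hc e hve.symm
    exact he e' h
  have htgt : ∀ e, (∀ e', g.fE e' ≠ e) → ∀ v : r.VL, v.1 ∉ r.VK → g.fV v ≠ G.tgt e := by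
    intro e he v hv hve
    have hc := (hd v hv).1
    rw [HostGraph.indeg, RuleGraph.indeg_eq, Nat.cast_inj] at hc
    obtain ⟨e', h⟩ := surjective_of_card g.injE g.tgt hc e hve.symm
    exact he e' h
  let gK : r.VK → G.V := fun a => g.fV ⟨a.1, r.KL a.2⟩
  let D : PGraph :=
    { V := {x : G.V // ∀ v : r.VL, v.1 ∉ r.VK → g.fV v ≠ x}
      E := {e : G.E // ∀ e', g.fE e' ≠ e}
      finV := inferInstance
      finE := inferInstance
      src := fun e => ⟨G.src e.1, hsrc e.1 e.2⟩
      tgt := fun e => ⟨G.tgt e.1, htgt e.1 e.2⟩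
      labV := fun x => if ∃ a, gK a = x.1 then none else some (G.labV x.1, G.markV x.1)
      labE := fun e => (G.labE e.1, G.markE e.1)
      root := fun x => if ∃ a, gK a = x.1 then none else some (G.root x.1) }
  have hgK : ∀ a : r.VK, ∀ v : r.VL, v.1 ∉ r.VK → g.fV v ≠ gK a := by
    rintro a v hv h
    rw [g.injV h] at hv
    exact hv a.2
  let k : interfaceGraph r.VK ⟶ D :=
    PGraph.Hom.mk (G := interfaceGraph r.VK) (H := D) (fun a => ⟨gK a, hgK a⟩)
      (fun e => Empty.elim e) (fun e => Empty.elim e) (fun e => Empty.elim e)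
      (fun _ _ h => Option.noConfusion rfl (heq_of_eq h)) (fun e => Empty.elim e)
      (fun _ _ h => Option.noConfusion rfl (heq_of_eq h))
  have hlabV : ∀ x l, D.labV x = some l → some (G.labV x.1, G.markV x.1) = some l := by
    intro x l h
    have e : D.labV x = if ∃ a, gK a = x.1 then none else some (G.labV x.1, G.markV x.1) := rfl
    rw [e] at h
    split at h
    · cases h
    · exact h
  have hroot : ∀ x l, D.root x = some l → some (G.root x.1) = some l := by
    intro x l h
    have e : D.root x = if ∃ a, gK a = x.1 then none else some (G.root x.1) := rfl
    rw [e] at h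
    split at h
    · cases h
    · exact h
  let dG : D ⟶ G.toPGraph :=
    PGraph.Hom.mk (G := D) (H := G.toPGraph) Subtype.val Subtype.val (fun _ => rfl) (fun _ => rfl)
      hlabV (fun _ => rfl) hroot
  have hiL := interfaceIncl_injective r.KL r.L G g.fV α
  have hiR := interfaceIncl_injective r.KR r.R G g.fV α
  have hk : Function.Injective k.fV := fun a b hab =>
    hiL (g.injV (congrArg Subtype.val hab))
  have kl : ∀ a, D.labV (k.fV a) = none := fun a => if_pos ⟨a, rfl⟩
  have kr : ∀ a, D.root (k.fV a) = none := fun a => if_pos ⟨a, rfl⟩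
  have nkl : ∀ y, (∀ a, k.fV a ≠ y) → D.labV y ≠ none := fun y hy => by
    have : ¬ ∃ a, gK a = y.1 := not_exists.2 fun a ha => hy a (Subtype.ext ha)
    have h : D.labV y = some (G.labV y.1, G.markV y.1) := if_neg this
    rw [h]
    exact Option.some_ne_none _
  have nkr : ∀ y, (∀ a, k.fV a ≠ y) → D.root y ≠ none := fun y hy => by
    have : ¬ ∃ a, gK a = y.1 := not_exists.2 fun a ha => hy a (Subtype.ext ha)
    have h : D.root y = some (G.root y.1) := if_neg this
    rw [h]
    exact Option.some_ne_none _
  have glueG : Gluing (interfaceIncl r.KL r.L G g.fV α).fV k.fV m.fV m.fE dG.fV dG.fE := by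
    rw [hmV, hmE]
    refine ⟨g.injV, g.injE, Subtype.val_injective, Subtype.val_injective, fun _ => rfl,
      fun x => ?_, fun e => ?_, fun v y h => ?_, fun e e' h => e'.2 e h⟩
    · by_cases hx : ∃ v, g.fV v = x
      · exact Or.inl hx
      · exact Or.inr ⟨⟨x, fun v _ h => hx ⟨v, h⟩⟩, rfl⟩
    · by_cases he : ∃ e', g.fE e' = e
      · exact Or.inl he
      · exact Or.inr ⟨⟨e, fun e' h => he ⟨e', h⟩⟩, rfl⟩
    · have hv : v.1 ∈ r.VK := by
        by_contra hv
        exact y.2 v hv h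
      exact ⟨⟨v.1, hv⟩, rfl, Subtype.ext h⟩
  have nlab : ∀ a l, D.labV (k.fV a) = some l →
      (r.R.inst G g.fV α).toPGraph.labV ((interfaceIncl r.KR r.R G g.fV α).fV a) = some l :=
    fun a l h => by rw [kl] at h; cases h
  have nroot : ∀ a l, D.root (k.fV a) = some l →
      (r.R.inst G g.fV α).toPGraph.root ((interfaceIncl r.KR r.R G g.fV α).fV a) = some l :=
    fun a l h => by rw [kr] at h; cases h
  -- The gluing is totally labelled, hence a host graph: interface nodes take their labels from `R`,
  -- and the other nodes of `D` have kept theirs.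
  obtain ⟨H, hH⟩ := (glued (interfaceIncl r.KR r.R G g.fV α) k).exists_hostGraph (by
      rintro (y | v)
      · by_cases hy : ∃ a, k.fV a = y
        · obtain ⟨a, rfl⟩ := hy
          rw [glued_labV_interface hk]
          exact Option.some_ne_none _
        · rw [glued_labV_outside (not_exists.1 hy)]
          exact nkl y (not_exists.1 hy)
      · exact Option.some_ne_none _) (by
      rintro (y | v)
      · by_cases hy : ∃ a, k.fV a = y
        · obtain ⟨a, rfl⟩ := hy
          rw [glued_root_interface hk]
          exact Option.some_ne_none _
        · rw [glued_root_outside (not_exists.1 hy)]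
          exact nkr y (not_exists.1 hy)
      · exact Option.some_ne_none _)
  have glueH : ∃ (gs : (r.R.inst G g.fV α).toPGraph ⟶ H.toPGraph) (dH : D ⟶ H.toPGraph),
      Gluing (interfaceIncl r.KR r.R G g.fV α).fV k.fV gs.fV gs.fE dH.fV dH.fE := by
    rw [hH]
    exact ⟨_, _, gluing_glued hiR hk nlab nroot⟩
  obtain ⟨gs, dH, glueH⟩ := glueH
  exact ⟨H, D, k, dG, dH, gs, isPushout_of_gluing glueG nkl nkr,
    isPullback_of_gluing hiL glueG kl kr, isPushout_of_gluing glueH nkl nkr,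
    isPullback_of_gluing hiR glueH kl kr⟩

/-! ### Matches and assignments -/

theorem Wild.agree_mk {M : Type} [DecidableEq M] {nomark a : M} {q : Wild M} :
    Wild.agree nomark (.mk a) q = true ↔ q = .mk a ∨ q = .any ∧ a ≠ nomark := by
  cases q with
  | any => simp [Wild.agree]
  | mk b =>
    simp only [Wild.agree, decide_eq_true_eq, Wild.mk.injEq, reduceCtorEq, false_and, or_false]
    exact eq_comm

/-- The truth of `Γ`, the specification of the left-hand graph, and the dangling condition. -/
def RuleSchema.Matches (r : RuleSchema)
    (a : Assignment (Sig.over r.p r.VL r.EL) G 0 0 0) : Prop :=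
  Form.sat a r.Γ.toForm ∧ Form.sat a r.toURule.inv.spec ∧ Form.sat a r.toURule.inv.inv.dang

theorem RuleSchema.Matches.exists_isMatch {a : Assignment (Sig.over r.p r.VL r.EL) G 0 0 0}
    (h : r.Matches a) (hV : Function.Injective a.nd) (hE : Function.Injective a.ed) :
    ∃ g α m, r.IsMatch G g α m ∧ r.Dangling G g.fV ∧ g.fV = a.nd ∧ g.fE = a.ed ∧
      α.val = a.lb := by
  classical
  obtain ⟨hΓ, hspec, hdang⟩ := h
  obtain ⟨hval, hnode, hedge⟩ := (r.sat_spec a).1 hspec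
  let g : r.L.Premorphism G :=
    { fV := a.nd
      fE := a.ed
      src := fun e => (hedge e).1
      tgt := fun e => (hedge e).2.1
      root := fun v => (hnode v).2.2
      injV := hV
      injE := hE }
  let α : LabelAssignment r.τ :=
    { val := a.lb
      val_mem := hval
      -- A wildcard takes the mark found in `G`, which the specification forces to be different from
      -- `none`. Elsewhere `red` is an arbitrary choice subject to the same restriction.
      muV := fun n => if h : ∃ hn : n ∈ r.VL, r.L.markV ⟨n, hn⟩ = .any
        then G.markV (a.nd ⟨n, h.1⟩) else .red
      muE := fun n => if h : ∃ hn : n ∈ r.EL, r.L.markE ⟨n, hn⟩ = .any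
        then G.markE (a.ed ⟨n, h.1⟩) else .red
      muV_ne := fun n => by
        split
        · rename_i h
          obtain ⟨hn, h⟩ := h
          have := (hnode ⟨n, hn⟩).2.1
          rw [h, Wild.agree_mk] at this
          simpa using this
        · simp
      muE_ne := fun n => by
        split
        · rename_i h
          obtain ⟨hn, h⟩ := h
          have := (hedge ⟨n, hn⟩).2.2.2
          rw [h, Wild.agree_mk] at this
          simpa using this
        · simp }
  have markV : ∀ v : r.VL, G.markV (a.nd v) = (r.L.markV v).resolve (α.muV v.1) := fun v => by
    rcases Wild.agree_mk.1 (hnode v).2.1 with h | ⟨h, -⟩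
    · rw [h]; rfl
    · have h' : ∃ hn : v.1 ∈ r.VL, r.L.markV ⟨v.1, hn⟩ = .any := ⟨v.2, h⟩
      have h2 : α.muV v.1 = G.markV (a.nd ⟨v.1, h'.1⟩) := dif_pos h'
      rw [h]
      exact h2.symm
  have markE : ∀ v : r.EL, G.markE (a.ed v) = (r.L.markE v).resolve (α.muE v.1) := fun v => by
    rcases Wild.agree_mk.1 (hedge v).2.2.2 with h | ⟨h, -⟩
    · rw [h]; rfl
    · have h' : ∃ hn : v.1 ∈ r.EL, r.L.markE ⟨v.1, hn⟩ = .any := ⟨v.2, h⟩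
      have h2 : α.muE v.1 = G.markE (a.ed ⟨v.1, h'.1⟩) := dif_pos h'
      rw [h]
      exact h2.symm
  let m : (r.L.inst G g.fV α).toPGraph ⟶ G.toPGraph :=
    PGraph.Hom.mk (G := (r.L.inst G g.fV α).toPGraph) (H := G.toPGraph) a.nd a.ed
      (fun e => (hedge e).1) (fun e => (hedge e).2.1)
      (fun v l hl => (congrArg some (Prod.ext (hnode v).1 (markV v))).trans hl)
      (fun e => Prod.ext (hedge e).2.2.1 (markE e))
      (fun v l hl => (congrArg some (hnode v).2.2).trans hl)
  exact ⟨g, α, m, ⟨rfl, rfl, (Cond.sat_toForm hval a rfl _).1 hΓ⟩,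
    (URule.sat_dang (u := r.toURule.inv.inv) a).1 hdang, rfl, rfl, rfl⟩

theorem RuleSchema.IsMatch.matches {g : r.L.Premorphism G} {α : LabelAssignment r.τ}
    {m : (r.L.inst G g.fV α).toPGraph ⟶ G.toPGraph} (hm : r.IsMatch G g α m)
    (hd : r.Dangling G g.fV) (a : Assignment (Sig.over r.p r.VL r.EL) G 0 0 0)
    (hnd : a.nd = g.fV) (hed : a.ed = g.fE) (hlb : a.lb = α.val) : r.Matches a := by
  have hΓ := hm.2.2
  have hval : ∀ x, a.lb x ∈ (r.τ x).dom := fun x => by rw [hlb]; exact α.val_mem x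
  have glabV := hm.labV_markV
  have glabE := hm.labE_markE
  refine ⟨(Cond.sat_toForm hval a rfl _).2 (by rw [hnd, hlb]; exact hΓ), ?_, ?_⟩
  · rw [r.sat_spec, hnd, hed, hlb]
    refine ⟨α.val_mem, fun v => ⟨congrArg Prod.fst (glabV v), ?_, g.root v⟩, fun e =>
      ⟨g.src e, g.tgt e, congrArg Prod.fst (glabE e), ?_⟩⟩
    · have : G.markV (g.fV v) = _ := congrArg Prod.snd (glabV v)
      rw [this, Wild.agree_mk]
      cases r.L.markV v with
      | mk q => exact Or.inl rfl
      | any => exact Or.inr ⟨rfl, α.muV_ne _⟩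
    · have : G.markE (g.fE e) = _ := congrArg Prod.snd (glabE e)
      rw [this, Wild.agree_mk]
      cases r.L.markE e with
      | mk q => exact Or.inl rfl
      | any => exact Or.inr ⟨rfl, α.muE_ne _⟩
  · refine (URule.sat_dang (u := r.toURule.inv.inv) a).2 ?_
    rw [hnd]
    exact hd

/-! ### Strongest liberal postconditions of the inverse rule -/

/-- The truth value in `G` depends only on the match, while `H` is an arbitrary result of it; so any
one result may be used to evaluate the formula. -/
theorem RuleSchema.Produces.sat_adj_lift {g : r.L.Premorphism G} {α : LabelAssignment r.τ}
    {m : (r.L.inst G g.fV α).toPGraph ⟶ G.toPGraph} (hm : r.IsMatch G g α m)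
    (h : r.Produces G H g α m) (c : Sentence)
    (a : Assignment (Sig.over r.p r.VL r.EL) G 0 0 0)
    (hnd : a.nd = g.fV) (hed : a.ed = g.fE) (hlb : a.lb = α.val) :
    Form.sat a (r.toURule.inv.adj (lift c r.gen.inv)) ↔ Models H c := by
  obtain ⟨st, h1, h2, h3⟩ := h.exists_step hm
  let b : Assignment r.toURule.inv.sigL H 0 0 0 :=
    ⟨st.hV, st.hE, st.val, Empty.elim, Fin.elim0, Fin.elim0, Fin.elim0⟩
  -- The argument `trivial` proves the left condition of the inverse generalised rule, which is
  -- `tt`.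
  have key : ∀ b' : Assignment Sig.closed H 0 0 0, _ ↔ c.sat b' := fun b' =>
    URule.Step.sat_adj_lift (w := r.gen.inv) st c a (hnd.trans h1.symm)
      (hed.trans h2.symm) (hlb.trans h3.symm) b rfl rfl rfl trivial b'
  constructor
  · exact fun hs => ⟨⟨Empty.elim, Empty.elim, Empty.elim, Empty.elim, Fin.elim0, Fin.elim0,
      Fin.elim0⟩, (key _).1 hs⟩
  · rintro ⟨b', hb'⟩
    exact (key b').2 hb'

/-- A satisfying assignment yields a match with the dangling condition, and hence some result, at
which `c` must hold. Conversely, the match behind a result is a satisfying assignment, its dangling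
condition being a consequence of the gluing. -/
theorem models_slpInv (c : Sentence) (r : RuleSchema) (G : HostGraph) :
    Models G (slpInv c r) ↔ ∃ H ∈ r.results G, Models H c := by
  refine (models_closure (p := r.p) (V := r.VL) (E := r.EL) (shift c r.gen.inv) G).trans ?_
  constructor
  · rintro ⟨a, hV, hE, h1, h2⟩
    obtain ⟨g, α, m, hm, hd, e1, e2, e3⟩ :=
      RuleSchema.Matches.exists_isMatch (r := r) (a := a) h2 hV hE
    obtain ⟨H, hH⟩ := RuleSchema.exists_produces hm hd
    exact ⟨H, RuleSchema.mem_results.2 ⟨g, α, m, hm, hH⟩,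
      (hH.sat_adj_lift hm c a e1.symm e2.symm e3.symm).1 h1⟩
  · rintro ⟨H, hH, hc⟩
    obtain ⟨g, α, m, hm, hH⟩ := RuleSchema.mem_results.1 hH
    have hd : r.Dangling G g.fV := by
      obtain ⟨st, h1, -⟩ := hH.exists_step hm
      rw [← h1]
      exact st.dangling
    let a : Assignment (Sig.over r.p r.VL r.EL) G 0 0 0 :=
      ⟨g.fV, g.fE, α.val, Empty.elim, Fin.elim0, Fin.elim0, Fin.elim0⟩
    exact ⟨a, g.injV, g.injE, (hH.sat_adj_lift hm c a rfl rfl rfl).2 hc,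
      hm.matches hd a rfl rfl rfl⟩

/-- `Models` quantifies existentially over assignments. In the closed signature there is exactly
one, so the quantifier commutes with negation. -/
theorem models_not (c : Sentence) (G : HostGraph) : Models G (.not c) ↔ ¬ Models G c := by
  have huniq : ∀ a b : Assignment Sig.closed G 0 0 0, a = b := fun a b => by
    cases a; cases b
    simp only [Assignment.mk.injEq]
    exact ⟨funext fun x => x.elim, funext fun x => x.elim, funext fun x => x.elim,
      funext fun x => x.elim, funext fun x => x.elim0, funext fun x => x.elim0,
      funext fun x => x.elim0⟩
  constructor
  · rintro ⟨a, ha⟩ ⟨b, hb⟩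
    exact ha (huniq b a ▸ hb)
  · exact fun h => ⟨⟨Empty.elim, Empty.elim, Empty.elim, Empty.elim, Fin.elim0, Fin.elim0,
      Fin.elim0⟩, fun h' => h ⟨_, h'⟩⟩

end GP2

theorem mainTheorem3 (d : GP2.Sentence) (r : GP2.RuleSchema) :
    GP2.IsWLP r.results (fun H => GP2.Models H d)
        (fun G => GP2.Models G (.not (GP2.slpInv (.not d) r))) ∧
      ∀ W : GP2.HostGraph → Prop, GP2.IsWLP r.results (fun H => GP2.Models H d) W →
        ∀ G : GP2.HostGraph, GP2.Models G (.not (GP2.slpInv (.not d) r)) ↔ W G := by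
  have key : ∀ G : GP2.HostGraph, GP2.Models G (.not (GP2.slpInv (.not d) r)) ↔
      ∀ H ∈ r.results G, GP2.Models H d := fun G => by
    simp only [GP2.models_not, GP2.models_slpInv, not_exists, not_and, not_not]
  have hW : GP2.IsWLP r.results (fun H => GP2.Models H d)
      (fun G => GP2.Models G (.not (GP2.slpInv (.not d) r))) :=
    ⟨fun G H hG hH => (key G).1 hG H hH, fun c hc G hG => (key G).2 fun H hH => hc G H hG hH⟩
  -- Each of two weakest liberal preconditions is a liberal precondition and therefore implies the
  -- other.
  exact ⟨hW, fun W hW' G => ⟨hW'.2 _ hW.1 G, hW.2 W hW'.1 G⟩⟩
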